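/- Proposition (Input-Output Relation). Let $\mathfrak{h}_S$ and $\mathfrak{f}_B$ be complex Hilbert spaces, and let $\Gamma(\mathfrak{f}_B)=\bigoplus_{n\ge 0}\otimes^n_{\mathrm{symm}}\mathfrak{f}_B$ be the Bose Fock space over $\mathfrak{f}_B$, with creation and annihilation operators $a(g)^*$, $a(g)$ and differential second quantization $d\Gamma$. Inner products are conjugate linear in the first argument. Let $H=H^*$ and $L$ be bounded operators on $\mathfrak{h}_S$, let $h_B$ be a (possibly unbounded) self-adjoint operator on $\mathfrak{f}_B$, and let $g\in\mathfrak{f}_B$. On $\mathfrak{h}_S\otimes\Gamma(\mathfrak{f}_B)$ put $$H_0=I\otimes d\Gamma(h_B),\qquad H_{\mathrm{Tot}}=H\otimes I+I\otimes d\Gamma(h_B)+iL\otimes a(g)^*-iL^*\otimes a(g)$$ (the closures of the operators defined on the algebraic tensor products of the natural domains), and $$U_t=e^{itH_0}e^{-itH_{\mathrm{Tot}}},\quad g_t=e^{ith_B}g,\quad K(t,s)=\langle g_t\,|\,g_s\rangle,$$ $$j_t(X)=U_t^*(X\otimes I)U_t,\quad Z_{\mathrm{in}}(t)=I\otimes a(g_t)^*,\quad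 Z_{\mathrm{out}}(t)=U_t^*Z_{\mathrm{in}}(t)U_t .$$ Then for every $t\in\mathbb{R}$ $$Z_{\mathrm{out}}(t)^*=Z_{\mathrm{in}}(t)^*+\int_0^t K(t,\tau)\,j_\tau(L)\,d\tau$$ as an equality of unbounded operators: the two adjoints have the same domain, for every vector $\psi$ the function $\tau\mapsto K(t,\tau)j_\tau(L)\psi$ is integrable between $0$ and $t$, and for every $\psi$ in the common domain $Z_{\mathrm{out}}(t)^*\psi=Z_{\mathrm{in}}(t)^*\psi+\int_0^tK(t,\tau)j_\tau(L)\psi\,d\tau$. -/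

import Mathlib

open scoped TensorProduct InnerProductSpace LinearPMap

noncomputable section

universe u v

namespace OpenSystem

/-! ### Unitary groups and operators on Hilbert space tensor products -/

section Operators

variable {E : Type u} [NormedAddCommGroup E] [InnerProductSpace ℂ E]
variable {F : Type v} [NormedAddCommGroup F] [InnerProductSpace ℂ F]

/-- `U` is a strongly continuous one-parameter unitary group on `E` whose generator is the
(unbounded) operator `A`, in the convention `U t = e ^ (-i t A)`: a vector `ψ` lies in the domain of
`A` if and only if `t ↦ U t ψ` is differentiable at `0`, and the derivative is then `-i A ψ`. -/
structure IsUnitaryGroupOf [CompleteSpace E] (A : E →ₗ.[ℂ] E) (U : ℝ → E →L[ℂ] E) : Prop where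
  unitary : ∀ t, U t ∈ unitary (E →L[ℂ] E)
  zero : U 0 = 1
  add : ∀ s t, U (s + t) = U s * U t
  continuous : ∀ ψ, Continuous fun t => U t ψ
  generator : ∀ ψ φ, (ψ, φ) ∈ A.graph ↔ HasDerivAt (fun t => U t ψ) (-Complex.I • φ) 0

open Classical in
/-- The operator `e ^ (-i t A)` for a self-adjoint, possibly unbounded, operator `A`: the value at
`t` of the strongly continuous unitary group generated by `A`. (By Stone's theorem this group exists
and is unique when `A` is self-adjoint; the value is `0` if no such group exists.) -/
def expNegI [CompleteSpace E] (A : E →ₗ.[ℂ] E) (t : ℝ) : E →L[ℂ] E :=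
  if h : ∃ U, IsUnitaryGroupOf A U then h.choose t else 0

/-- A bounded operator, as an everywhere defined partial operator. -/
def bdd (X : E →L[ℂ] E) : E →ₗ.[ℂ] E := X.toLinearMap.toPMap ⊤

variable (E F) in
/-- The Hilbert space tensor product. -/
abbrev HTensor : Type (max u v) := UniformSpace.Completion (E ⊗[ℂ] F)

/-- The inclusion of the algebraic tensor product of two subspaces into the Hilbert space tensor
product. -/
def tensorIncl (P : Submodule ℂ E) (Q : Submodule ℂ F) : (P ⊗[ℂ] Q) →ₗᵢ[ℂ] HTensor E F :=
  UniformSpace.Completion.toComplₗᵢ.comp (TensorProduct.mapInclIsometry P Q)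

/-- The algebraic tensor product of two (unbounded) operators: its domain is the algebraic tensor
product of the domains, and it sends `x ⊗ y` to `A x ⊗ B y`. -/
def tensorOp (A : E →ₗ.[ℂ] E) (B : F →ₗ.[ℂ] F) : HTensor E F →ₗ.[ℂ] HTensor E F where
  domain := LinearMap.range (tensorIncl A.domain B.domain).toLinearMap
  toFun :=
    (UniformSpace.Completion.toComplₗᵢ (𝕜 := ℂ) (E := E ⊗[ℂ] F)).toLinearMap ∘ₗ
      TensorProduct.map A.toFun B.toFun ∘ₗ
        (LinearEquiv.ofInjective (tensorIncl A.domain B.domain).toLinearMap <| by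
          exact fun _ _ hab => LinearIsometry.injective (tensorIncl A.domain B.domain) hab).symm.toLinearMap

/-- The operator `A ⊗ 1 + 1 ⊗ B` as a closed operator: the closure of the sum on the algebraic tensor
product of the domains. -/
def tensorSum (A : E →ₗ.[ℂ] E) (B : F →ₗ.[ℂ] F) : HTensor E F →ₗ.[ℂ] HTensor E F :=
  (tensorOp A (bdd 1) + tensorOp (bdd 1) B).closure

variable (F) in
/-- The bounded operator `X ⊗ 1` on the Hilbert space tensor product. -/
def ampliation (X : E →L[ℂ] E) : HTensor E F →L[ℂ] HTensor E F :=
  (X.rTensor F).completion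

/-- The operator `U* Z U`, for `U` bounded and `Z` unbounded, with domain `{ψ | U ψ ∈ dom Z}`. -/
def conjOp [CompleteSpace E] (U : E →L[ℂ] E) (Z : E →ₗ.[ℂ] E) : E →ₗ.[ℂ] E where
  domain := Z.domain.comap U.toLinearMap
  toFun := (ContinuousLinearMap.adjoint U).toLinearMap ∘ₗ Z.toFun ∘ₗ
    U.toLinearMap.restrict (p := Z.domain.comap U.toLinearMap) (q := Z.domain) fun _ h => h

end Operators

/-! ### The symmetric Fock space -/

/-- Hilbert spaces, bundled; used only to form tensor powers by recursion. -/
structure HilbertSp : Type (u + 1) where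
  carrier : Type u
  [normed : NormedAddCommGroup carrier]
  [inner : InnerProductSpace ℂ carrier]
  [complete : CompleteSpace carrier]

attribute [instance] HilbertSp.normed HilbertSp.inner HilbertSp.complete

section Fock

variable (f : Type u) [NormedAddCommGroup f] [InnerProductSpace ℂ f]

/-- The `n`-fold Hilbert space tensor power of `f`, bundled: one-dimensional for `n = 0`, and
`f ⊗ (n-th power)` for `n + 1`. -/
def tensorPowSp : ℕ → HilbertSp.{u}
  | 0 => ⟨EuclideanSpace ℂ PUnit.{u + 1}⟩
  | n + 1 => ⟨HTensor f (tensorPowSp n).carrier⟩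

/-- The `n`-fold Hilbert space tensor power of `f`. -/
abbrev TensorPow (n : ℕ) : Type u := (tensorPowSp f n).carrier

variable {f} in
/-- Tensoring with `g` on the left, `ψ ↦ g ⊗ ψ`. -/
def tensorLeft (g : f) (n : ℕ) : TensorPow f n →L[ℂ] TensorPow f (n + 1) :=
  (UniformSpace.Completion.toComplL : (f ⊗[ℂ] TensorPow f n) →L[ℂ] HTensor f (TensorPow f n)) ∘L
    TensorProduct.mkL ℂ f (TensorPow f n) g

variable {f} in
/-- The vector `x ⊗ ⋯ ⊗ x` (`n` factors). -/
def tpow (x : f) : (n : ℕ) → TensorPow f n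
  | 0 => EuclideanSpace.single PUnit.unit (1 : ℂ)
  | n + 1 => tensorLeft x n (tpow x n)

/-- The `n`-particle space: the subspace of symmetric tensors in the `n`-fold tensor power. By
polarization it is the closed linear span of the vectors `x ⊗ ⋯ ⊗ x`. -/
def symPow (n : ℕ) : Submodule ℂ (TensorPow f n) :=
  (Submodule.span ℂ (Set.range fun x : f => tpow x n)).topologicalClosure

instance (n : ℕ) : CompleteSpace (symPow f n) :=
  (Submodule.isClosed_topologicalClosure _).completeSpace_coe

/-- The symmetric (Bose) Fock space over `f`: the Hilbert space direct sum of the `n`-particle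
spaces. -/
abbrev Fock : Type u := lp (fun n : ℕ => symPow f n) 2

variable {f}

/-- The creation operator from the `n`-particle to the `(n+1)`-particle space,
`ψ ↦ √(n+1) P (g ⊗ ψ)`, with `P` the orthogonal projection onto the symmetric tensors. -/
def createN (g : f) (n : ℕ) : symPow f n →L[ℂ] symPow f (n + 1) :=
  ((Real.sqrt (n + 1) : ℝ) : ℂ) •
    ((symPow f (n + 1)).orthogonalProjectionOnto ∘L tensorLeft g n ∘L (symPow f n).subtypeL)

/-- The components of the creation operator applied to a sequence of `n`-particle vectors. -/
def createSeq (g : f) : (∀ n, symPow f n) →ₗ[ℂ] ∀ n, symPow f n :=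
  LinearMap.pi fun n => match n with
    | 0 => 0
    | n + 1 => (createN g n).toLinearMap ∘ₗ LinearMap.proj n

/-- The creation operator `a(g)*` on Fock space, on its maximal domain. -/
def creation (g : f) : Fock f →ₗ.[ℂ] Fock f where
  domain :=
    { carrier := {ψ | Memℓp (createSeq g ψ) 2}
      zero_mem' := by
        change Memℓp (createSeq g 0) 2
        rw [map_zero]; exact zero_memℓp
      add_mem' := fun {a b} ha hb => by
        change Memℓp (createSeq g (a + b)) 2
        rw [map_add]; exact Memℓp.add ha hb
      smul_mem' := fun c a ha => by
        change Memℓp (createSeq g (c • (a : ∀ n, symPow f n))) 2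
        rw [map_smul]; exact Memℓp.const_smul ha c }
  toFun :=
    { toFun := fun ψ => ⟨createSeq g (ψ : Fock f), ψ.2⟩
      map_add' := fun a b => by
        ext1; exact map_add (createSeq g) (a : Fock f).1 (b : Fock f).1
      map_smul' := fun c a => by
        ext1; exact map_smul (createSeq g) c (a : Fock f).1 }

/-- The annihilation operator `a(g)` on Fock space: the adjoint of the creation operator. -/
def annihilation (g : f) : Fock f →ₗ.[ℂ] Fock f := (creation g)†

/-- The operator `∑ j, 1 ⊗ ⋯ ⊗ h ⊗ ⋯ ⊗ 1` (`h` in the `j`-th place, `j = 1, …, n`) on the `n`-fold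
tensor power, as a closed operator. -/
def secondQuantN (h : f →ₗ.[ℂ] f) : (n : ℕ) → TensorPow f n →ₗ.[ℂ] TensorPow f n
  | 0 => 0
  | n + 1 => tensorSum h (secondQuantN h n)

/-- The graph of the differential second quantization of `h`: `h` acts as `secondQuantN h n` on each
`n`-particle component. -/
def secondQuantGraph (h : f →ₗ.[ℂ] f) : Submodule ℂ (Fock f × Fock f) where
  carrier := {p | ∀ n, ((p.1 n : TensorPow f n), (p.2 n : TensorPow f n)) ∈ (secondQuantN h n).graph}
  zero_mem' := fun n => (secondQuantN h n).graph.zero_mem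
  add_mem' := fun ha hb n => (secondQuantN h n).graph.add_mem (ha n) (hb n)
  smul_mem' := fun c _ ha n => (secondQuantN h n).graph.smul_mem c (ha n)

/-- The differential second quantization `dΓ(h)` on Fock space, on its maximal domain: the direct sum
of the operators `∑ j, 1 ⊗ ⋯ ⊗ h ⊗ ⋯ ⊗ 1` on the `n`-particle spaces. -/
def secondQuant (h : f →ₗ.[ℂ] f) : Fock f →ₗ.[ℂ] Fock f := (secondQuantGraph h).toLinearPMap

/-- `secondQuantGraph h` is the graph of an operator, so that `secondQuant h` is not a default
value. -/
theorem secondQuant_graph (h : f →ₗ.[ℂ] f) : (secondQuant h).graph = secondQuantGraph h := by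
  refine Submodule.toLinearPMap_graph_eq _ fun p hp hp0 => ?_
  ext n
  refine LinearPMap.graph_fst_eq_zero_snd _ (hp n) ?_
  rw [hp0]
  rfl

end Fock

/-! ### The system coupled to the bath -/

section Model

variable {𝓗 : Type u} [NormedAddCommGroup 𝓗] [InnerProductSpace ℂ 𝓗] [CompleteSpace 𝓗]
variable {f : Type v} [NormedAddCommGroup f] [InnerProductSpace ℂ f] [CompleteSpace f]

variable (𝓗 f) in
/-- The Hilbert space of system and bath together. -/
abbrev Total : Type (max u v) := HTensor 𝓗 (Fock f)

variable (𝓗) in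
/-- The free Hamiltonian `H₀ = 1 ⊗ dΓ(h)`. -/
def freeHam (h : f →ₗ.[ℂ] f) : Total 𝓗 f →ₗ.[ℂ] Total 𝓗 f :=
  (tensorOp (bdd 1) (secondQuant h)).closure

/-- The total Hamiltonian `H ⊗ 1 + 1 ⊗ dΓ(h) + i L ⊗ a(g)* - i L* ⊗ a(g)`: the closure of the sum
on the intersection of the domains of its terms. -/
def totalHam (H L : 𝓗 →L[ℂ] 𝓗) (h : f →ₗ.[ℂ] f) (g : f) : Total 𝓗 f →ₗ.[ℂ] Total 𝓗 f :=
  (tensorOp (bdd H) (bdd 1) + tensorOp (bdd 1) (secondQuant h)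
    + Complex.I • tensorOp (bdd L) (creation g)
    - Complex.I • tensorOp (bdd (ContinuousLinearMap.adjoint L)) (annihilation g)).closure

/-- The interaction picture evolution `U_t = e ^ (i t H₀) e ^ (-i t H_tot)`. -/
def evol (H L : 𝓗 →L[ℂ] 𝓗) (h : f →ₗ.[ℂ] f) (g : f) (t : ℝ) : Total 𝓗 f →L[ℂ] Total 𝓗 f :=
  expNegI (freeHam 𝓗 h) (-t) * expNegI (totalHam H L h g) t

/-- The evolved one-particle vector `g_t = e ^ (i t h) g`. -/
def gAt (h : f →ₗ.[ℂ] f) (g : f) (t : ℝ) : f := expNegI h (-t) g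

/-- The bath correlation function `K(t, s) = ⟨g_t, g_s⟩` (conjugate linear in the first entry). -/
def bathKernel (h : f →ₗ.[ℂ] f) (g : f) (t s : ℝ) : ℂ := ⟪gAt h g t, gAt h g s⟫_ℂ

/-- The Heisenberg picture operator `j_t(X) = U_t* (X ⊗ 1) U_t`. -/
def heis (H L : 𝓗 →L[ℂ] 𝓗) (h : f →ₗ.[ℂ] f) (g : f) (t : ℝ) (X : 𝓗 →L[ℂ] 𝓗) :
    Total 𝓗 f →L[ℂ] Total 𝓗 f :=
  ContinuousLinearMap.adjoint (evol H L h g t) * ampliation (Fock f) X * evol H L h g t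

variable (𝓗) in
/-- The input process `Z_in(t) = 1 ⊗ a(g_t)*`, as a closed operator. -/
def Zin (h : f →ₗ.[ℂ] f) (g : f) (t : ℝ) : Total 𝓗 f →ₗ.[ℂ] Total 𝓗 f :=
  (tensorOp (bdd 1) (creation (gAt h g t))).closure

/-- The output process `Z_out(t) = U_t* Z_in(t) U_t`. -/
def Zout (H L : 𝓗 →L[ℂ] 𝓗) (h : f →ₗ.[ℂ] f) (g : f) (t : ℝ) : Total 𝓗 f →ₗ.[ℂ] Total 𝓗 f :=
  conjOp (evol H L h g t) (Zin 𝓗 h g t)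

end Model

end OpenSystem

end

open scoped TensorProduct InnerProductSpace LinearPMap

noncomputable section

set_option linter.unusedSectionVars false

namespace OpenSystem


/-! ### Unitary groups and their generators -/

section UnitaryGroups

variable {E : Type*} [NormedAddCommGroup E] [InnerProductSpace ℂ E] [CompleteSpace E]

open MeasureTheory Filter Topology

/-! Write Γ_t = e^{-itH₀}, so that U_t = Γ_{-t} e^{-itH_Tot}. Formally i dU_t/dt = V_t U_t with V_s
= H⊗1 + iL⊗a(g_s)* - iL*⊗a(g_s). By the canonical commutation relations [V_s, 1⊗a(k)*] = -i⟪g_s,k⟫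
L*⊗1, which is bounded although neither factor is. Hence U_t*(1⊗a(k)*)U_t = 1⊗a(k)* + ∫₀ᵗ ⟪g_s,k⟫
j_s(L*) ds, and the adjoint of this identity at k = g_t is the claim. The work lies in the domains.

Vectors of finite particle number carry the analysis. On at most n particles V_s is bounded by
c√(n+1), and it adds at most one particle. The k-th Dyson term started from m particles is therefore
at most (c|t|)^k ∏_{j≤k} √(m+j) / k! times the norm of the vector, and the series converges for
every t (`summable_dysonMaj`). Differentiating matrix elements between partial sums gives the
Heisenberg equation for the full sums (`inner_dysonSum_ladder`); with the identity in place of the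
creation operator, the same lemma shows that the series is isometric. An isometric bounded solution
of the Schrödinger equation rules out deficiency vectors of H_Tot (`IsPerturbation.isSymmSurj`).
Stone's theorem (`IsSymmSurj.exists_isUnitaryGroupOf`) then supplies e^{-itH_Tot}, which matters
because `expNegI` is 0 if no group exists, and uniqueness for the Schrödinger equation identifies
U_t with the Dyson sum (`IsPerturbation.apply_eq_dysonSum`).

Finite-particle vectors form a core of 1⊗a(k)*, so membership in the graph of its adjoint is a
family of bounded conditions, one for each truncation (`mem_graph_adjoint_tensorOp_creation`). U_t
does not preserve finite particle number, but the partial Dyson sums have it, and passing to the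
limit turns an adjoint pair at U_t ψ into one at ψ, with the integral subtracted
(`isAdjointPair_heisenberg`). This yields the formula and one inclusion of domains. The other
inclusion is the same statement at time -t, carried along by Γ_t, because U_{-t} Γ_t U_t = Γ_t
(`exists_isAdjointPair_evol`).

Self-adjointness is used throughout as symmetry together with surjectivity of A + ic for every real
c ≠ 0 (`IsSymmSurj`). -/

/-- A strongly continuous one-parameter unitary group. -/
structure IsUnitaryGroup (U : ℝ → E →L[ℂ] E) : Prop where
  unitary : ∀ t, U t ∈ unitary (E →L[ℂ] E)
  zero : U 0 = 1
  add : ∀ s t, U (s + t) = U s * U t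
  continuous : ∀ ψ, Continuous fun t => U t ψ

theorem IsUnitaryGroupOf.isUnitaryGroup {A : E →ₗ.[ℂ] E} {U : ℝ → E →L[ℂ] E}
    (h : IsUnitaryGroupOf A U) : IsUnitaryGroup U :=
  ⟨h.unitary, h.zero, h.add, h.continuous⟩

theorem norm_apply_of_mem_unitary {V : E →L[ℂ] E} (hV : V ∈ unitary (E →L[ℂ] E)) (x : E) :
    ‖V x‖ = ‖x‖ :=
  ContinuousLinearMap.norm_map_of_mem_unitary hV x

theorem inner_apply_apply_of_mem_unitary {V : E →L[ℂ] E} (hV : V ∈ unitary (E →L[ℂ] E))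
    (x y : E) : ⟪V x, V y⟫_ℂ = ⟪x, y⟫_ℂ :=
  ContinuousLinearMap.inner_map_map_of_mem_unitary hV x y

namespace IsUnitaryGroup

variable {U : ℝ → E →L[ℂ] E}

theorem norm_apply (hU : IsUnitaryGroup U) (t : ℝ) (x : E) : ‖U t x‖ = ‖x‖ :=
  norm_apply_of_mem_unitary (hU.unitary t) x

theorem inner_apply_apply (hU : IsUnitaryGroup U) (t : ℝ) (x y : E) :
    ⟪U t x, U t y⟫_ℂ = ⟪x, y⟫_ℂ :=
  inner_apply_apply_of_mem_unitary (hU.unitary t) x y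

theorem apply_add (hU : IsUnitaryGroup U) (s t : ℝ) (x : E) : U (s + t) x = U s (U t x) := by
  rw [hU.add]; rfl

theorem apply_zero (hU : IsUnitaryGroup U) (x : E) : U 0 x = x := by
  rw [hU.zero]; rfl

theorem apply_neg_apply (hU : IsUnitaryGroup U) (t : ℝ) (x : E) : U (-t) (U t x) = x := by
  rw [← hU.apply_add, neg_add_cancel, hU.apply_zero]

theorem apply_apply_neg (hU : IsUnitaryGroup U) (t : ℝ) (x : E) : U t (U (-t) x) = x := by
  rw [← hU.apply_add, add_neg_cancel, hU.apply_zero]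

theorem inner_apply_left (hU : IsUnitaryGroup U) (t : ℝ) (x y : E) :
    ⟪U t x, y⟫_ℂ = ⟪x, U (-t) y⟫_ℂ := by
  rw [← hU.inner_apply_apply (-t), hU.apply_neg_apply]

theorem adjoint_eq (hU : IsUnitaryGroup U) (t : ℝ) :
    ContinuousLinearMap.adjoint (U t) = U (-t) := by
  refine ((ContinuousLinearMap.eq_adjoint_iff _ _).2 fun x y => ?_).symm
  rw [hU.inner_apply_left, neg_neg]

/-- A strongly continuous group depends jointly continuously on time and vector. -/
theorem continuous_comp (hU : IsUnitaryGroup U) {X : Type*} [TopologicalSpace X] {τ : X → ℝ}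
    {x : X → E} (hτ : Continuous τ) (hx : Continuous x) :
    Continuous fun s => U (τ s) (x s) := by
  rw [continuous_iff_continuousAt]
  intro s
  have h1 : Tendsto (fun r => U (τ r) (x s)) (𝓝 s) (𝓝 (U (τ s) (x s))) :=
    ((hU.continuous (x s)).comp hτ).tendsto s
  have h2 : Tendsto (fun r => U (τ r) (x r - x s)) (𝓝 s) (𝓝 0) := by
    rw [tendsto_zero_iff_norm_tendsto_zero]
    simp only [hU.norm_apply]
    rw [← tendsto_zero_iff_norm_tendsto_zero, ← sub_self (x s)]
    exact (hx.tendsto s).sub_const _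
  have := h1.add h2
  simpa [ContinuousAt] using this

variable (U) in
/-- The graph of the generator of `U`. -/
def generatorGraph : Submodule ℂ (E × E) where
  carrier := {p | HasDerivAt (fun t => U t p.1) (-Complex.I • p.2) 0}
  zero_mem' := by simpa using hasDerivAt_const (0 : ℝ) (0 : E)
  add_mem' := fun {a b} ha hb => by
    have := HasDerivAt.fun_add ha hb
    simpa only [Set.mem_ofPred_eq, Prod.fst_add, Prod.snd_add, map_add, smul_add] using this
  smul_mem' := fun c a ha => by
    have := HasDerivAt.fun_const_smul c ha
    rw [smul_comm] at this
    simpa only [Set.mem_ofPred_eq, Prod.smul_fst, Prod.smul_snd, map_smul] using this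

theorem mem_generatorGraph {ψ φ : E} :
    (ψ, φ) ∈ generatorGraph U ↔ HasDerivAt (fun t => U t ψ) (-Complex.I • φ) 0 := Iff.rfl

theorem hasDerivAt (hU : IsUnitaryGroup U) {ψ φ : E} (h : (ψ, φ) ∈ generatorGraph U) (t : ℝ) :
    HasDerivAt (fun t => U t ψ) (-Complex.I • U t φ) t := by
  have h0 : HasDerivAt (fun r => U r ψ) (-Complex.I • φ) (t - t) := by rw [sub_self]; exact h
  have h1 : HasDerivAt (fun r => U (r - t) ψ) (-Complex.I • φ) t := h0.comp_sub_const t t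
  have h2 := ((U t).restrictScalars ℝ).hasFDerivAt.comp_hasDerivAt t h1
  simp only [ContinuousLinearMap.coe_restrictScalars', map_smul] at h2
  refine h2.congr_of_eventuallyEq (Eventually.of_forall fun r => ?_)
  simp only [Function.comp]
  rw [← hU.apply_add]; simp

/-- With its converse `mem_generatorGraph_of_integral_eq`, this replaces the derivative at 0 by an
integral equation for all times. The integral equation survives limits in ψ and φ; the derivative
condition does not visibly do so. -/
theorem integral_eq (hU : IsUnitaryGroup U) {ψ φ : E} (h : (ψ, φ) ∈ generatorGraph U) (t : ℝ) :
    ∫ s in (0 : ℝ)..t, -Complex.I • U s φ = U t ψ - ψ := by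
  rw [intervalIntegral.integral_eq_sub_of_hasDerivAt (fun s _ => hU.hasDerivAt h s)
    (((hU.continuous φ).const_smul _).intervalIntegrable _ _), hU.apply_zero]

theorem mem_generatorGraph_of_integral_eq (hU : IsUnitaryGroup U) {ψ φ : E}
    (h : ∀ t, ∫ s in (0 : ℝ)..t, -Complex.I • U s φ = U t ψ - ψ) :
    (ψ, φ) ∈ generatorGraph U := by
  have hc : Continuous fun s => -Complex.I • U s φ := (hU.continuous φ).const_smul _
  have h1 := hc.integral_hasStrictDerivAt 0 0
  have h2 := h1.hasDerivAt.add_const ψ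
  rw [hU.apply_zero] at h2
  refine h2.congr_of_eventuallyEq (Eventually.of_forall fun t => ?_)
  simp only
  rw [h t]; abel

theorem continuous_integral (hU : IsUnitaryGroup U) (t : ℝ) :
    Continuous fun φ => ∫ s in (0 : ℝ)..t, -Complex.I • U s φ := by
  have hi : ∀ φ, IntervalIntegrable (fun s => -Complex.I • U s φ) volume 0 t := fun φ =>
    ((hU.continuous φ).const_smul _).intervalIntegrable _ _
  refine continuous_of_linear_of_bound (𝕜 := ℂ) (fun x y => ?_) (fun c x => ?_) (C := |t|)
    fun x => ?_
  · simp only [map_add, smul_add]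
    exact intervalIntegral.integral_add (hi x) (hi y)
  · simp only [map_smul]
    rw [← intervalIntegral.integral_smul]
    exact intervalIntegral.integral_congr fun s _ => smul_comm _ _ _
  · have := intervalIntegral.norm_integral_le_of_norm_le_const (a := 0) (b := t) (C := ‖x‖)
      (f := fun s => -Complex.I • U s x) fun s _ => by
        rw [norm_smul, hU.norm_apply]; simp
    simpa [mul_comm] using this

/-- The integral equations cut the graph out by closed conditions, one for each t. -/
theorem isClosed_generatorGraph (hU : IsUnitaryGroup U) :
    IsClosed (generatorGraph U : Set (E × E)) := by
  have : (generatorGraph U : Set (E × E)) =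
      ⋂ t : ℝ, {p : E × E | ∫ s in (0 : ℝ)..t, -Complex.I • U s p.2 = U t p.1 - p.1} := by
    ext p
    simp only [SetLike.mem_coe, Set.mem_iInter, Set.mem_ofPred_eq]
    exact ⟨fun h t => hU.integral_eq h t, fun h => hU.mem_generatorGraph_of_integral_eq h⟩
  rw [this]
  refine isClosed_iInter fun t => isClosed_eq ((hU.continuous_integral t).comp continuous_snd) ?_
  fun_prop

/-- The inner product of two orbits is constant in time, and its derivative at 0 is i(⟪y, x'⟫ - ⟪x,
y'⟫). -/
theorem inner_generatorGraph (hU : IsUnitaryGroup U) {x y x' y' : E}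
    (h : (x, y) ∈ generatorGraph U) (h' : (x', y') ∈ generatorGraph U) :
    ⟪y, x'⟫_ℂ = ⟪x, y'⟫_ℂ := by
  have h1 := HasDerivAt.inner ℂ (mem_generatorGraph.1 h) (mem_generatorGraph.1 h')
  simp only [hU.inner_apply_apply, hU.apply_zero] at h1
  have h2 := h1.unique (hasDerivAt_const _ _)
  simp only [inner_smul_right, inner_smul_left, map_neg, Complex.conj_I, neg_neg] at h2
  have h3 : Complex.I * (⟪y, x'⟫_ℂ - ⟪x, y'⟫_ℂ) = 0 := by linear_combination h2
  rcases mul_eq_zero.1 h3 with h4 | h4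
  · exact absurd h4 Complex.I_ne_zero
  · exact sub_eq_zero.1 h4

/-- Averaging an orbit smooths it: U_r shifts the window [0, t] to [r, r + t], so only the endpoints
contribute to the derivative in r. Such averages, rescaled, converge to ψ, whence the density of the
domain. -/
theorem integral_mem_generatorGraph (hU : IsUnitaryGroup U) (ψ : E) (t : ℝ) :
    (∫ s in (0 : ℝ)..t, U s ψ, Complex.I • (U t ψ - ψ)) ∈ generatorGraph U := by
  have hi : ∀ a b, IntervalIntegrable (fun s => U s ψ) volume a b := fun a b =>
    (hU.continuous ψ).intervalIntegrable _ _
  have hd : ∀ c : ℝ, HasDerivAt (fun r => ∫ s in (0 : ℝ)..(r + c), U s ψ) (U c ψ) 0 := fun c => by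
    have h1 : HasDerivAt (fun r => ∫ s in (0 : ℝ)..r, U s ψ) (U c ψ) (0 + c) := by
      rw [zero_add]; exact ((hU.continuous ψ).integral_hasStrictDerivAt 0 c).hasDerivAt
    exact h1.comp_add_const 0 c
  have h2 := (hd t).sub (hd 0)
  rw [mem_generatorGraph, smul_smul, neg_mul, Complex.I_mul_I, neg_neg, one_smul]
  rw [hU.apply_zero] at h2
  refine h2.congr_of_eventuallyEq (Eventually.of_forall fun r => ?_)
  simp only [Pi.sub_apply, add_zero]
  rw [intervalIntegral.integral_interval_sub_left (hi _ _) (hi _ _)]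
  have h3 := ((U r).intervalIntegral_comp_comm (hi 0 t))
  rw [← h3]
  simp only [← hU.apply_add]
  rw [intervalIntegral.integral_comp_add_left (fun s => U s ψ) r, add_zero]

theorem tendsto_average (hU : IsUnitaryGroup U) (ψ : E) :
    Tendsto (fun t : ℝ => t⁻¹ • ∫ s in (0 : ℝ)..t, U s ψ) (𝓝[≠] 0) (𝓝 ψ) := by
  have h1 := ((hU.continuous ψ).integral_hasStrictDerivAt 0 0).hasDerivAt
  rw [hasDerivAt_iff_tendsto_slope, hU.apply_zero] at h1
  refine h1.congr fun t => ?_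
  simp [slope]

/-- The domain of the generator is dense. -/
theorem eq_zero_of_inner_generatorGraph (hU : IsUnitaryGroup U) {ψ : E}
    (h : ∀ x y, (x, y) ∈ generatorGraph U → ⟪ψ, x⟫_ℂ = 0) : ψ = 0 := by
  have h1 := (tendsto_const_nhds (x := ψ)).inner (𝕜 := ℂ) (hU.tendsto_average ψ)
  have h2 : ∀ t : ℝ, ⟪ψ, t⁻¹ • ∫ s in (0 : ℝ)..t, U s ψ⟫_ℂ = 0 := fun t => by
    rw [← Complex.coe_smul, inner_smul_right, h _ _ (hU.integral_mem_generatorGraph ψ t), mul_zero]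
  simp only [h2] at h1
  exact inner_self_eq_zero.1 (tendsto_nhds_unique tendsto_const_nhds h1).symm

end IsUnitaryGroup

theorem IsUnitaryGroupOf.graph_eq {A : E →ₗ.[ℂ] E} {U : ℝ → E →L[ℂ] E}
    (h : IsUnitaryGroupOf A U) : A.graph = IsUnitaryGroup.generatorGraph U := by
  ext p
  exact h.generator p.1 p.2

/-- Solutions of `i z' = A z`, with `A` symmetric, are determined by their initial value. -/
theorem eq_zero_of_hasDerivAt_of_symmetric {A : E →ₗ.[ℂ] E}
    (hA : ∀ x y x' y', (x, y) ∈ A.graph → (x', y') ∈ A.graph → ⟪y, x'⟫_ℂ = ⟪x, y'⟫_ℂ)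
    {z w : ℝ → E} (hz : ∀ t, HasDerivAt z (-Complex.I • w t) t) (hg : ∀ t, (z t, w t) ∈ A.graph)
    (h0 : z 0 = 0) (t : ℝ) : z t = 0 := by
  -- The derivative of ‖z‖² is i(⟪w, z⟫ - ⟪z, w⟫), which symmetry makes zero.
  have hd : ∀ t, HasDerivAt (fun t => ⟪z t, z t⟫_ℂ) 0 t := fun t => by
    have := HasDerivAt.inner ℂ (hz t) (hz t)
    simp only [inner_smul_right, inner_smul_left, map_neg, Complex.conj_I, neg_neg,
      hA _ _ _ _ (hg t) (hg t)] at this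
    rwa [neg_mul, neg_add_cancel] at this
  have := is_const_of_deriv_eq_zero (fun t => (hd t).differentiableAt) (fun t => (hd t).deriv) t 0
  rw [h0, inner_zero_left] at this
  exact inner_self_eq_zero.1 this

/-- For x in the domain both orbits stay in the domain and solve the same Cauchy problem, so they
coincide; density of the domain does the rest. -/
theorem IsUnitaryGroupOf.unique {A : E →ₗ.[ℂ] E} {U V : ℝ → E →L[ℂ] E}
    (hU : IsUnitaryGroupOf A U) (hV : IsUnitaryGroupOf A V) : U = V := by
  have hU' := hU.isUnitaryGroup
  have hV' := hV.isUnitaryGroup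
  have inv : ∀ {W : ℝ → E →L[ℂ] E}, IsUnitaryGroupOf A W → ∀ {x y : E}, (x, y) ∈ A.graph → ∀ t,
      (W t x, W t y) ∈ A.graph := fun {W} hW {x y} hxy t => by
    have hW' := hW.isUnitaryGroup
    rw [hW.graph_eq] at hxy ⊢
    have h1 := hW'.hasDerivAt hxy t
    have h2 : HasDerivAt (fun r => W (r + t) x) (-Complex.I • W t y) 0 := by
      have h1' : HasDerivAt (fun t => W t x) (-Complex.I • W t y) (0 + t) := by rwa [zero_add]
      exact h1'.comp_add_const 0 t
    rw [IsUnitaryGroup.mem_generatorGraph]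
    simpa only [hW'.apply_add] using h2
  have key : ∀ x y, (x, y) ∈ A.graph → ∀ t, U t x = V t x := fun x y hxy t => by
    have hA : ∀ x y x' y', (x, y) ∈ A.graph → (x', y') ∈ A.graph → ⟪y, x'⟫_ℂ = ⟪x, y'⟫_ℂ := by
      intro x y x' y' h h'
      rw [hU.graph_eq] at h h'
      exact hU'.inner_generatorGraph h h'
    refine sub_eq_zero.1 (eq_zero_of_hasDerivAt_of_symmetric hA (z := fun t => U t x - V t x)
      (w := fun t => U t y - V t y) (fun t => ?_) (fun t => ?_) ?_ t)
    · have h1 := hU'.hasDerivAt (hU.graph_eq ▸ hxy) t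
      have h2 := hV'.hasDerivAt (hV.graph_eq ▸ hxy) t
      rw [smul_sub]
      exact h1.sub h2
    · exact A.graph.sub_mem (inv hU hxy t) (inv hV hxy t)
    · simp [hU'.apply_zero, hV'.apply_zero]
  funext t
  refine ContinuousLinearMap.ext fun x => ?_
  rw [← sub_eq_zero]
  -- Density enters through the adjoint of U t - V t, whose range is orthogonal to the domain of the
  -- generator.
  have h0 : ∀ v : E, ⟪v, U t x - V t x⟫_ℂ = 0 := by
    intro v
    have hz : ContinuousLinearMap.adjoint (U t - V t) v = 0 := by
      refine hU'.eq_zero_of_inner_generatorGraph fun a b hab => ?_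
      rw [ContinuousLinearMap.adjoint_inner_left, sub_apply,
        key a b (hU.graph_eq ▸ hab) t, sub_self, inner_zero_right]
    have := ContinuousLinearMap.adjoint_inner_left (U t - V t) x v
    rw [hz, inner_zero_left] at this
    exact this.symm
  exact inner_self_eq_zero.1 (h0 _)

/-- Uniqueness makes the choice inside `expNegI` irrelevant, and exhibiting any one group excludes
the default value 0. -/
theorem expNegI_eq {A : E →ₗ.[ℂ] E} {U : ℝ → E →L[ℂ] E} (hU : IsUnitaryGroupOf A U) (t : ℝ) :
    expNegI A t = U t := by
  have h : ∃ U, IsUnitaryGroupOf A U := ⟨U, hU⟩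
  rw [expNegI, dif_pos h, h.choose_spec.unique hU]

end UnitaryGroups


/-! ### Self-adjointness through the range criterion, and Stone's theorem -/

section Stone

variable {E : Type*} [NormedAddCommGroup E] [InnerProductSpace ℂ E] [CompleteSpace E]

open MeasureTheory Filter Topology

/-- A symmetric operator `A` such that `A + i c` is surjective for all real `c ≠ 0`. -/
structure IsSymmSurj (A : E →ₗ.[ℂ] E) : Prop where
  symm : ∀ x y x' y', (x, y) ∈ A.graph → (x', y') ∈ A.graph → ⟪y, x'⟫_ℂ = ⟪x, y'⟫_ℂ
  surj : ∀ c : ℝ, c ≠ 0 → ∀ z, ∃ x y, (x, y) ∈ A.graph ∧ y + (c * Complex.I) • x = z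

/-- The hypothesis makes ⟪y, x⟫ real, so the cross term is purely imaginary. This identity is the
source of injectivity, closed range and the resolvent bound 1/|c|. -/
theorem norm_sq_add_smul {x y : E} (h : ⟪y, x⟫_ℂ = ⟪x, y⟫_ℂ) (c : ℝ) :
    ‖y + (c * Complex.I) • x‖ ^ 2 = ‖y‖ ^ 2 + c ^ 2 * ‖x‖ ^ 2 := by
  rw [@norm_add_sq ℂ, inner_smul_right, norm_smul, mul_pow]
  have him : (⟪y, x⟫_ℂ).im = 0 := by
    rw [← inner_conj_symm x y] at h
    have := congrArg Complex.im h
    rw [Complex.conj_im] at this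
    linarith
  have h1 : RCLike.re ((c : ℂ) * Complex.I * ⟪y, x⟫_ℂ) = 0 := by
    change ((c : ℂ) * Complex.I * ⟪y, x⟫_ℂ).re = 0
    simp [him]
  have h2 : ‖(c : ℂ) * Complex.I‖ ^ 2 = c ^ 2 := by simp
  rw [h1, h2]; ring

/-- The map (x, y) ↦ y + icx is bounded below on the complete space A.graph, so its range is closed;
`hdef` says that the orthogonal complement of the range vanishes. -/
theorem isSymmSurj_of_isClosed {A : E →ₗ.[ℂ] E} (hcl : A.IsClosed)
    (hsymm : ∀ x y x' y', (x, y) ∈ A.graph → (x', y') ∈ A.graph → ⟪y, x'⟫_ℂ = ⟪x, y'⟫_ℂ)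
    (hdef : ∀ c : ℝ, c ≠ 0 → ∀ φ,
      (∀ x y, (x, y) ∈ A.graph → ⟪φ, y + (c * Complex.I) • x⟫_ℂ = 0) → φ = 0) :
    IsSymmSurj A := by
  refine ⟨hsymm, fun c hc => ?_⟩
  have : CompleteSpace A.graph :=
    (show _root_.IsClosed (A.graph : Set (E × E)) from hcl).completeSpace_coe
  let T : A.graph →L[ℂ] E :=
    (ContinuousLinearMap.snd ℂ E E + (c * Complex.I) • ContinuousLinearMap.fst ℂ E E) ∘L
      A.graph.subtypeL
  have hT : ∀ p : A.graph, T p = p.1.2 + (c * Complex.I) • p.1.1 := fun p => rfl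
  -- The product carries the sup norm: ‖y‖ costs the constant 1 and ‖x‖ the constant |c|⁻¹.
  have hb : ∀ p : A.graph, ‖p‖ ≤ (1 + |c|⁻¹).toNNReal * ‖T p‖ := fun p => by
    have h1 := norm_sq_add_smul (hsymm _ _ _ _ p.2 p.2) c
    rw [← hT] at h1
    have hy : ‖p.1.2‖ ≤ ‖T p‖ := by
      refine le_of_sq_le_sq ?_ (norm_nonneg _)
      rw [h1]
      have : 0 ≤ c ^ 2 * ‖p.1.1‖ ^ 2 := by positivity
      linarith
    have hx : |c| * ‖p.1.1‖ ≤ ‖T p‖ := by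
      refine le_of_sq_le_sq ?_ (norm_nonneg _)
      rw [h1, mul_pow, sq_abs]
      have : 0 ≤ ‖p.1.2‖ ^ 2 := by positivity
      linarith
    have hc' : 0 < |c| := abs_pos.2 hc
    have hx' : ‖p.1.1‖ ≤ |c|⁻¹ * ‖T p‖ := by
      rw [inv_mul_eq_div, le_div_iff₀ hc']; linarith
    rw [Real.coe_toNNReal _ (by positivity), add_mul, one_mul]
    have hi : 0 ≤ |c|⁻¹ * ‖T p‖ := by positivity
    have : ‖p‖ = max ‖p.1.1‖ ‖p.1.2‖ := rfl
    rw [this]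
    exact max_le (by linarith [norm_nonneg (T p)]) (by linarith)
  have hcr : IsClosed (LinearMap.range T.toLinearMap : Set E) := by
    have := (ContinuousLinearMap.antilipschitz_of_bound T hb).isClosed_range T.uniformContinuous
    rwa [LinearMap.coe_range]
  have : CompleteSpace (LinearMap.range T.toLinearMap) := hcr.completeSpace_coe
  have htop : LinearMap.range T.toLinearMap = ⊤ := by
    rw [← Submodule.orthogonal_eq_bot_iff, Submodule.eq_bot_iff]
    intro φ hφ
    refine hdef c hc φ fun x y hxy => ?_
    exact (Submodule.mem_orthogonal' _ _).1 hφ _ ⟨⟨(x, y), hxy⟩, rfl⟩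
  intro z
  obtain ⟨p, hp⟩ : z ∈ LinearMap.range T.toLinearMap := htop ▸ Submodule.mem_top
  exact ⟨p.1.1, p.1.2, p.2, hp⟩

theorem mem_graph_adjoint_iff {A : E →ₗ.[ℂ] E} (hA : Dense (A.domain : Set E)) {x y : E} :
    (x, y) ∈ A†.graph ↔ ∀ a b, (a, b) ∈ A.graph → ⟪y, a⟫_ℂ = ⟪x, b⟫_ℂ := by
  rw [LinearPMap.adjoint_graph_eq_graph_adjoint hA, Submodule.mem_adjoint_iff]
  refine forall₃_congr fun a b _ => ?_
  rw [sub_eq_zero, ← inner_conj_symm y a, ← inner_conj_symm x b, (starRingEnd ℂ).injective.eq_iff]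
  exact eq_comm

theorem isSymmSurj_of_isSelfAdjoint {A : E →ₗ.[ℂ] E} (hA : IsSelfAdjoint A) : IsSymmSurj A := by
  have hg : ∀ {x y}, (x, y) ∈ A.graph ↔ ∀ a b, (a, b) ∈ A.graph → ⟪y, a⟫_ℂ = ⟪x, b⟫_ℂ := by
    intro x y
    rw [← mem_graph_adjoint_iff hA.dense_domain, LinearPMap.isSelfAdjoint_def.1 hA]
  have hsymm : ∀ x y x' y', (x, y) ∈ A.graph → (x', y') ∈ A.graph → ⟪y, x'⟫_ℂ = ⟪x, y'⟫_ℂ :=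
    fun x y x' y' h h' => hg.1 h _ _ h'
  refine isSymmSurj_of_isClosed hA.isClosed hsymm fun c hc φ hφ => ?_
  -- A vector orthogonal to the range of A + ic lies in the domain of A* = A and is an eigenvector
  -- for ic, which symmetry forbids unless it is zero.
  have h1 : (φ, (c * Complex.I) • φ) ∈ A.graph := hg.2 fun a b hab => by
    have := hφ a b hab
    rw [inner_add_right, inner_smul_right] at this
    rw [inner_smul_left]
    simp only [map_mul, Complex.conj_ofReal, Complex.conj_I]
    linear_combination -this
  have h2 := hsymm _ _ _ _ h1 h1
  rw [inner_smul_left, inner_smul_right] at h2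
  simp only [map_mul, Complex.conj_ofReal, Complex.conj_I] at h2
  have h3 : (2 * c * Complex.I) * ⟪φ, φ⟫_ℂ = 0 := by linear_combination -h2
  have h4 : (2 * c * Complex.I : ℂ) ≠ 0 := by simp [hc]
  exact inner_self_eq_zero.1 ((mul_eq_zero.1 h3).resolve_left h4)

/-! ### Maximality, resolvents and density of the domain under the range property -/

namespace IsSymmSurj

variable {A : E →ₗ.[ℂ] E}

theorem eq_of_add_smul_eq (hA : IsSymmSurj A) {c : ℝ} (hc : c ≠ 0) {x y x' y' : E}
    (h : (x, y) ∈ A.graph) (h' : (x', y') ∈ A.graph)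
    (he : y + (c * Complex.I) • x = y' + (c * Complex.I) • x') : x = x' := by
  have hd := A.graph.sub_mem h h'
  have h1 := norm_sq_add_smul (hA.symm _ _ _ _ hd hd) c
  have h2 : y - y' + (c * Complex.I) • (x - x') = 0 := by
    rw [smul_sub, sub_add_sub_comm, he, sub_self]
  simp only at h1
  rw [h2, norm_zero] at h1
  have h3 : c ^ 2 * ‖x - x'‖ ^ 2 = 0 := by nlinarith [sq_nonneg ‖y - y'‖, sq_nonneg (c * ‖x - x'‖)]
  have h4 : ‖x - x'‖ ^ 2 = 0 := (mul_eq_zero.1 h3).resolve_left (pow_ne_zero 2 hc)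
  exact sub_eq_zero.1 (norm_eq_zero.1 (pow_eq_zero_iff two_ne_zero |>.1 h4))

/-- A symmetric operator with this range property has no proper symmetric extension. -/
theorem mem_graph (hA : IsSymmSurj A) {X Y : E}
    (h : ∀ x y, (x, y) ∈ A.graph → ⟪Y, x⟫_ℂ = ⟪X, y⟫_ℂ) : (X, Y) ∈ A.graph := by
  -- X is compared with the solution x' of (A + i)x' = Y + iX: the difference X - x' is orthogonal
  -- to the range of A - i, hence zero.
  obtain ⟨x', y', hg, he⟩ := hA.surj 1 one_ne_zero (Y + ((1 : ℝ) * Complex.I) • X)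
  have hd : ∀ x y, (x, y) ∈ A.graph → ⟪X - x', y + ((-1 : ℝ) * Complex.I) • x⟫_ℂ = 0 := by
    intro x y hxy
    have h1 := h x y hxy
    have h2 := hA.symm _ _ _ _ hg hxy
    have h3 := congrArg (fun v => ⟪v, x⟫_ℂ) he
    simp only [inner_add_left, inner_smul_left, map_mul, Complex.conj_ofReal, Complex.conj_I] at h3
    simp only [inner_sub_left, inner_add_right, inner_smul_right]
    push_cast at h3 ⊢
    linear_combination h2 - h1 - h3
  obtain ⟨x, y, hxy, hz⟩ := hA.surj (-1) (by norm_num) (X - x')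
  have h0 := hd x y hxy
  rw [hz] at h0
  have hX : X = x' := sub_eq_zero.1 (inner_self_eq_zero.1 h0)
  subst hX
  rwa [add_left_injective _ he] at hg

theorem exists_resolvent (hA : IsSymmSurj A) {c : ℝ} (hc : c ≠ 0) :
    ∃ J : E →L[ℂ] E, ∀ z, (J z, z - (c * Complex.I) • J z) ∈ A.graph := by
  choose x y hg he using hA.surj c hc
  have hxy : ∀ z, y z = z - (c * Complex.I) • x z := fun z => eq_sub_of_add_eq (he z)
  let J₀ : E →ₗ[ℂ] E :=
    { toFun := x
      map_add' := fun a b => by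
        refine hA.eq_of_add_smul_eq hc (hg _) (A.graph.add_mem (hg a) (hg b)) ?_
        simp only
        rw [he, smul_add, add_add_add_comm, he, he]
      map_smul' := fun r a => by
        refine hA.eq_of_add_smul_eq hc (hg _) (A.graph.smul_mem r (hg a)) ?_
        simp only
        rw [he, RingHom.id_apply, smul_comm, ← smul_add, he] }
  refine ⟨J₀.mkContinuous |c|⁻¹ fun z => ?_, fun z => ?_⟩
  · have h1 := norm_sq_add_smul (hA.symm _ _ _ _ (hg z) (hg z)) c
    rw [he] at h1
    have hx : |c| * ‖x z‖ ≤ ‖z‖ := by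
      refine le_of_sq_le_sq ?_ (norm_nonneg _)
      rw [h1, mul_pow, sq_abs]
      have : 0 ≤ ‖y z‖ ^ 2 := by positivity
      linarith
    have hc' : 0 < |c| := abs_pos.2 hc
    change ‖x z‖ ≤ _
    rw [inv_mul_eq_div, le_div_iff₀ hc']; linarith
  · have := hg z
    rw [hxy] at this
    exact this

theorem norm_resolvent_le (hA : IsSymmSurj A) {c : ℝ} {J : E →L[ℂ] E}
    (hJ : ∀ z, (J z, z - (c * Complex.I) • J z) ∈ A.graph) (z : E) : |c| * ‖J z‖ ≤ ‖z‖ := by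
  have h1 := norm_sq_add_smul (hA.symm _ _ _ _ (hJ z) (hJ z)) c
  rw [sub_add_cancel] at h1
  refine le_of_sq_le_sq ?_ (norm_nonneg _)
  rw [h1, mul_pow, sq_abs]
  have : 0 ≤ ‖z - (c * Complex.I) • J z‖ ^ 2 := by positivity
  linarith

theorem resolvent_apply (hA : IsSymmSurj A) {c : ℝ} (hc : c ≠ 0) {J : E →L[ℂ] E}
    (hJ : ∀ z, (J z, z - (c * Complex.I) • J z) ∈ A.graph) {x y : E} (h : (x, y) ∈ A.graph) :
    J (y + (c * Complex.I) • x) = x :=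
  hA.eq_of_add_smul_eq hc (hJ _) h (sub_add_cancel _ _)

/-- Applying J to the graph relation of K expresses J z through J K z; both K J z and J K z then
solve (A + id)v = J z. Commuting resolvents give commuting Yosida approximants. -/
theorem resolvent_comm (hA : IsSymmSurj A) {c d : ℝ} (hc : c ≠ 0) (hd : d ≠ 0) {J K : E →L[ℂ] E}
    (hJ : ∀ z, (J z, z - (c * Complex.I) • J z) ∈ A.graph)
    (hK : ∀ z, (K z, z - (d * Complex.I) • K z) ∈ A.graph) : Commute J K := by
  refine ContinuousLinearMap.ext fun z => ?_
  change J (K z) = K (J z)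
  have h1 := hA.resolvent_apply hc hJ (hK z)
  simp only [map_add, map_sub, map_smul] at h1
  refine hA.eq_of_add_smul_eq hd (hJ _) (hK _) ?_
  rw [sub_add_cancel]
  calc K z - (c * Complex.I) • J (K z) + (d * Complex.I) • J (K z)
      = (J z - (d * Complex.I) • J (K z) + (c * Complex.I) • J (K z))
        - (c * Complex.I) • J (K z) + (d * Complex.I) • J (K z) := by rw [h1]
    _ = J z := by abel

/-- K = (A - ic)⁻¹ is the adjoint of J = (A + ic)⁻¹, by the symmetry of A applied to J z and K w. -/
theorem inner_resolvent (hA : IsSymmSurj A) {c : ℝ} {J K : E →L[ℂ] E}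
    (hJ : ∀ z, (J z, z - (c * Complex.I) • J z) ∈ A.graph)
    (hK : ∀ z, (K z, z - ((-c : ℝ) * Complex.I) • K z) ∈ A.graph) (z w : E) :
    ⟪J z, w⟫_ℂ = ⟪z, K w⟫_ℂ := by
  have h := hA.symm _ _ _ _ (hJ z) (hK w)
  simp only [inner_sub_left, inner_sub_right, inner_smul_left, inner_smul_right, map_mul,
    Complex.conj_ofReal, Complex.conj_I] at h
  push_cast at h
  linear_combination -h

/-- A vector orthogonal to the domain is orthogonal to the range of a resolvent J, so it lies in the
kernel of J* = K, and K is injective. -/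
theorem dense_domain (hA : IsSymmSurj A) : Dense (A.domain : Set E) := by
  rw [Submodule.dense_iff_topologicalClosure_eq_top, Submodule.topologicalClosure_eq_top_iff,
    Submodule.eq_bot_iff]
  intro φ hφ
  obtain ⟨J, hJ⟩ := hA.exists_resolvent (one_ne_zero (α := ℝ))
  obtain ⟨K, hK⟩ := hA.exists_resolvent (c := (-1 : ℝ)) (by norm_num)
  have h1 : K φ = 0 := by
    refine inner_self_eq_zero (𝕜 := ℂ).1 ?_
    rw [← hA.inner_resolvent hJ hK]
    exact (Submodule.mem_orthogonal _ _).1 hφ _ (LinearPMap.mem_domain_of_mem_graph (hJ _))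
  have h2 := hK φ
  rw [h1, smul_zero, sub_zero] at h2
  exact LinearPMap.graph_fst_eq_zero_snd _ h2 rfl

end IsSymmSurj

theorem tendsto_zero_of_dense {F ι : Type*} [NormedAddCommGroup F] [NormedSpace ℂ F]
    {l : Filter ι} {T : ι → E →L[ℂ] F} {C : ℝ} (hT : ∀ i x, ‖T i x‖ ≤ C * ‖x‖) {D : Set E}
    (hD : Dense D) (h : ∀ x ∈ D, Tendsto (fun i => T i x) l (𝓝 0)) (x : E) :
    Tendsto (fun i => T i x) l (𝓝 0) := by
  rw [Metric.tendsto_nhds]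
  intro ε hε
  have hC : 0 < |C| + 1 := by positivity
  obtain ⟨y, hy, hxy⟩ := Metric.dense_iff.1 hD x (ε / (2 * (|C| + 1))) (by positivity)
  rw [Metric.mem_ball, dist_comm, dist_eq_norm, lt_div_iff₀ (by positivity)] at hy
  filter_upwards [Metric.tendsto_nhds.1 (h y hxy) (ε / 2) (by positivity)] with i hi
  rw [dist_zero_right] at hi ⊢
  have h1 : T i x = T i (x - y) + T i y := by rw [map_sub, sub_add_cancel]
  have h2 := hT i (x - y)
  have h3 : C * ‖x - y‖ ≤ (|C| + 1) * ‖x - y‖ :=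
    mul_le_mul_of_nonneg_right (by linarith [le_abs_self C]) (norm_nonneg _)
  rw [h1]
  refine (norm_add_le _ _).trans_lt ?_
  nlinarith

theorem isClosed_setOf_continuous {X : Type*} [TopologicalSpace X] {U : X → E →L[ℂ] E}
    (hU : ∀ t x, ‖U t x‖ = ‖x‖) : IsClosed {x | Continuous fun t => U t x} := by
  rw [← isSeqClosed_iff_isClosed]
  intro u x hu hx
  refine continuous_of_uniform_approx_of_continuous fun s hs => ?_
  obtain ⟨ε, hε, h⟩ := Metric.mem_uniformity_dist.1 hs
  obtain ⟨n, hn⟩ := (Metric.tendsto_nhds.1 hx ε hε).exists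
  refine ⟨fun t => U t (u n), hu n, fun t => h ?_⟩
  rw [dist_eq_norm, ← map_sub, hU, ← dist_eq_norm, dist_comm]
  exact hn

/-- The group law makes isometries invertible, hence unitary. Isometry also makes the set of vectors
with continuous orbit a closed subspace, so a total set suffices for strong continuity. -/
theorem IsUnitaryGroup.of_norm {U : ℝ → E →L[ℂ] E} (hnorm : ∀ t x, ‖U t x‖ = ‖x‖) (h0 : U 0 = 1)
    (hadd : ∀ s t, U (s + t) = U s * U t) {D : Set E}
    (hD : (Submodule.span ℂ D).topologicalClosure = ⊤)
    (hc : ∀ x ∈ D, Continuous fun t => U t x) : IsUnitaryGroup U := by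
  have hinv : ∀ t, U t * U (-t) = 1 := fun t => by rw [← hadd, add_neg_cancel, h0]
  refine ⟨fun t => ?_, h0, hadd, fun ψ => ?_⟩
  · have h1 : ContinuousLinearMap.adjoint (U t) * U t = 1 :=
      (ContinuousLinearMap.norm_map_iff_adjoint_comp_self (U t)).1 (hnorm t)
    have h2 : ContinuousLinearMap.adjoint (U t) = U (-t) := by
      rw [← mul_one (ContinuousLinearMap.adjoint (U t)), ← hinv t, ← mul_assoc, h1, one_mul]
    refine Unitary.mem_iff.2 ⟨h1, ?_⟩
    rw [ContinuousLinearMap.star_eq_adjoint, h2, hinv]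
  · let K : Submodule ℂ E :=
      { carrier := {x | Continuous fun t => U t x}
        zero_mem' := by
          simpa only [Set.mem_ofPred_eq, map_zero] using continuous_const
        add_mem' := fun {a b} ha hb => by
          simpa only [Set.mem_ofPred_eq, map_add] using Continuous.fun_add ha hb
        smul_mem' := fun c a ha => by
          simpa only [Set.mem_ofPred_eq, map_smul] using Continuous.fun_const_smul ha c }
    have hK : IsClosed (K : Set E) := isClosed_setOf_continuous hnorm
    have : (Submodule.span ℂ D).topologicalClosure ≤ K :=
      Submodule.topologicalClosure_minimal _ (Submodule.span_le.2 hc) hK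
    rw [hD] at this
    exact this Submodule.mem_top

theorem IsUnitaryGroup.norm_apply_sub_le {U : ℝ → E →L[ℂ] E} (hU : IsUnitaryGroup U) {ψ φ : E}
    (h : (ψ, φ) ∈ IsUnitaryGroup.generatorGraph U) (t : ℝ) : ‖U t ψ - ψ‖ ≤ ‖φ‖ * |t| := by
  rw [← hU.integral_eq h]
  have := intervalIntegral.norm_integral_le_of_norm_le_const (a := 0) (b := t) (C := ‖φ‖)
      (f := fun s => -Complex.I • U s φ) fun s _ => by
        rw [norm_smul, hU.norm_apply]; simp
  simpa using this

/-- The unitary group generated by a bounded self-adjoint operator. -/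
theorem isUnitaryGroup_exp {B : E →L[ℂ] E} (hB : IsSelfAdjoint B) :
    IsUnitaryGroup (fun t : ℝ => NormedSpace.exp (t • (-Complex.I • B))) ∧
    ∀ ψ, (ψ, B ψ) ∈
      IsUnitaryGroup.generatorGraph (fun t : ℝ => NormedSpace.exp (t • (-Complex.I • B))) := by
  let _ : NormedAlgebra ℚ (E →L[ℂ] E) := NormedAlgebra.restrictScalars ℚ ℂ _
  have hd : ∀ t : ℝ, HasDerivAt (fun t : ℝ => NormedSpace.exp (t • (-Complex.I • B)))
      (NormedSpace.exp (t • (-Complex.I • B)) * (-Complex.I • B)) t := fun t =>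
    hasDerivAt_exp_smul_const (-Complex.I • B) t
  have hdv : ∀ (ψ : E) (t : ℝ), HasDerivAt (fun t : ℝ => NormedSpace.exp (t • (-Complex.I • B)) ψ)
      ((NormedSpace.exp (t • (-Complex.I • B)) * (-Complex.I • B)) ψ) t := fun ψ t =>
    (((ContinuousLinearMap.apply ℂ E ψ).restrictScalars ℝ).hasFDerivAt.comp_hasDerivAt t (hd t))
  refine ⟨⟨fun t => ?_, by simp, fun s t => ?_, fun ψ => ?_⟩, fun ψ => ?_⟩
  · refine NormedSpace.exp_mem_unitary_of_mem_skewAdjoint ?_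
    rw [skewAdjoint.mem_iff, star_smul, star_smul, hB.star_eq]
    simp
  · rw [add_smul]
    exact NormedSpace.exp_add_of_commute
      (((Commute.refl (-Complex.I • B)).smul_left s).smul_right t)
  · exact continuous_iff_continuousAt.2 fun t => (hdv ψ t).continuousAt
  · have := hdv ψ 0
    rw [IsUnitaryGroup.mem_generatorGraph]
    simpa using this

/-- With c = n + 1, J = (A + ic)⁻¹ and K = (A - ic)⁻¹, the approximant is c²(J + K)/2, formally
c²A(A² + c²)⁻¹. It is bounded and self-adjoint, and on the domain it equals M A for the contraction
M = (ic/2)(J - K), formally c²(A² + c²)⁻¹, which tends strongly to 1. -/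
theorem IsSymmSurj.exists_yosida {A : E →ₗ.[ℂ] E} (hA : IsSymmSurj A) :
    ∃ B : ℕ → E →L[ℂ] E, (∀ n, IsSelfAdjoint (B n)) ∧ (∀ m n, Commute (B m) (B n)) ∧
      ∀ ψ φ, (ψ, φ) ∈ A.graph → (∀ n, ‖B n ψ‖ ≤ ‖φ‖) ∧ Tendsto (fun n => B n ψ) atTop (𝓝 φ) := by
  have hc : ∀ n : ℕ, (n + 1 : ℝ) ≠ 0 := fun n => by positivity
  have hc' : ∀ n : ℕ, (-(n + 1) : ℝ) ≠ 0 := fun n => neg_ne_zero.2 (hc n)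
  choose J hJ using fun n : ℕ => hA.exists_resolvent (hc n)
  choose K hK using fun n : ℕ => hA.exists_resolvent (hc' n)
  have hnJ : ∀ n z, (n + 1) * ‖J n z‖ ≤ ‖z‖ := fun n z => by
    have := hA.norm_resolvent_le (hJ n) z
    rwa [abs_of_pos (by positivity)] at this
  have hnK : ∀ n z, (n + 1) * ‖K n z‖ ≤ ‖z‖ := fun n z => by
    have := hA.norm_resolvent_le (hK n) z
    rwa [abs_neg, abs_of_pos (by positivity)] at this
  let M : ℕ → E →L[ℂ] E := fun n => (((n + 1 : ℝ) : ℂ) * Complex.I / 2) • (J n - K n)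
  have hM : ∀ n z, ‖M n z‖ ≤ 1 * ‖z‖ := fun n z => by
    have h1 : ‖((n + 1 : ℝ) : ℂ) * Complex.I / 2‖ = (n + 1) / 2 := by
      rw [norm_div, norm_mul, Complex.norm_real, Complex.norm_I, mul_one, Real.norm_eq_abs,
        abs_of_pos (by positivity)]
      norm_num
    have h2 : M n z = (((n + 1 : ℝ) : ℂ) * Complex.I / 2) • (J n z - K n z) := rfl
    rw [h2, norm_smul, h1]
    have := norm_sub_le (J n z) (K n z)
    have h3 : (0 : ℝ) ≤ (n + 1) / 2 := by positivity
    nlinarith [hnJ n z, hnK n z, mul_le_mul_of_nonneg_left this h3]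
  have hJr : ∀ n ψ φ, (ψ, φ) ∈ A.graph → J n φ = ψ - (((n + 1 : ℝ) : ℂ) * Complex.I) • J n ψ := by
    intro n ψ φ h
    have := hA.resolvent_apply (hc n) (hJ n) h
    rw [map_add, map_smul] at this
    exact eq_sub_of_add_eq this
  have hKr : ∀ n ψ φ, (ψ, φ) ∈ A.graph → K n φ = ψ + (((n + 1 : ℝ) : ℂ) * Complex.I) • K n ψ := by
    intro n ψ φ h
    have := hA.resolvent_apply (hc' n) (hK n) h
    rw [map_add, map_smul, Complex.ofReal_neg, neg_mul, neg_smul, ← sub_eq_add_neg] at this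
    exact eq_add_of_sub_eq this
  have hMlim : ∀ z, Tendsto (fun n => M n z) atTop (𝓝 z) := fun z => by
    have h0 := tendsto_zero_of_dense (l := atTop) (T := fun n => M n - 1) (C := 2)
      (fun n x => by
        rw [sub_apply]
        refine (norm_sub_le _ _).trans ?_
        have := hM n x
        rw [one_apply_eq_self]
        linarith) hA.dense_domain (fun ψ hψ => by
        obtain ⟨φ, h⟩ := LinearPMap.mem_domain_iff.1 hψ
        -- On the domain M - 1 is -(J + K)A/2, of order 1/(n + 1) by the resolvent bounds.
        have hform : ∀ n, (M n - 1) ψ = -(((1 / 2 : ℝ) : ℂ) • (J n φ + K n φ)) := fun n => by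
          have e : (M n - 1) ψ =
            (((n + 1 : ℝ) : ℂ) * Complex.I / 2) • (J n ψ - K n ψ) - ψ := rfl
          rw [hJr n ψ φ h, hKr n ψ φ h, e]
          push_cast
          module
        have hle : ∀ n : ℕ, ‖(M n - 1) ψ‖ ≤ ‖φ‖ * (1 / ((n : ℝ) + 1)) := fun n => by
          rw [hform, norm_neg, norm_smul, Complex.norm_real, mul_one_div,
            le_div_iff₀ (by positivity)]
          have h3 := norm_add_le (J n φ) (K n φ)
          have h4 : (0 : ℝ) ≤ n + 1 := by positivity
          norm_num
          nlinarith [hnJ n φ, hnK n φ, mul_le_mul_of_nonneg_left h3 h4]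
        refine squeeze_zero_norm hle ?_
        simpa using (tendsto_one_div_add_atTop_nhds_zero_nat (𝕜 := ℝ)).const_mul ‖φ‖) z
    have := h0.add_const z
    simpa using this
  refine ⟨fun n => (((n + 1 : ℝ) ^ 2 / 2 : ℝ) : ℂ) • (J n + K n), fun n => ?_, fun m n => ?_,
    fun ψ φ h => ?_⟩
  · refine IsSelfAdjoint.smul (by rw [isSelfAdjoint_iff]; exact Complex.conj_ofReal _) ?_
    have hadj : ContinuousLinearMap.adjoint (J n) = K n :=
      ((ContinuousLinearMap.eq_adjoint_iff _ _).2 fun x y => by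
        rw [← inner_conj_symm, ← hA.inner_resolvent (hJ n) (hK n), inner_conj_symm]).symm
    rw [isSelfAdjoint_iff, star_add, ContinuousLinearMap.star_eq_adjoint,
      ContinuousLinearMap.star_eq_adjoint, ← hadj, ContinuousLinearMap.adjoint_adjoint, add_comm]
  · refine Commute.smul_left (Commute.smul_right ?_ _) _
    exact ((hA.resolvent_comm (hc m) (hc n) (hJ m) (hJ n)).add_right
      (hA.resolvent_comm (hc m) (hc' n) (hJ m) (hK n))).add_left
      ((hA.resolvent_comm (hc' m) (hc n) (hK m) (hJ n)).add_right
      (hA.resolvent_comm (hc' m) (hc' n) (hK m) (hK n)))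
  · have hB : ∀ n : ℕ, ((((n + 1 : ℝ) ^ 2 / 2 : ℝ) : ℂ) • (J n + K n)) ψ = M n φ := fun n => by
      have e : M n φ = (((n + 1 : ℝ) : ℂ) * Complex.I / 2) • (J n φ - K n φ) := rfl
      have hI : Complex.I ^ 2 = -1 := Complex.I_sq
      have e2 : ((((n + 1 : ℝ) ^ 2 / 2 : ℝ) : ℂ)) =
          (((n + 1 : ℝ) : ℂ) * Complex.I / 2) * (-(((n + 1 : ℝ) : ℂ) * Complex.I)) := by
        push_cast
        linear_combination ((n + 1 : ℂ) ^ 2 / 2) * hI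
      rw [e, hJr n ψ φ h, hKr n ψ φ h, smul_apply, add_apply, e2]
      module
    simp only [hB]
    exact ⟨fun n => by simpa using hM n φ, hMlim φ⟩

/-- A symmetric operator contained in the generator of a unitary group is the generator, provided
it has the range property. -/
theorem IsSymmSurj.isUnitaryGroupOf {A : E →ₗ.[ℂ] E} (hA : IsSymmSurj A) {U : ℝ → E →L[ℂ] E}
    (hU : IsUnitaryGroup U) (hle : A.graph ≤ IsUnitaryGroup.generatorGraph U) :
    IsUnitaryGroupOf A U :=
  ⟨hU.unitary, hU.zero, hU.add, hU.continuous, fun _ _ => ⟨fun h => hle h, fun h =>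
    hA.mem_graph fun _ _ hxy => hU.inner_generatorGraph h (hle hxy)⟩⟩

/-- Stone's theorem: existence of the unitary group. -/
theorem IsSymmSurj.exists_isUnitaryGroupOf {A : E →ₗ.[ℂ] E} (hA : IsSymmSurj A) :
    ∃ U, IsUnitaryGroupOf A U := by
  let _ : NormedAlgebra ℚ (E →L[ℂ] E) := NormedAlgebra.restrictScalars ℚ ℂ _
  obtain ⟨B, hB, hcomm, hlim⟩ := hA.exists_yosida
  let V : ℕ → ℝ → E →L[ℂ] E := fun n t => NormedSpace.exp (t • (-Complex.I • B n))
  have hV : ∀ n, IsUnitaryGroup (V n) := fun n => (isUnitaryGroup_exp (hB n)).1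
  have hVg : ∀ n ψ, (ψ, B n ψ) ∈ IsUnitaryGroup.generatorGraph (V n) := fun n =>
    (isUnitaryGroup_exp (hB n)).2
  -- Commuting generators allow the factorisation V_m = V_n e^{-it(B_m - B_n)}, so the difference is
  -- controlled by (B_m - B_n)ψ, which is Cauchy on the domain of A.
  have hVsub : ∀ m n t ψ, ‖V m t ψ - V n t ψ‖ ≤ ‖B m ψ - B n ψ‖ * |t| := fun m n t ψ => by
    have h1 : V m t = V n t * NormedSpace.exp (t • (-Complex.I • (B m - B n))) := by
      change NormedSpace.exp _ = NormedSpace.exp _ * _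
      rw [← NormedSpace.exp_add_of_commute]
      · congr 1
        module
      · exact ((((hcomm n m).sub_right (hcomm n n)).smul_right _).smul_right _).smul_left _
          |>.smul_left _
    have h2 := (isUnitaryGroup_exp ((hB m).sub (hB n)))
    rw [h1, mul_apply_eq_comp, ← map_sub, (hV n).norm_apply]
    exact h2.1.norm_apply_sub_le (h2.2 ψ) t
  have hcau : ∀ t ψ, CauchySeq fun n => V n t ψ := fun t ψ => by
    have h0 := tendsto_zero_of_dense (l := atTop ×ˢ atTop)
      (T := fun p : ℕ × ℕ => V p.1 t - V p.2 t) (C := 2) (fun p x => by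
        rw [sub_apply]
        refine (norm_sub_le _ _).trans ?_
        rw [(hV _).norm_apply, (hV _).norm_apply, two_mul]) hA.dense_domain (fun ψ hψ => by
        obtain ⟨φ, h⟩ := LinearPMap.mem_domain_iff.1 hψ
        have h1 : Tendsto (fun p : ℕ × ℕ => ‖B p.1 ψ - B p.2 ψ‖ * |t|) (atTop ×ˢ atTop) (𝓝 0) := by
          have := (((hlim ψ φ h).2.comp tendsto_fst).sub
            ((hlim ψ φ h).2.comp (tendsto_snd (f := (atTop : Filter ℕ))))).norm.mul_const |t|
          simpa using this
        exact squeeze_zero_norm (fun p => hVsub p.1 p.2 t ψ) h1) ψ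
    rw [cauchySeq_iff_tendsto_dist_atTop_0, ← prod_atTop_atTop_eq]
    simp only [dist_eq_norm]
    simpa using h0.norm
  have hex : ∀ t, ∃ W : E →L[ℂ] E, ∀ ψ, Tendsto (fun n => V n t ψ) atTop (𝓝 (W ψ)) := fun t => by
    choose W hW using fun ψ => cauchySeq_tendsto_of_complete (hcau t ψ)
    exact ⟨continuousLinearMapOfTendsto (fun n => V n t) (tendsto_pi_nhds.2 hW), hW⟩
  choose U hUlim using hex
  have hnorm : ∀ t x, ‖U t x‖ = ‖x‖ := fun t x =>
    tendsto_nhds_unique (hUlim t x).norm (by simp only [(hV _).norm_apply]; exact tendsto_const_nhds)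
  have h0 : U 0 = 1 := ContinuousLinearMap.ext fun x =>
    tendsto_nhds_unique (hUlim 0 x) (by simp only [(hV _).apply_zero]; exact tendsto_const_nhds)
  have hcomp : ∀ t x (y : ℕ → E), Tendsto y atTop (𝓝 x) →
      Tendsto (fun n => V n t (y n)) atTop (𝓝 (U t x)) := fun t x y hy => by
    have h1 : Tendsto (fun n => V n t (y n - x)) atTop (𝓝 0) := by
      rw [tendsto_zero_iff_norm_tendsto_zero]
      simp only [(hV _).norm_apply]
      rw [← tendsto_zero_iff_norm_tendsto_zero, ← sub_self x]
      exact hy.sub_const x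
    simpa using h1.add (hUlim t x)
  have hadd : ∀ s t, U (s + t) = U s * U t := fun s t => ContinuousLinearMap.ext fun x =>
    tendsto_nhds_unique (hUlim (s + t) x) (by
      simp only [(hV _).apply_add]
      exact hcomp s _ _ (hUlim t x))
  have hint : ∀ ψ φ, (ψ, φ) ∈ A.graph → ∀ t, ‖U t ψ - ψ‖ ≤ ‖φ‖ * |t| := fun ψ φ h t => by
    refine le_of_tendsto ((hUlim t ψ).sub_const ψ).norm (Eventually.of_forall fun n => ?_)
    refine ((hV n).norm_apply_sub_le (hVg n ψ) t).trans ?_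
    exact mul_le_mul_of_nonneg_right ((hlim ψ φ h).1 n) (abs_nonneg t)
  have hU : IsUnitaryGroup U := by
    refine IsUnitaryGroup.of_norm hnorm h0 hadd (D := A.domain) ?_ fun ψ hψ => ?_
    · rw [Submodule.span_eq, ← Submodule.dense_iff_topologicalClosure_eq_top]
      exact hA.dense_domain
    · obtain ⟨φ, h⟩ := LinearPMap.mem_domain_iff.1 hψ
      rw [continuous_iff_continuousAt]
      intro s
      rw [ContinuousAt, tendsto_iff_norm_sub_tendsto_zero]
      have h1 : ∀ r, ‖U r ψ - U s ψ‖ ≤ ‖φ‖ * |r - s| := fun r => by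
        have : U r ψ - U s ψ = U s (U (r - s) ψ - ψ) := by
          rw [map_sub, ← mul_apply_eq_comp, ← hadd, add_sub_cancel]
        rw [this, hnorm]
        exact hint ψ φ h _
      refine squeeze_zero (fun r => norm_nonneg _) h1 ?_
      have : Continuous fun r : ℝ => ‖φ‖ * |r - s| := by fun_prop
      simpa using this.tendsto s
  refine ⟨U, hA.isUnitaryGroupOf hU fun p hp => ?_⟩
  obtain ⟨ψ, φ⟩ := p
  -- The integral equations of the approximating groups converge by dominated convergence.
  -- Containing A in the generator is enough, by maximality of A.
  refine hU.mem_generatorGraph_of_integral_eq fun t => ?_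
  refine tendsto_nhds_unique (intervalIntegral.tendsto_integral_filter_of_dominated_convergence
    (F := fun n s => -Complex.I • V n s (B n ψ)) (l := atTop) (fun _ => ‖φ‖) ?_ ?_ ?_ ?_) ?_
  · exact Eventually.of_forall fun n =>
      ((hV n).continuous (B n ψ)).const_smul (-Complex.I) |>.aestronglyMeasurable
  · refine Eventually.of_forall fun n => Eventually.of_forall fun s _ => ?_
    rw [norm_smul, (hV n).norm_apply]
    simpa using (hlim ψ φ hp).1 n
  · exact intervalIntegrable_const
  · exact Eventually.of_forall fun s _ => (hcomp s φ _ (hlim ψ φ hp).2).const_smul _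
  · simp only [(hV _).integral_eq (hVg _ ψ)]
    exact (hUlim t ψ).sub_const ψ

/-! ### Cores -/

/-- The solution is e^{ct} y(0), which is unbounded in one time direction unless y(0) = 0. This
drives the deficiency arguments: matrix elements of a deficiency vector with bounded orbits satisfy
such an equation. -/
theorem eq_zero_of_hasDerivAt_mul_of_bounded {y : ℝ → ℂ} {c C : ℝ} (hc : c ≠ 0)
    (hy : ∀ t, HasDerivAt y (c * y t) t) (hb : ∀ t, ‖y t‖ ≤ C) : y 0 = 0 := by
  have hd : ∀ t : ℝ, HasDerivAt (fun t : ℝ => Complex.exp (-(c * t : ℂ)) * y t) 0 t := fun t => by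
    have h1 : HasDerivAt (fun t : ℝ => -(c * t : ℂ)) (-(c : ℂ)) t := by
      simpa using ((Complex.ofRealCLM.hasDerivAt (x := t)).const_mul (c : ℂ)).fun_neg
    have h2 := h1.cexp.fun_mul (hy t)
    exact h2.congr_deriv (by ring)
  have hconst := fun t => is_const_of_deriv_eq_zero (fun t => (hd t).differentiableAt)
    (fun t => (hd t).deriv) 0 t
  simp only [Complex.ofReal_zero, mul_zero, neg_zero, Complex.exp_zero, one_mul] at hconst
  have hle : ∀ r : ℝ, ‖y 0‖ ≤ Real.exp (-r) * C := fun r => by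
    -- The time r / c turns the factor e^{-ct} into e^{-r}, whatever the sign of c.
    have h1 := hconst (r / c)
    rw [h1, norm_mul, Complex.norm_exp]
    have : (-(c * ((r / c : ℝ) : ℂ))).re = -r := by
      rw [← Complex.ofReal_mul, mul_div_cancel₀ _ hc]; simp
    rw [this]
    exact mul_le_mul_of_nonneg_left (hb _) (Real.exp_pos _).le
  have h0 : Tendsto (fun r : ℝ => Real.exp (-r) * C) atTop (𝓝 0) := by
    simpa using Real.tendsto_exp_neg_atTop_nhds_zero.mul_const C
  exact norm_le_zero_iff.1 (ge_of_tendsto' h0 hle)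

theorem IsUnitaryGroup.isClosable_of_le {U : ℝ → E →L[ℂ] E} {S : E →ₗ.[ℂ] E}
    (hU : IsUnitaryGroup U) (hle : S.graph ≤ IsUnitaryGroup.generatorGraph U) :
    S.IsClosable ∧ S.closure.graph ≤ IsUnitaryGroup.generatorGraph U := by
  have h1 : S.graph.topologicalClosure ≤ IsUnitaryGroup.generatorGraph U :=
    Submodule.topologicalClosure_minimal _ hle hU.isClosed_generatorGraph
  have h2 : S.IsClosable := by
    refine ⟨S.graph.topologicalClosure.toLinearPMap, (Submodule.toLinearPMap_graph_eq _ ?_).symm⟩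
    rintro ⟨x, y⟩ hp rfl
    have := IsUnitaryGroup.mem_generatorGraph.1 (h1 hp)
    simp only [map_zero] at this
    have h0 := this.unique (hasDerivAt_const _ _)
    simpa using h0
  exact ⟨h2, h2.graph_closure_eq_closure_graph ▸ h1⟩

/-- If φ is orthogonal to the range of S + ic and x ∈ D, then ⟪φ, U_t x⟫ is bounded and has
derivative -c⟪φ, U_t x⟫, because the orbit of x stays in the domain of S. It vanishes, and D is
total. -/
theorem IsUnitaryGroup.isSymmSurj_closure {U : ℝ → E →L[ℂ] E} {S : E →ₗ.[ℂ] E}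
    (hU : IsUnitaryGroup U) (hle : S.graph ≤ IsUnitaryGroup.generatorGraph U) {D : Set E}
    (hD : (Submodule.span ℂ D).topologicalClosure = ⊤) (hinv : ∀ t, ∀ x ∈ D, U t x ∈ S.domain) :
    IsSymmSurj S.closure := by
  obtain ⟨hS, hSle⟩ := hU.isClosable_of_le hle
  refine isSymmSurj_of_isClosed hS.closure_isClosed
    (fun x y x' y' h h' => hU.inner_generatorGraph (hSle h) (hSle h')) fun c hc φ hφ => ?_
  have hker : ∀ x ∈ D, ⟪φ, x⟫_ℂ = 0 := fun x hx => by
    have h1 : ∀ t, HasDerivAt (fun t => ⟪φ, U t x⟫_ℂ) (((-c : ℝ) : ℂ) * ⟪φ, U t x⟫_ℂ) t := by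
      intro t
      obtain ⟨w, hw⟩ := LinearPMap.mem_domain_iff.1 (hinv t x hx)
      have hg := IsUnitaryGroup.mem_generatorGraph.1 (hle hw)
      have hg' : HasDerivAt (fun r => U r (U t x)) (-Complex.I • w) (t - t) := by rwa [sub_self]
      have h2 := hg'.comp_sub_const t t
      simp only [← hU.apply_add, sub_add_cancel] at h2
      have h3 := (hasDerivAt_const t φ).inner ℂ h2
      have h4 := hφ _ _ (LinearPMap.le_graph_of_le S.le_closure hw)
      rw [inner_add_right, inner_smul_right] at h4
      rw [inner_smul_right, inner_zero_left, add_zero] at h3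
      refine h3.congr_deriv ?_
      have hI : Complex.I * Complex.I = -1 := Complex.I_mul_I
      push_cast
      linear_combination -Complex.I * h4 + c * ⟪φ, U t x⟫_ℂ * hI
    have h2 := eq_zero_of_hasDerivAt_mul_of_bounded (neg_ne_zero.2 hc) h1 (C := ‖φ‖ * ‖x‖)
      fun t => (norm_inner_le_norm _ _).trans (by rw [hU.norm_apply])
    rwa [hU.apply_zero] at h2
  have hmem : φ ∈ (Submodule.span ℂ D)ᗮ := by
    rw [Submodule.mem_orthogonal']
    intro u hu
    induction hu using Submodule.span_induction with
    | mem x hx => exact hker x hx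
    | zero => exact inner_zero_right _
    | add x y _ _ hx hy => rw [inner_add_right, hx, hy, add_zero]
    | smul a x _ hx => rw [inner_smul_right, hx, mul_zero]
  rwa [(Submodule.topologicalClosure_eq_top_iff).1 hD, Submodule.mem_bot] at hmem

/-- A total set of vectors which is invariant under a unitary group and contained in the domain of
its generator is a core. -/
theorem IsUnitaryGroup.isUnitaryGroupOf_closure {U : ℝ → E →L[ℂ] E} {S : E →ₗ.[ℂ] E}
    (hU : IsUnitaryGroup U) (hle : S.graph ≤ IsUnitaryGroup.generatorGraph U) {D : Set E}
    (hD : (Submodule.span ℂ D).topologicalClosure = ⊤) (hinv : ∀ t, ∀ x ∈ D, U t x ∈ S.domain) :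
    IsUnitaryGroupOf S.closure U :=
  (hU.isSymmSurj_closure hle hD hinv).isUnitaryGroupOf hU (hU.isClosable_of_le hle).2

end Stone


/-! ### Operators on Hilbert space tensor products -/

section Tensor

variable {E : Type*} [NormedAddCommGroup E] [InnerProductSpace ℂ E]
variable {F : Type*} [NormedAddCommGroup F] [InnerProductSpace ℂ F]

open Filter Topology

/-- The pure tensor `x ⊗ y` in the Hilbert space tensor product. -/
def ht (x : E) (y : F) : HTensor E F :=
  ((x ⊗ₜ[ℂ] y : E ⊗[ℂ] F) : UniformSpace.Completion (E ⊗[ℂ] F))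

variable (E F) in
/-- The pure tensor as a continuous bilinear map. -/
def htL : E →L[ℂ] F →L[ℂ] HTensor E F :=
  (ContinuousLinearMap.compL ℂ F (E ⊗[ℂ] F) (HTensor E F)
    UniformSpace.Completion.toComplL) ∘L TensorProduct.mkL ℂ E F

theorem htL_apply (x : E) (y : F) : htL E F x y = ht x y := rfl

theorem inner_ht (x x' : E) (y y' : F) : ⟪ht x y, ht x' y'⟫_ℂ = ⟪x, x'⟫_ℂ * ⟪y, y'⟫_ℂ := by
  rw [ht, ht, UniformSpace.Completion.inner_coe, TensorProduct.inner_tmul]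

theorem continuous_ht {X : Type*} [TopologicalSpace X] {a : X → E} {b : X → F}
    (ha : Continuous a) (hb : Continuous b) : Continuous fun t => ht (a t) (b t) :=
  ((htL E F).continuous.comp ha).clm_apply hb

theorem hasDerivAt_ht {a : ℝ → E} {b : ℝ → F} {a' : E} {b' : F} {t : ℝ} (ha : HasDerivAt a a' t)
    (hb : HasDerivAt b b' t) :
    HasDerivAt (fun t => ht (a t) (b t)) (ht (a t) b' + ht a' (b t)) t := by
  have := ((htL E F).bilinearRestrictScalars ℝ).hasDerivAt_of_bilinear (fun _ => ha) (fun _ => hb)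
  exact this

/-- The pure tensors with entries in total sets are total. -/
theorem span_ht_eq_top {D : Set E} {D' : Set F} (hD : (Submodule.span ℂ D).topologicalClosure = ⊤)
    (hD' : (Submodule.span ℂ D').topologicalClosure = ⊤) :
    (Submodule.span ℂ (Set.image2 (ht (E := E) (F := F)) D D')).topologicalClosure = ⊤ := by
  set K := (Submodule.span ℂ (Set.image2 (ht (E := E) (F := F)) D D')).topologicalClosure
  have hK : IsClosed (K : Set (HTensor E F)) := Submodule.isClosed_topologicalClosure _
  have h1 : ∀ x ∈ D, ∀ y, ht x y ∈ K := fun x hx y => by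
    have hle : (Submodule.span ℂ D').topologicalClosure ≤ K.comap (htL E F x).toLinearMap := by
      refine Submodule.topologicalClosure_minimal _ (Submodule.span_le.2 fun y hy => ?_)
        (hK.preimage (htL E F x).continuous)
      exact Submodule.le_topologicalClosure _ (Submodule.subset_span ⟨x, hx, y, hy, rfl⟩)
    rw [hD'] at hle
    exact hle Submodule.mem_top
  have h2 : ∀ x y, ht x y ∈ K := fun x y => by
    have hle : (Submodule.span ℂ D).topologicalClosure ≤
        K.comap ((htL E F).flip y).toLinearMap :=
      Submodule.topologicalClosure_minimal _ (Submodule.span_le.2 fun x hx => h1 x hx y)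
        (hK.preimage ((htL E F).flip y).continuous)
    rw [hD] at hle
    exact hle Submodule.mem_top
  rw [Submodule.eq_top_iff']
  intro z
  induction z using UniformSpace.Completion.induction_on with
  | hp => exact hK
  | ih z =>
    induction z using TensorProduct.induction_on with
    | zero => exact K.zero_mem
    | tmul x y => exact h2 x y
    | add a b ha hb => rw [UniformSpace.Completion.coe_add]; exact K.add_mem ha hb

theorem span_univ_closure : (Submodule.span ℂ (Set.univ : Set E)).topologicalClosure = ⊤ := by
  rw [Submodule.span_univ]
  exact top_le_iff.1 (Submodule.le_topologicalClosure _)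

/-- Continuous linear maps on a Hilbert space tensor product are determined on pure tensors. -/
theorem ext_ht {G : Type*} [NormedAddCommGroup G] [NormedSpace ℂ G]
    {S T : HTensor E F →L[ℂ] G} (h : ∀ x y, S (ht x y) = T (ht x y)) : S = T := by
  refine ContinuousLinearMap.ext_on (s := Set.image2 ht Set.univ Set.univ) ?_ ?_
  · rw [Submodule.dense_iff_topologicalClosure_eq_top]
    exact span_ht_eq_top span_univ_closure span_univ_closure
  · rintro _ ⟨x, -, y, -, rfl⟩
    exact h x y

/-- The bounded operator `X ⊗ Y` on the Hilbert space tensor product. -/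
def mapT (X : E →L[ℂ] E) (Y : F →L[ℂ] F) : HTensor E F →L[ℂ] HTensor E F :=
  (TensorProduct.mapL X Y).completion

@[simp] theorem mapT_ht (X : E →L[ℂ] E) (Y : F →L[ℂ] F) (x : E) (y : F) :
    mapT X Y (ht x y) = ht (X x) (Y y) := by
  rw [mapT, ht, ContinuousLinearMap.completion_apply_coe, TensorProduct.mapL_tmul]; rfl

theorem ampliation_eq (X : E →L[ℂ] E) : ampliation F X = mapT X 1 :=
  ext_ht fun x y => by
    rw [mapT_ht, ampliation, ht, ContinuousLinearMap.completion_apply_coe]; rfl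

theorem mapT_mul (X X' : E →L[ℂ] E) (Y Y' : F →L[ℂ] F) :
    mapT X Y * mapT X' Y' = mapT (X * X') (Y * Y') :=
  ext_ht fun x y => by simp

theorem mapT_one : mapT (1 : E →L[ℂ] E) (1 : F →L[ℂ] F) = 1 := ext_ht fun x y => by simp

theorem ht_add_left (x x' : E) (y : F) : ht (x + x') y = ht x y + ht x' y := by
  simp only [← htL_apply, map_add, add_apply]

theorem ht_add_right (x : E) (y y' : F) : ht x (y + y') = ht x y + ht x y' := by
  simp only [← htL_apply, map_add]

theorem ht_smul_left (c : ℂ) (x : E) (y : F) : ht (c • x) y = c • ht x y := by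
  simp only [← htL_apply, map_smul, smul_apply]

theorem ht_smul_right (c : ℂ) (x : E) (y : F) : ht x (c • y) = c • ht x y := by
  simp only [← htL_apply, map_smul]

theorem mapT_add_right (X : E →L[ℂ] E) (Y Y' : F →L[ℂ] F) :
    mapT X (Y + Y') = mapT X Y + mapT X Y' :=
  ext_ht fun x y => by simp [ht_add_right]

theorem mapT_smul_right (X : E →L[ℂ] E) (c : ℂ) (Y : F →L[ℂ] F) :
    mapT X (c • Y) = c • mapT X Y :=
  ext_ht fun x y => by simp [ht_smul_right]

theorem norm_mapT_le (X : E →L[ℂ] E) (Y : F →L[ℂ] F) : ‖mapT X Y‖ ≤ ‖X‖ * ‖Y‖ := by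
  refine ContinuousLinearMap.opNorm_le_bound _ (by positivity) fun z => ?_
  induction z using UniformSpace.Completion.induction_on with
  | hp => exact isClosed_le (by fun_prop) (by fun_prop)
  | ih z =>
    rw [mapT, ContinuousLinearMap.completion_apply_coe, UniformSpace.Completion.norm_coe,
      UniformSpace.Completion.norm_coe]
    exact (TensorProduct.mapL X Y).le_of_opNorm_le (TensorProduct.norm_mapL_le X Y) z

/-- Two vectors of a tensor product agree if their inner products with pure tensors do. -/
theorem eq_of_inner_ht {z w : HTensor E F} (h : ∀ x y, ⟪ht x y, z⟫_ℂ = ⟪ht x y, w⟫_ℂ) : z = w := by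
  have h1 : (innerSL ℂ z : HTensor E F →L[ℂ] ℂ) = innerSL ℂ w := ext_ht fun x y => by
    rw [innerSL_apply_apply, innerSL_apply_apply, ← inner_conj_symm, h, inner_conj_symm]
  exact (innerSL_inj (𝕜 := ℂ)).1 h1

theorem adjoint_mapT [CompleteSpace E] [CompleteSpace F] (X : E →L[ℂ] E) (Y : F →L[ℂ] F) :
    ContinuousLinearMap.adjoint (mapT X Y) =
      mapT (ContinuousLinearMap.adjoint X) (ContinuousLinearMap.adjoint Y) := by
  refine ext_ht fun x y => eq_of_inner_ht fun x' y' => ?_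
  rw [ContinuousLinearMap.adjoint_inner_right, mapT_ht, mapT_ht, inner_ht, inner_ht,
    ContinuousLinearMap.adjoint_inner_right, ContinuousLinearMap.adjoint_inner_right]

/-! ### Algebraic tensor products of unbounded operators -/

theorem mem_graph_bdd {X : E →L[ℂ] E} {x y : E} : (x, y) ∈ (bdd X).graph ↔ y = X x := by
  rw [LinearPMap.mem_graph_iff']
  constructor
  · rintro ⟨z, hz⟩
    obtain ⟨rfl, rfl⟩ := Prod.mk.inj hz
    rfl
  · rintro rfl
    exact ⟨⟨x, Submodule.mem_top⟩, rfl⟩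

theorem tensorOp_apply (A : E →ₗ.[ℂ] E) (B : F →ₗ.[ℂ] F) (z : A.domain ⊗[ℂ] B.domain) :
    (tensorIncl A.domain B.domain z,
      ((TensorProduct.map A.toFun B.toFun z : E ⊗[ℂ] F) : HTensor E F)) ∈ (tensorOp A B).graph := by
  rw [LinearPMap.mem_graph_iff']
  refine ⟨⟨tensorIncl A.domain B.domain z, ⟨z, rfl⟩⟩, ?_⟩
  refine Prod.ext rfl ?_
  simp only [tensorOp]
  change ((TensorProduct.map A.toFun B.toFun ((LinearEquiv.ofInjective
    (tensorIncl A.domain B.domain).toLinearMap _).symm ⟨_, _⟩) : E ⊗[ℂ] F) : HTensor E F) = _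
  congr 2
  exact (LinearEquiv.symm_apply_eq _).2 (Subtype.ext rfl)

theorem ht_mem_tensorOp_graph {A : E →ₗ.[ℂ] E} {B : F →ₗ.[ℂ] F} {x x' : E} {y y' : F}
    (hx : (x, x') ∈ A.graph) (hy : (y, y') ∈ B.graph) :
    (ht x y, ht x' y') ∈ (tensorOp A B).graph := by
  obtain ⟨a, ha⟩ := A.mem_graph_iff'.1 hx
  obtain ⟨b, hb⟩ := B.mem_graph_iff'.1 hy
  obtain ⟨rfl, rfl⟩ := Prod.mk.inj ha
  obtain ⟨rfl, rfl⟩ := Prod.mk.inj hb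
  exact tensorOp_apply A B (a ⊗ₜ b)

/-- The graph of the algebraic tensor product is spanned by the pure tensors of the graphs. -/
theorem tensorOp_graph_le {A : E →ₗ.[ℂ] E} {B : F →ₗ.[ℂ] F}
    {G : Submodule ℂ (HTensor E F × HTensor E F)}
    (h : ∀ x x' y y', (x, x') ∈ A.graph → (y, y') ∈ B.graph → (ht x y, ht x' y') ∈ G) :
    (tensorOp A B).graph ≤ G := by
  have h1 : ∀ z : A.domain ⊗[ℂ] B.domain, (tensorIncl A.domain B.domain z,
      ((TensorProduct.map A.toFun B.toFun z : E ⊗[ℂ] F) : HTensor E F)) ∈ G := fun z => by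
    induction z using TensorProduct.induction_on with
    | zero =>
      simp only [map_zero, UniformSpace.Completion.coe_zero]
      exact G.zero_mem
    | tmul a b => exact h _ _ _ _ (A.mem_graph a) (B.mem_graph b)
    | add a b ha hb =>
      have := G.add_mem ha hb
      rwa [Prod.mk_add_mk, ← map_add, ← UniformSpace.Completion.coe_add, ← map_add] at this
  rintro ⟨p, q⟩ hp
  obtain ⟨⟨z, hz⟩, -⟩ := LinearPMap.mem_domain_of_mem_graph hp, trivial
  have hq := (tensorOp A B).mem_graph_snd_inj hp (tensorOp_apply A B z) hz.symm
  have := h1 z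
  rw [← hq] at this
  convert this using 2
  exact hz.symm

theorem mem_domain_of_ht {A : E →ₗ.[ℂ] E} {B : F →ₗ.[ℂ] F} {x : E} {y : F} (hx : x ∈ A.domain)
    (hy : y ∈ B.domain) : ht x y ∈ (tensorOp A B).domain := by
  obtain ⟨x', hx'⟩ := LinearPMap.mem_domain_iff.1 hx
  obtain ⟨y', hy'⟩ := LinearPMap.mem_domain_iff.1 hy
  exact LinearPMap.mem_domain_of_mem_graph (ht_mem_tensorOp_graph hx' hy')

theorem mem_graph_add {V : Type*} [NormedAddCommGroup V] [NormedSpace ℂ V] {A B : V →ₗ.[ℂ] V}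
    {x y : V} : (x, y) ∈ (A + B).graph ↔
      ∃ y₁ y₂, (x, y₁) ∈ A.graph ∧ (x, y₂) ∈ B.graph ∧ y = y₁ + y₂ := by
  constructor
  · intro h
    obtain ⟨⟨z, hz⟩, h'⟩ := (LinearPMap.mem_graph_iff' _).1 h
    obtain ⟨rfl, rfl⟩ := Prod.mk.inj h'
    exact ⟨A ⟨z, hz.1⟩, B ⟨z, hz.2⟩, A.mem_graph ⟨z, hz.1⟩, B.mem_graph ⟨z, hz.2⟩, rfl⟩
  · rintro ⟨y₁, y₂, h₁, h₂, rfl⟩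
    obtain ⟨⟨a, ha⟩, h₁'⟩ := (LinearPMap.mem_graph_iff' _).1 h₁
    obtain ⟨⟨b, hb⟩, h₂'⟩ := (LinearPMap.mem_graph_iff' _).1 h₂
    obtain ⟨rfl, rfl⟩ := Prod.mk.inj h₁'
    obtain ⟨rfl, rfl⟩ := Prod.mk.inj h₂'
    exact (A + B).mem_graph ⟨_, ha, hb⟩

theorem mem_graph_sub {V : Type*} [NormedAddCommGroup V] [NormedSpace ℂ V] {A B : V →ₗ.[ℂ] V}
    {x y : V} : (x, y) ∈ (A - B).graph ↔
      ∃ y₁ y₂, (x, y₁) ∈ A.graph ∧ (x, y₂) ∈ B.graph ∧ y = y₁ - y₂ := by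
  constructor
  · intro h
    obtain ⟨⟨z, hz⟩, h'⟩ := (LinearPMap.mem_graph_iff' _).1 h
    obtain ⟨rfl, rfl⟩ := Prod.mk.inj h'
    exact ⟨A ⟨z, hz.1⟩, B ⟨z, hz.2⟩, A.mem_graph ⟨z, hz.1⟩, B.mem_graph ⟨z, hz.2⟩, rfl⟩
  · rintro ⟨y₁, y₂, h₁, h₂, rfl⟩
    obtain ⟨⟨a, ha⟩, h₁'⟩ := (LinearPMap.mem_graph_iff' _).1 h₁
    obtain ⟨⟨b, hb⟩, h₂'⟩ := (LinearPMap.mem_graph_iff' _).1 h₂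
    obtain ⟨rfl, rfl⟩ := Prod.mk.inj h₁'
    obtain ⟨rfl, rfl⟩ := Prod.mk.inj h₂'
    exact (A - B).mem_graph ⟨_, ha, hb⟩

theorem mem_graph_smul {V : Type*} [NormedAddCommGroup V] [NormedSpace ℂ V] {A : V →ₗ.[ℂ] V}
    {c : ℂ} {x y : V} : (x, y) ∈ (c • A).graph ↔ ∃ y₁, (x, y₁) ∈ A.graph ∧ y = c • y₁ := by
  constructor
  · intro h
    obtain ⟨⟨z, hz⟩, h'⟩ := (LinearPMap.mem_graph_iff' _).1 h
    obtain ⟨rfl, rfl⟩ := Prod.mk.inj h'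
    exact ⟨A ⟨z, hz⟩, A.mem_graph _, rfl⟩
  · rintro ⟨y₁, h₁, rfl⟩
    obtain ⟨⟨a, ha⟩, h₁'⟩ := (LinearPMap.mem_graph_iff' _).1 h₁
    obtain ⟨rfl, rfl⟩ := Prod.mk.inj h₁'
    exact (c • A).mem_graph ⟨_, ha⟩

/-! ### Unitary groups on tensor products -/

variable [CompleteSpace E] [CompleteSpace F]

theorem mapT_mem_unitary {X : E →L[ℂ] E} {Y : F →L[ℂ] F} (hX : X ∈ unitary (E →L[ℂ] E))
    (hY : Y ∈ unitary (F →L[ℂ] F)) : mapT X Y ∈ unitary (HTensor E F →L[ℂ] HTensor E F) := by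
  rw [Unitary.mem_iff] at *
  rw [ContinuousLinearMap.star_eq_adjoint, adjoint_mapT, mapT_mul, mapT_mul,
    ← ContinuousLinearMap.star_eq_adjoint, ← ContinuousLinearMap.star_eq_adjoint, hX.1, hX.2, hY.1,
    hY.2, mapT_one]
  exact ⟨rfl, rfl⟩

theorem isUnitaryGroup_one : IsUnitaryGroup fun _ => (1 : E →L[ℂ] E) :=
  ⟨fun _ => one_mem _, rfl, fun _ _ => (one_mul 1).symm, fun _ => continuous_const⟩

theorem IsUnitaryGroup.mapT {U : ℝ → E →L[ℂ] E} {V : ℝ → F →L[ℂ] F} (hU : IsUnitaryGroup U)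
    (hV : IsUnitaryGroup V) : IsUnitaryGroup fun t => mapT (U t) (V t) := by
  refine .of_norm (fun t => norm_apply_of_mem_unitary (mapT_mem_unitary (hU.unitary t)
    (hV.unitary t))) (by rw [hU.zero, hV.zero, mapT_one]) (fun s t => ?_)
    (span_ht_eq_top span_univ_closure span_univ_closure) ?_
  · rw [mapT_mul, hU.add, hV.add]
  · rintro _ ⟨x, -, y, -, rfl⟩
    simp only [mapT_ht]
    exact continuous_ht (hU.continuous x) (hV.continuous y)

/-- A product rule under strong continuity alone: the slope splits into the slope of U at z and U_t
applied to the slope of V, and the isometries U_t converge on convergent arguments. -/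
theorem IsUnitaryGroup.hasDerivAt_comp {U V : ℝ → E →L[ℂ] E} (hU : IsUnitaryGroup U) {z w₁ w₂ : E}
    (h₁ : (z, w₁) ∈ generatorGraph U) (h₂ : (z, w₂) ∈ generatorGraph V) (hV0 : V 0 = 1) :
    HasDerivAt (fun t => U t (V t z)) (-Complex.I • (w₁ + w₂)) 0 := by
  rw [mem_generatorGraph, hasDerivAt_iff_tendsto_slope] at h₁ h₂
  rw [hasDerivAt_iff_tendsto_slope]
  have h3 : Tendsto (fun t => U t (slope (fun t => V t z) 0 t)) (𝓝[≠] 0)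
      (𝓝 (-Complex.I • w₂)) := by
    have ha : Tendsto (fun t => U t (slope (fun t => V t z) 0 t - -Complex.I • w₂)) (𝓝[≠] 0)
        (𝓝 0) := by
      rw [tendsto_zero_iff_norm_tendsto_zero]
      simp only [hU.norm_apply]
      rw [← tendsto_zero_iff_norm_tendsto_zero]
      simpa using h₂.sub_const (-Complex.I • w₂)
    have hb : Tendsto (fun t => U t (-Complex.I • w₂)) (𝓝[≠] 0) (𝓝 (-Complex.I • w₂)) := by
      have := (hU.continuous (-Complex.I • w₂)).tendsto 0
      rw [hU.apply_zero] at this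
      exact this.mono_left nhdsWithin_le_nhds
    simpa using ha.add hb
  have h4 := h₁.add h3
  rw [← smul_add] at h4
  refine h4.congr fun t => ?_
  simp only [slope, sub_zero, vsub_eq_sub, hU.apply_zero, hV0, one_apply_eq_self]
  rw [← Complex.coe_smul, ← Complex.coe_smul, map_smul, map_sub, ← Complex.coe_smul, ← smul_add]
  congr 1
  abel

theorem IsUnitaryGroupOf.span_domain {A : E →ₗ.[ℂ] E} {U : ℝ → E →L[ℂ] E}
    (h : IsUnitaryGroupOf A U) :
    (Submodule.span ℂ (A.domain : Set E)).topologicalClosure = ⊤ := by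
  rw [Submodule.span_eq, Submodule.topologicalClosure_eq_top_iff, Submodule.eq_bot_iff]
  intro ψ hψ
  refine h.isUnitaryGroup.eq_zero_of_inner_generatorGraph fun x y hxy => ?_
  rw [← h.graph_eq] at hxy
  exact (Submodule.mem_orthogonal' _ _).1 hψ _ (LinearPMap.mem_domain_of_mem_graph hxy)

theorem IsUnitaryGroupOf.apply_mem_graph {A : E →ₗ.[ℂ] E} {U : ℝ → E →L[ℂ] E}
    (h : IsUnitaryGroupOf A U) {x y : E} (hxy : (x, y) ∈ A.graph) (t : ℝ) :
    (U t x, U t y) ∈ A.graph := by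
  have hU := h.isUnitaryGroup
  rw [h.graph_eq] at hxy ⊢
  have h1 : HasDerivAt (fun t => U t x) (-Complex.I • U t y) (0 + t) := by
    rw [zero_add]; exact hU.hasDerivAt hxy t
  have h2 := h1.comp_add_const 0 t
  rw [IsUnitaryGroup.mem_generatorGraph]
  simpa only [hU.apply_add] using h2

theorem IsUnitaryGroupOf.apply_mem_domain {A : E →ₗ.[ℂ] E} {U : ℝ → E →L[ℂ] E}
    (h : IsUnitaryGroupOf A U) {x : E} (hx : x ∈ A.domain) (t : ℝ) : U t x ∈ A.domain := by
  obtain ⟨y, hy⟩ := LinearPMap.mem_domain_iff.1 hx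
  exact LinearPMap.mem_domain_of_mem_graph (h.apply_mem_graph hy t)

/-- The converse of Stone's theorem: the domain is its own invariant core, and the generator is
already closed. -/
theorem IsUnitaryGroupOf.isSymmSurj {A : E →ₗ.[ℂ] E} {U : ℝ → E →L[ℂ] E}
    (h : IsUnitaryGroupOf A U) : IsSymmSurj A := by
  have h1 := h.isUnitaryGroup.isSymmSurj_closure h.graph_eq.le h.span_domain
    fun t x hx => h.apply_mem_domain hx t
  have h2 : A.IsClosed := by
    rw [LinearPMap.IsClosed, h.graph_eq]
    exact h.isUnitaryGroup.isClosed_generatorGraph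
  have h3 : A.closure = A := LinearPMap.eq_of_eq_graph <| by
    rw [← h2.isClosable.graph_closure_eq_closure_graph]
    exact IsClosed.submodule_topologicalClosure_eq h2
  rwa [h3] at h1

theorem tensorOp_bdd_one_left_graph_le {B : F →ₗ.[ℂ] F} {V : ℝ → F →L[ℂ] F}
    (hV : IsUnitaryGroupOf B V) : (tensorOp (bdd (1 : E →L[ℂ] E)) B).graph ≤
      IsUnitaryGroup.generatorGraph fun t => mapT (1 : E →L[ℂ] E) (V t) := by
  refine tensorOp_graph_le fun x x' y y' hx hy => ?_
  obtain rfl : x' = x := mem_graph_bdd.1 hx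
  rw [IsUnitaryGroup.mem_generatorGraph]
  have := hasDerivAt_ht (hasDerivAt_const (0 : ℝ) x') ((hV.generator y y').1 hy)
  simp only [mapT_ht, one_apply_eq_self]
  refine this.congr_deriv ?_
  rw [ht_smul_right, ← htL_apply 0, map_zero, zero_apply, add_zero]

theorem tensorOp_bdd_one_right_graph_le {A : E →ₗ.[ℂ] E} {U : ℝ → E →L[ℂ] E}
    (hU : IsUnitaryGroupOf A U) : (tensorOp A (bdd (1 : F →L[ℂ] F))).graph ≤
      IsUnitaryGroup.generatorGraph fun t => mapT (U t) (1 : F →L[ℂ] F) := by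
  refine tensorOp_graph_le fun x x' y y' hx hy => ?_
  obtain rfl : y' = y := mem_graph_bdd.1 hy
  rw [IsUnitaryGroup.mem_generatorGraph]
  have := hasDerivAt_ht ((hU.generator x x').1 hx) (hasDerivAt_const (0 : ℝ) y')
  simp only [mapT_ht, one_apply_eq_self]
  refine this.congr_deriv ?_
  rw [ht_smul_left, ← htL_apply _ 0, map_zero, zero_add]

theorem isUnitaryGroupOf_tensorOp_closure {B : F →ₗ.[ℂ] F} {V : ℝ → F →L[ℂ] F}
    (hV : IsUnitaryGroupOf B V) : IsUnitaryGroupOf (tensorOp (bdd (1 : E →L[ℂ] E)) B).closure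
      fun t => mapT (1 : E →L[ℂ] E) (V t) := by
  refine (isUnitaryGroup_one.mapT hV.isUnitaryGroup).isUnitaryGroupOf_closure
    (tensorOp_bdd_one_left_graph_le hV) (span_ht_eq_top span_univ_closure hV.span_domain) ?_
  rintro t _ ⟨x, -, y, hy, rfl⟩
  rw [mapT_ht]
  exact mem_domain_of_ht Submodule.mem_top (hV.apply_mem_domain hy t)

/-- Pure tensors of domain vectors are total and are permuted by e^{-itA}⊗e^{-itB}, so they form a
core; the product rule identifies the generator on them. -/
theorem isUnitaryGroupOf_tensorSum {A : E →ₗ.[ℂ] E} {B : F →ₗ.[ℂ] F} {U : ℝ → E →L[ℂ] E}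
    {V : ℝ → F →L[ℂ] F} (hU : IsUnitaryGroupOf A U) (hV : IsUnitaryGroupOf B V) :
    IsUnitaryGroupOf (tensorSum A B) fun t => mapT (U t) (V t) := by
  refine (hU.isUnitaryGroup.mapT hV.isUnitaryGroup).isUnitaryGroupOf_closure ?_
    (span_ht_eq_top hU.span_domain hV.span_domain) ?_
  · rintro ⟨z, w⟩ h
    obtain ⟨w₁, w₂, h₁, h₂, rfl⟩ := mem_graph_add.1 h
    have := (hU.isUnitaryGroup.mapT (isUnitaryGroup_one (E := F))).hasDerivAt_comp
      (tensorOp_bdd_one_right_graph_le hU h₁) (tensorOp_bdd_one_left_graph_le hV h₂)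
      (by rw [hV.zero, mapT_one])
    rw [IsUnitaryGroup.mem_generatorGraph]
    simp only [← mul_apply_eq_comp, mapT_mul, mul_one, one_mul] at this
    exact this
  · rintro t _ ⟨x, hx, y, hy, rfl⟩
    rw [mapT_ht]
    exact ⟨mem_domain_of_ht (hU.apply_mem_domain hx t) Submodule.mem_top,
      mem_domain_of_ht Submodule.mem_top (hV.apply_mem_domain hy t)⟩

end Tensor


/-! ### The `n`-particle spaces -/

section NParticle

universe w
variable {f : Type w} [NormedAddCommGroup f] [InnerProductSpace ℂ f]

open Filter Topology

theorem tensorLeft_add (g g' : f) (n : ℕ) (ψ : TensorPow f n) :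
    tensorLeft (g + g') n ψ = tensorLeft g n ψ + tensorLeft g' n ψ := ht_add_left g g' ψ

theorem tensorLeft_smul (c : ℂ) (g : f) (n : ℕ) (ψ : TensorPow f n) :
    tensorLeft (c • g) n ψ = c • tensorLeft g n ψ := ht_smul_left c g ψ

theorem inner_tensorLeft (g g' : f) (n : ℕ) (ψ ψ' : TensorPow f n) :
    ⟪tensorLeft g n ψ, tensorLeft g' n ψ'⟫_ℂ = ⟪g, g'⟫_ℂ * ⟪ψ, ψ'⟫_ℂ := inner_ht g g' ψ ψ'

theorem norm_tensorLeft (g : f) (n : ℕ) (ψ : TensorPow f n) :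
    ‖tensorLeft g n ψ‖ = ‖g‖ * ‖ψ‖ := by
  change ‖((g ⊗ₜ[ℂ] ψ : f ⊗[ℂ] TensorPow f n) : HTensor f (TensorPow f n))‖ = _
  rw [UniformSpace.Completion.norm_coe, TensorProduct.norm_tmul]

theorem tpow_succ (x : f) (n : ℕ) : tpow x (n + 1) = tensorLeft x n (tpow x n) := rfl

theorem inner_tpow (x y : f) (n : ℕ) : ⟪tpow x n, tpow y n⟫_ℂ = ⟪x, y⟫_ℂ ^ n := by
  induction n with
  | zero =>
    rw [pow_zero]
    change ⟪EuclideanSpace.single PUnit.unit (1 : ℂ), EuclideanSpace.single PUnit.unit (1 : ℂ)⟫_ℂ = 1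
    simp
  | succ n ih => rw [tpow_succ, tpow_succ, inner_tensorLeft, ih, pow_succ']

/-- The `n`-th tensor power of a bounded operator. -/
def tpowMap (u : f →L[ℂ] f) : (n : ℕ) → TensorPow f n →L[ℂ] TensorPow f n
  | 0 => 1
  | n + 1 => mapT u (tpowMap u n)

theorem tpowMap_tpow (u : f →L[ℂ] f) (x : f) (n : ℕ) : tpowMap u n (tpow x n) = tpow (u x) n := by
  induction n with
  | zero => rfl
  | succ n ih => rw [tpow_succ, tpow_succ, ← ih]; exact mapT_ht _ _ _ _

/-- The vector `x ⊗ ⋯ ⊗ x` as an element of the `n`-particle space. -/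
def spow (x : f) (n : ℕ) : symPow f n :=
  ⟨tpow x n, Submodule.le_topologicalClosure _ (Submodule.subset_span ⟨x, rfl⟩)⟩

theorem inner_spow (x y : f) (n : ℕ) : ⟪spow x n, spow y n⟫_ℂ = ⟪x, y⟫_ℂ ^ n := inner_tpow x y n

theorem span_spow (n : ℕ) :
    (Submodule.span ℂ (Set.range fun x : f => spow x n)).topologicalClosure = ⊤ := by
  rw [Submodule.topologicalClosure_eq_top_iff, Submodule.eq_bot_iff]
  intro φ hφ
  have h1 : symPow f n ≤ (ℂ ∙ (φ : TensorPow f n))ᗮ := by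
    refine Submodule.topologicalClosure_minimal _ (Submodule.span_le.2 ?_)
      (Submodule.isClosed_orthogonal _)
    rintro _ ⟨x, rfl⟩
    refine (Submodule.mem_orthogonal_singleton_iff_inner_left).2 ?_
    exact (Submodule.mem_orthogonal _ _).1 hφ (spow x n) (Submodule.subset_span ⟨x, rfl⟩)
  have h2 := Submodule.mem_orthogonal_singleton_iff_inner_left.1 (h1 φ.2)
  exact inner_self_eq_zero (𝕜 := ℂ).1 h2

/-- Polarization in operator form: identities between bounded operators on an n-particle space need
only be checked on powers x⊗⋯⊗x, where they become polynomial in x and can be differentiated. -/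
theorem ext_spow {n : ℕ} {G : Type*} [NormedAddCommGroup G] [NormedSpace ℂ G]
    {S T : symPow f n →L[ℂ] G} (h : ∀ x, S (spow x n) = T (spow x n)) : S = T := by
  refine ContinuousLinearMap.ext_on (s := Set.range fun x : f => spow x n) ?_ ?_
  · rw [Submodule.dense_iff_topologicalClosure_eq_top]
    exact span_spow n
  · rintro _ ⟨x, rfl⟩
    exact h x

theorem eq_of_inner_spow {n : ℕ} {φ ψ : symPow f n}
    (h : ∀ x, ⟪spow x n, φ⟫_ℂ = ⟪spow x n, ψ⟫_ℂ) : φ = ψ := by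
  have h1 : (innerSL ℂ φ : symPow f n →L[ℂ] ℂ) = innerSL ℂ ψ := ext_spow fun x => by
    rw [innerSL_apply_apply, innerSL_apply_apply, ← inner_conj_symm, h, inner_conj_symm]
  exact (innerSL_inj (𝕜 := ℂ)).1 h1

theorem tpowMap_mem_symPow (u : f →L[ℂ] f) (n : ℕ) (ψ : symPow f n) :
    tpowMap u n ψ ∈ symPow f n := by
  have : symPow f n ≤ (symPow f n).comap (tpowMap u n).toLinearMap := by
    refine Submodule.topologicalClosure_minimal _ (Submodule.span_le.2 ?_)
      ((Submodule.isClosed_topologicalClosure _).preimage (tpowMap u n).continuous)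
    rintro _ ⟨x, rfl⟩
    change tpowMap u n (tpow x n) ∈ symPow f n
    rw [tpowMap_tpow]
    exact (spow (u x) n).2
  exact this ψ.2

/-- The `n`-th tensor power of a bounded operator, on the `n`-particle space. -/
def spowMap (u : f →L[ℂ] f) (n : ℕ) : symPow f n →L[ℂ] symPow f n :=
  (tpowMap u n ∘L (symPow f n).subtypeL).codRestrict (symPow f n) (tpowMap_mem_symPow u n)

theorem coe_spowMap (u : f →L[ℂ] f) (n : ℕ) (ψ : symPow f n) :
    (spowMap u n ψ : TensorPow f n) = tpowMap u n ψ := rfl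

theorem spowMap_spow (u : f →L[ℂ] f) (x : f) (n : ℕ) : spowMap u n (spow x n) = spow (u x) n :=
  Subtype.ext (tpowMap_tpow u x n)

/-! ### Creation and annihilation between particle sectors -/

theorem createN_apply (g : f) (n : ℕ) (ψ : symPow f n) :
    createN g n ψ = ((Real.sqrt (n + 1) : ℝ) : ℂ) •
      (symPow f (n + 1)).orthogonalProjectionOnto (tensorLeft g n ψ) := rfl

/-- The symmetrizing projection disappears against symmetric test vectors, leaving a plain tensor
product. -/
theorem inner_createN_left (g : f) (n : ℕ) (ψ : symPow f n) (x : f) :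
    ⟪createN g n ψ, spow x (n + 1)⟫_ℂ =
      ((Real.sqrt (n + 1) : ℝ) : ℂ) * ⟪g, x⟫_ℂ * ⟪ψ, spow x n⟫_ℂ := by
  rw [createN_apply, inner_smul_left, Complex.conj_ofReal, mul_assoc]
  congr 1
  rw [Submodule.inner_orthogonalProjectionOnto_eq_of_mem_right]
  exact inner_tensorLeft _ _ _ _ _

theorem inner_createN_right (g : f) (n : ℕ) (ψ : symPow f n) (x : f) :
    ⟪spow x (n + 1), createN g n ψ⟫_ℂ =
      ((Real.sqrt (n + 1) : ℝ) : ℂ) * ⟪x, g⟫_ℂ * ⟪spow x n, ψ⟫_ℂ := by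
  rw [← inner_conj_symm, inner_createN_left, map_mul, map_mul, inner_conj_symm, inner_conj_symm,
    Complex.conj_ofReal]

theorem norm_createN_le (g : f) (n : ℕ) (ψ : symPow f n) :
    ‖createN g n ψ‖ ≤ Real.sqrt (n + 1) * ‖g‖ * ‖ψ‖ := by
  rw [createN_apply, norm_smul, Complex.norm_real, Real.norm_of_nonneg (Real.sqrt_nonneg _),
    mul_assoc]
  refine mul_le_mul_of_nonneg_left ?_ (Real.sqrt_nonneg _)
  refine (Submodule.norm_orthogonalProjectionOnto_apply_le _ _).trans ?_
  exact (norm_tensorLeft g n (ψ : TensorPow f n)).le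

theorem createN_add (g g' : f) (n : ℕ) (ψ : symPow f n) :
    createN (g + g') n ψ = createN g n ψ + createN g' n ψ := by
  simp only [createN_apply]
  rw [tensorLeft_add, map_add, smul_add]

theorem createN_smul (c : ℂ) (g : f) (n : ℕ) (ψ : symPow f n) :
    createN (c • g) n ψ = c • createN g n ψ := by
  simp only [createN_apply]
  rw [tensorLeft_smul, map_smul, smul_comm]

/-- The annihilation operator from the `(n+1)`-particle to the `n`-particle space. -/
def annihN (g : f) (n : ℕ) : symPow f (n + 1) →L[ℂ] symPow f n :=
  ContinuousLinearMap.adjoint (createN g n)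

theorem annihN_spow (g : f) (n : ℕ) (x : f) :
    annihN g n (spow x (n + 1)) = (((Real.sqrt (n + 1) : ℝ) : ℂ) * ⟪g, x⟫_ℂ) • spow x n := by
  refine ext_inner_left ℂ fun φ => ?_
  rw [annihN, ContinuousLinearMap.adjoint_inner_right, inner_createN_left, inner_smul_right]

theorem hasDerivAt_add_smul (x k : f) : HasDerivAt (fun ε : ℝ => x + ε • k) k 0 := by
  simpa using ((hasDerivAt_id (0 : ℝ)).smul_const k).const_add x

/-- Mere existence suffices; `hasDerivAt_spow` recovers the value from inner products. -/
theorem exists_hasDerivAt_tpow (x k : f) (n : ℕ) :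
    ∃ d, HasDerivAt (fun ε : ℝ => tpow (x + ε • k) n) d 0 := by
  induction n with
  | zero => exact ⟨0, hasDerivAt_const _ _⟩
  | succ n ih =>
    obtain ⟨d, hd⟩ := ih
    exact ⟨_, hasDerivAt_ht (hasDerivAt_add_smul x k) hd⟩

/-- The creation operator is obtained by differentiating `x ⊗ ⋯ ⊗ x`. -/
theorem hasDerivAt_spow (x k : f) (n : ℕ) :
    HasDerivAt (fun ε : ℝ => spow (x + ε • k) (n + 1))
      (((Real.sqrt (n + 1) : ℝ) : ℂ) • createN k n (spow x n)) 0 := by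
  obtain ⟨d, hd⟩ := exists_hasDerivAt_tpow x k (n + 1)
  have h1 := ((symPow f (n + 1)).orthogonalProjectionOnto.restrictScalars
    ℝ).hasFDerivAt.comp_hasDerivAt 0 hd
  have h2 : HasDerivAt (fun ε : ℝ => spow (x + ε • k) (n + 1))
      ((symPow f (n + 1)).orthogonalProjectionOnto d) 0 := by
    refine h1.congr_of_eventuallyEq (Eventually.of_forall fun ε => ?_)
    exact (Submodule.orthogonalProjectionOnto_mem_subspace_eq_self
      (spow (x + ε • k) (n + 1))).symm
  -- Tested against the power of z, both candidates give (n + 1)⟪z, k⟫⟪z, x⟫^n.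
  refine h2.congr_deriv (eq_of_inner_spow fun z => ?_)
  have h3 := (hasDerivAt_const (0 : ℝ) (spow z (n + 1))).inner ℂ h2
  rw [inner_zero_left, add_zero] at h3
  have h4 := (((hasDerivAt_const (0 : ℝ) z).inner ℂ (hasDerivAt_add_smul x k)).fun_pow (n + 1))
  simp only [inner_spow] at h3
  rw [h3.unique h4, inner_smul_right, inner_createN_right, inner_spow]
  have h5 : ((Real.sqrt (n + 1) : ℝ) : ℂ) * ((Real.sqrt (n + 1) : ℝ) : ℂ) = n + 1 := by
    rw [← Complex.ofReal_mul, Real.mul_self_sqrt (by positivity)]; push_cast; rfl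
  simp only [zero_smul, add_zero, inner_zero_left, Nat.add_sub_cancel]
  push_cast
  linear_combination -⟪z, k⟫_ℂ * ⟪z, x⟫_ℂ ^ n * h5

/-- Differentiate a(g)x^{⊗(n+1)} = √(n+1)⟪g, x⟫x^{⊗n} along x + εk and cancel √(n+1). The derivative
d is left abstract since it is 0 in the vacuum sector and a creation term above it; the product rule
then is the commutation relation. -/
theorem hasDerivAt_annihN_spow (g k x : f) (n : ℕ) {d : symPow f n}
    (hd : HasDerivAt (fun ε : ℝ => spow (x + ε • k) n) d 0) :
    annihN g n (createN k n (spow x n)) = ⟪g, k⟫_ℂ • spow x n + ⟪g, x⟫_ℂ • d := by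
  have h1 := ((annihN g n).restrictScalars ℝ).hasFDerivAt.comp_hasDerivAt 0 (hasDerivAt_spow x k n)
  have h2 := ((hasDerivAt_const (0 : ℝ) g).inner ℂ (hasDerivAt_add_smul x k)).fun_smul hd
  have h3 := h2.fun_const_smul ((Real.sqrt (n + 1) : ℝ) : ℂ)
  have h4 := h1.unique (h3.congr_of_eventuallyEq (Eventually.of_forall fun ε => by
    simp only [Function.comp, ContinuousLinearMap.coe_restrictScalars']
    rw [annihN_spow, mul_smul]))
  have h5 : ((Real.sqrt (n + 1) : ℝ) : ℂ) ≠ 0 := by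
    simpa using (Real.sqrt_pos.2 (by positivity : (0 : ℝ) < n + 1)).ne'
  rw [ContinuousLinearMap.coe_restrictScalars', map_smul] at h4
  rw [smul_right_injective _ h5 h4]
  simp [add_comm]

theorem ccr_zero (g k : f) (ψ : symPow f 0) : annihN g 0 (createN k 0 ψ) = ⟪g, k⟫_ℂ • ψ := by
  have : annihN g 0 ∘L createN k 0 = ⟪g, k⟫_ℂ • ContinuousLinearMap.id ℂ _ := ext_spow fun x => by
    have h0 : HasDerivAt (fun ε : ℝ => spow (x + ε • k) 0) 0 0 :=
      hasDerivAt_const (0 : ℝ) (spow x 0)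
    have := hasDerivAt_annihN_spow g k x 0 h0
    simpa using this
  exact congrArg (fun T => T ψ) this

/-- On powers, the term where the derivative hits x^{⊗(n+1)} is exactly a(k)*a(g), and the term
where it hits ⟪g, x⟫ is the commutator. -/
theorem ccr_succ (g k : f) (n : ℕ) (ψ : symPow f (n + 1)) :
    annihN g (n + 1) (createN k (n + 1) ψ) - createN k n (annihN g n ψ) = ⟪g, k⟫_ℂ • ψ := by
  have : annihN g (n + 1) ∘L createN k (n + 1) - createN k n ∘L annihN g n =
      ⟪g, k⟫_ℂ • ContinuousLinearMap.id ℂ _ := ext_spow fun x => by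
    have := hasDerivAt_annihN_spow g k x (n + 1) (hasDerivAt_spow x k n)
    simp only [sub_apply, ContinuousLinearMap.comp_apply, smul_apply, ContinuousLinearMap.id_apply]
    rw [this, annihN_spow, map_smul, smul_smul, mul_comm ⟪g, x⟫_ℂ, add_sub_cancel_right]
  exact congrArg (fun T => T ψ) this

theorem createN_comm (g k : f) (n : ℕ) (ψ : symPow f n) :
    createN g (n + 1) (createN k n ψ) = createN k (n + 1) (createN g n ψ) := by
  refine eq_of_inner_spow fun x => ?_
  simp only [inner_createN_right]
  ring

/-- Creation is the derivative of powers and u maps powers to powers. Surjectivity of u lets every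
test vector be written as a power of some u x. -/
theorem createN_spowMap {u : f →L[ℂ] f} (hu : ∀ x y, ⟪u x, u y⟫_ℂ = ⟪x, y⟫_ℂ)
    (hs : Function.Surjective u) (k : f) (n : ℕ) (ψ : symPow f n) :
    spowMap u (n + 1) (createN k n ψ) = createN (u k) n (spowMap u n ψ) := by
  have : spowMap u (n + 1) ∘L createN k n = createN (u k) n ∘L spowMap u n := by
    refine ext_spow fun y => eq_of_inner_spow fun z => ?_
    obtain ⟨x, rfl⟩ := hs z
    simp only [ContinuousLinearMap.comp_apply]
    rw [inner_createN_right, spowMap_spow, inner_spow, hu, hu]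
    have h1 := hasDerivAt_spow y k n
    have h2 := ((spowMap u (n + 1)).restrictScalars ℝ).hasFDerivAt.comp_hasDerivAt 0 h1
    have h3 := hasDerivAt_spow (u y) (u k) n
    have h4 := h2.unique (h3.congr_of_eventuallyEq (Eventually.of_forall fun ε => by
      simp only [Function.comp, ContinuousLinearMap.coe_restrictScalars']
      rw [spowMap_spow, map_add, ← Complex.coe_smul, map_smul, Complex.coe_smul]))
    have h5 : ((Real.sqrt (n + 1) : ℝ) : ℂ) ≠ 0 := by
      simpa using (Real.sqrt_pos.2 (by positivity : (0 : ℝ) < n + 1)).ne'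
    rw [ContinuousLinearMap.coe_restrictScalars', map_smul] at h4
    rw [smul_right_injective _ h5 h4, inner_createN_right, inner_spow, hu, hu]
  exact congrArg (fun T => T ψ) this

end NParticle


/-! ### Operators on Hilbert space direct sums -/

section DirectSum

variable {G : ℕ → Type*} [∀ n, NormedAddCommGroup (G n)] [∀ n, InnerProductSpace ℂ (G n)]

open Filter Topology
open scoped ENNReal

theorem sum_norm_sq_le (ψ : lp G 2) (s : Finset ℕ) : ∑ n ∈ s, ‖ψ n‖ ^ 2 ≤ ‖ψ‖ ^ 2 := by
  have := lp.sum_rpow_le_norm_rpow (p := 2) (by norm_num) ψ s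
  simpa using this

theorem memℓp_of_sum_le {ψ : ∀ n, G n} {C : ℝ} (h : ∀ s : Finset ℕ, ∑ n ∈ s, ‖ψ n‖ ^ 2 ≤ C) :
    Memℓp ψ 2 :=
  memℓp_gen' (C := C) fun s => by simpa using h s

theorem norm_le_of_sum_le {ψ : lp G 2} {C : ℝ} (hC : 0 ≤ C)
    (h : ∀ s : Finset ℕ, ∑ n ∈ s, ‖ψ n‖ ^ 2 ≤ C ^ 2) : ‖ψ‖ ≤ C :=
  lp.norm_le_of_forall_sum_le (by norm_num) hC fun s => by simpa using h s

/-- A linear map on sequences which is bounded in the `ℓ²` norm, as a bounded operator. -/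
def lpMap (T : (∀ n, G n) →ₗ[ℂ] ∀ n, G n) (C : ℝ) (hC : 0 ≤ C)
    (hT : ∀ (ψ : lp G 2) (s : Finset ℕ), ∑ n ∈ s, ‖T ψ n‖ ^ 2 ≤ (C * ‖ψ‖) ^ 2) :
    lp G 2 →L[ℂ] lp G 2 :=
  LinearMap.mkContinuous
    { toFun := fun ψ => ⟨T ψ, memℓp_of_sum_le (hT ψ)⟩
      map_add' := fun a b => lp.ext (map_add T (fun n => a n) (fun n => b n))
      map_smul' := fun c a => lp.ext (map_smul T c (fun n => a n)) } C fun ψ =>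
    norm_le_of_sum_le (by positivity) (hT ψ)

theorem lpMap_apply (T : (∀ n, G n) →ₗ[ℂ] ∀ n, G n) (C : ℝ) (hC : 0 ≤ C)
    (hT : ∀ (ψ : lp G 2) (s : Finset ℕ), ∑ n ∈ s, ‖T ψ n‖ ^ 2 ≤ (C * ‖ψ‖) ^ 2) (ψ : lp G 2) (n : ℕ) :
    lpMap T C hC hT ψ n = T ψ n := rfl

theorem norm_lpMap_le (T : (∀ n, G n) →ₗ[ℂ] ∀ n, G n) (C : ℝ) (hC : 0 ≤ C)
    (hT : ∀ (ψ : lp G 2) (s : Finset ℕ), ∑ n ∈ s, ‖T ψ n‖ ^ 2 ≤ (C * ‖ψ‖) ^ 2) :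
    ‖lpMap T C hC hT‖ ≤ C := LinearMap.mkContinuous_norm_le _ hC _

variable (G) in
/-- The projection of a sequence to its first entries. -/
def cutSeq (N : ℕ) : (∀ n, G n) →ₗ[ℂ] ∀ n, G n :=
  LinearMap.pi fun n => if n ≤ N then LinearMap.proj n else 0

theorem cutSeq_apply (N : ℕ) (ψ : ∀ n, G n) (n : ℕ) :
    cutSeq G N ψ n = if n ≤ N then ψ n else 0 := by
  rw [cutSeq, LinearMap.pi_apply]
  split_ifs <;> rfl

theorem norm_cutSeq_le (N : ℕ) (ψ : ∀ n, G n) (n : ℕ) : ‖cutSeq G N ψ n‖ ≤ ‖ψ n‖ := by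
  rw [cutSeq_apply]
  split_ifs
  · exact le_rfl
  · rw [norm_zero]; exact norm_nonneg _

variable (G) in
/-- The projection to the first summands of a Hilbert space direct sum. -/
def cut (N : ℕ) : lp G 2 →L[ℂ] lp G 2 :=
  lpMap (cutSeq G N) 1 zero_le_one fun ψ s => by
    rw [one_mul]
    refine (Finset.sum_le_sum fun n _ => ?_).trans (sum_norm_sq_le ψ s)
    exact pow_le_pow_left₀ (norm_nonneg _) (norm_cutSeq_le N ψ n) 2

theorem cut_apply (N : ℕ) (ψ : lp G 2) (n : ℕ) : cut G N ψ n = if n ≤ N then ψ n else 0 := by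
  rw [cut, lpMap_apply, cutSeq_apply]

theorem norm_cut_le (N : ℕ) : ‖cut G N‖ ≤ 1 := norm_lpMap_le _ _ _ _

theorem cut_mul_cut {m n : ℕ} (h : m ≤ n) : cut G n * cut G m = cut G m := by
  refine ContinuousLinearMap.ext fun ψ => lp.ext (funext fun i => ?_)
  rw [mul_apply_eq_comp, cut_apply, cut_apply]
  split_ifs with h1 h2
  · rfl
  · rfl
  · omega
  · rfl

theorem inner_cut_left (N : ℕ) (φ ψ : lp G 2) : ⟪cut G N φ, ψ⟫_ℂ = ⟪φ, cut G N ψ⟫_ℂ := by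
  rw [lp.inner_eq_tsum, lp.inner_eq_tsum]
  refine tsum_congr fun n => ?_
  rw [cut_apply, cut_apply]
  split_ifs
  · rfl
  · rw [inner_zero_left, inner_zero_right]

theorem adjoint_cut [∀ n, CompleteSpace (G n)] (N : ℕ) :
    ContinuousLinearMap.adjoint (cut G N) = cut G N :=
  ((ContinuousLinearMap.eq_adjoint_iff _ _).2 fun x y => inner_cut_left N x y).symm

theorem cut_eq_sum (N : ℕ) (ψ : lp G 2) :
    cut G N ψ = ∑ n ∈ Finset.range (N + 1), lp.single 2 n (ψ n) := by
  refine lp.ext (funext fun i => ?_)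
  rw [cut_apply, lp.coeFn_sum, Finset.sum_apply]
  simp only [lp.coeFn_single]
  rw [Finset.sum_pi_single]
  simp only [Finset.mem_range, Nat.lt_succ_iff]

theorem tendsto_cut (ψ : lp G 2) : Tendsto (fun N => cut G N ψ) atTop (𝓝 ψ) := by
  have h := (lp.hasSum_single (p := 2) (by norm_num) ψ).tendsto_sum_nat
  simp only [cut_eq_sum]
  exact h.comp (tendsto_add_atTop_nat 1)

theorem span_single :
    (Submodule.span ℂ {ψ : lp G 2 | ∃ n a, ψ = lp.single 2 n a}).topologicalClosure = ⊤ := by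
  rw [Submodule.eq_top_iff']
  intro ψ
  refine mem_closure_of_tendsto (tendsto_cut ψ) (Eventually.of_forall fun N => ?_)
  rw [cut_eq_sum]
  exact Submodule.sum_mem _ fun n _ => Submodule.subset_span ⟨n, _, rfl⟩

/-- The direct sum of contractions. -/
def diag (T : ∀ n, G n →L[ℂ] G n) (hT : ∀ n x, ‖T n x‖ ≤ ‖x‖) : lp G 2 →L[ℂ] lp G 2 :=
  lpMap (LinearMap.pi fun n => (T n).toLinearMap ∘ₗ LinearMap.proj n) 1 zero_le_one fun ψ s => by
    rw [one_mul]
    refine (Finset.sum_le_sum fun n _ => ?_).trans (sum_norm_sq_le ψ s)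
    exact pow_le_pow_left₀ (norm_nonneg _) (hT n (ψ n)) 2

theorem diag_apply (T : ∀ n, G n →L[ℂ] G n) (hT : ∀ n x, ‖T n x‖ ≤ ‖x‖) (ψ : lp G 2) (n : ℕ) :
    diag T hT ψ n = T n (ψ n) := rfl

theorem diag_single (T : ∀ n, G n →L[ℂ] G n) (hT : ∀ n x, ‖T n x‖ ≤ ‖x‖) (n : ℕ) (a : G n) :
    diag T hT (lp.single 2 n a) = lp.single 2 n (T n a) := by
  refine lp.ext (funext fun i => ?_)
  rw [diag_apply]
  by_cases h : i = n
  · subst h; rw [lp.single_apply_self, lp.single_apply_self]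
  · rw [lp.single_apply_ne _ _ _ h, lp.single_apply_ne _ _ _ h, map_zero]

end DirectSum

/-! ### The symmetric Fock space -/

section FockSpace

universe w
variable {f : Type w} [NormedAddCommGroup f] [InnerProductSpace ℂ f]

open Filter Topology MeasureTheory

theorem createSeq_zero (g : f) (ψ : ∀ n, symPow f n) : createSeq g ψ 0 = 0 := rfl

theorem createSeq_succ (g : f) (ψ : ∀ n, symPow f n) (n : ℕ) :
    createSeq g ψ (n + 1) = createN g n (ψ n) := rfl

theorem sum_createSeq_cutSeq_le (g : f) (N : ℕ) (ψ : Fock f) (s : Finset ℕ) :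
    ∑ n ∈ s, ‖createSeq g (cutSeq _ N ψ) n‖ ^ 2 ≤ (Real.sqrt (N + 1) * ‖g‖ * ‖ψ‖) ^ 2 := by
  obtain ⟨M, hM⟩ : ∃ M, s ⊆ Finset.range (M + 1) :=
    ⟨s.sup id, fun n hn => Finset.mem_range.2 (Nat.lt_succ_of_le (Finset.le_sup (f := id) hn))⟩
  refine (Finset.sum_le_sum_of_subset_of_nonneg hM fun _ _ _ => by positivity).trans ?_
  -- The vacuum component of the image vanishes, so the sum is reindexed by the particle number
  -- before creation; the worst factor is then √(N + 1).
  rw [Finset.sum_range_succ', createSeq_zero, norm_zero, mul_pow]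
  simp only [createSeq_succ]
  have h1 : ∀ n ∈ Finset.range M, ‖createN g n (cutSeq _ N ψ n)‖ ^ 2 ≤
      (Real.sqrt (N + 1) * ‖g‖) ^ 2 * ‖ψ n‖ ^ 2 := fun n _ => by
    rw [← mul_pow]
    refine pow_le_pow_left₀ (norm_nonneg _) ?_ 2
    rw [cutSeq_apply]
    split_ifs with h
    · refine (norm_createN_le g n _).trans ?_
      gcongr
    · rw [map_zero, norm_zero]; positivity
  refine (add_le_add_left (Finset.sum_le_sum h1) _).trans ?_
  rw [← Finset.mul_sum]
  have := mul_le_mul_of_nonneg_left (sum_norm_sq_le ψ (Finset.range M))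
    (sq_nonneg (Real.sqrt (N + 1) * ‖g‖))
  simpa using this

/-- The creation operator, restricted to vectors with at most `N` particles. -/
def cre (N : ℕ) (g : f) : Fock f →L[ℂ] Fock f :=
  lpMap (createSeq g ∘ₗ cutSeq _ N) (Real.sqrt (N + 1) * ‖g‖) (by positivity)
    (sum_createSeq_cutSeq_le g N)

theorem coe_cre (N : ℕ) (g : f) (ψ : Fock f) :
    (cre N g ψ : ∀ n, symPow f n) = createSeq g (cutSeq _ N ψ) := rfl

theorem cre_apply_zero (N : ℕ) (g : f) (ψ : Fock f) : cre N g ψ 0 = 0 := rfl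

theorem cre_apply_succ (N : ℕ) (g : f) (ψ : Fock f) (n : ℕ) :
    cre N g ψ (n + 1) = if n ≤ N then createN g n (ψ n) else 0 := by
  rw [coe_cre, createSeq_succ, cutSeq_apply]
  split_ifs
  · rfl
  · rw [map_zero]

theorem norm_cre_le (N : ℕ) (g : f) : ‖cre N g‖ ≤ Real.sqrt (N + 1) * ‖g‖ := norm_lpMap_le _ _ _ _

theorem fock_ext {φ ψ : Fock f} (h0 : φ 0 = ψ 0) (h : ∀ n, φ (n + 1) = ψ (n + 1)) : φ = ψ := by
  refine lp.ext (funext fun n => ?_)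
  cases n with
  | zero => exact h0
  | succ n => exact h n

theorem cre_add (N : ℕ) (g g' : f) : cre N (g + g') = cre N g + cre N g' := by
  refine ContinuousLinearMap.ext fun ψ => fock_ext ?_ fun n => ?_
  · rw [add_apply, lp.coeFn_add, Pi.add_apply]; simp only [cre_apply_zero, add_zero]
  · rw [add_apply, lp.coeFn_add, Pi.add_apply]; simp only [cre_apply_succ]
    split_ifs
    · exact createN_add g g' n _
    · rw [add_zero]

theorem cre_smul (N : ℕ) (c : ℂ) (g : f) : cre N (c • g) = c • cre N g := by
  refine ContinuousLinearMap.ext fun ψ => fock_ext ?_ fun n => ?_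
  · rw [smul_apply, lp.coeFn_smul, Pi.smul_apply]; simp only [cre_apply_zero, smul_zero]
  · rw [smul_apply, lp.coeFn_smul, Pi.smul_apply]; simp only [cre_apply_succ]
    split_ifs
    · exact createN_smul c g n _
    · rw [smul_zero]

theorem cre_mul_cut {m n : ℕ} (h : m ≤ n) (g : f) : cre n g * cut _ m = cre m g * cut _ m := by
  refine ContinuousLinearMap.ext fun ψ => fock_ext rfl fun i => ?_
  simp only [mul_apply_eq_comp, cre_apply_succ, cut_apply]
  split_ifs <;> first | rfl | omega | simp

theorem cre_mul_cut_self (n : ℕ) (g : f) : cre n g * cut _ n = cre n g := by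
  refine ContinuousLinearMap.ext fun ψ => fock_ext rfl fun i => ?_
  simp only [mul_apply_eq_comp, cre_apply_succ, cut_apply]
  split_ifs <;> rfl

theorem cut_succ_mul_cre (n : ℕ) (g : f) : cut _ (n + 1) * cre n g = cre n g := by
  refine ContinuousLinearMap.ext fun ψ => fock_ext ?_ fun i => ?_
  · simp only [mul_apply_eq_comp, cut_apply, cre_apply_zero, ite_self]
  · simp only [mul_apply_eq_comp, cre_apply_succ, cut_apply]
    split_ifs <;> first | rfl | omega

theorem cre_single (N : ℕ) (g : f) (n : ℕ) (a : symPow f n) :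
    cre N g (lp.single 2 n a) = if n ≤ N then lp.single 2 (n + 1) (createN g n a) else 0 := by
  refine fock_ext ?_ fun i => ?_
  · rw [cre_apply_zero]
    split_ifs
    · rw [lp.single_apply_ne _ _ _ (by omega)]
    · rfl
  · rw [cre_apply_succ]
    by_cases h : i = n
    · subst h
      split_ifs
      · rw [lp.single_apply_self, lp.single_apply_self]
      · rfl
    · rw [lp.single_apply_ne _ _ _ h, map_zero, ite_self]
      split_ifs
      · rw [lp.single_apply_ne _ _ _ (by omega)]
      · rfl

/-- The annihilation operator, restricted to vectors with at most `N + 1` particles. -/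
def ann (N : ℕ) (g : f) : Fock f →L[ℂ] Fock f := ContinuousLinearMap.adjoint (cre N g)

theorem ann_apply (N : ℕ) (g : f) (ψ : Fock f) (n : ℕ) :
    ann N g ψ n = if n ≤ N then annihN g n (ψ (n + 1)) else 0 := by
  refine ext_inner_left ℂ fun a => ?_
  refine (lp.inner_single_left (𝕜 := ℂ) n a (ann N g ψ)).symm.trans ?_
  rw [ann, ContinuousLinearMap.adjoint_inner_right, cre_single]
  split_ifs
  · rw [lp.inner_single_left, annihN, ContinuousLinearMap.adjoint_inner_right]
  · rw [inner_zero_left, inner_zero_right]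

theorem ann_mul_cut {m n : ℕ} (h : m ≤ n) (g : f) : ann n g * cut _ m = ann m g * cut _ m := by
  refine ContinuousLinearMap.ext fun ψ => lp.ext (funext fun i => ?_)
  simp only [mul_apply_eq_comp, ann_apply, cut_apply]
  split_ifs <;> first | rfl | omega | simp

theorem cut_succ_mul_ann (n : ℕ) (g : f) : cut _ (n + 1) * ann n g = ann n g := by
  refine ContinuousLinearMap.ext fun ψ => lp.ext (funext fun i => ?_)
  simp only [mul_apply_eq_comp, ann_apply, cut_apply]
  split_ifs <;> first | rfl | omega

/-- The margin n + 1 ≤ N keeps the second creation operator below its cutoff, so the truncated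
operators obey the exact relation. -/
theorem cre_mul_cre_mul_cut {n N : ℕ} (h : n + 1 ≤ N) (g k : f) :
    cre N g * cre N k * cut _ n = cre N k * cre N g * cut _ n := by
  refine ContinuousLinearMap.ext fun ψ => fock_ext rfl fun i => ?_
  simp only [mul_apply_eq_comp, cre_apply_succ]
  cases i with
  | zero => simp only [cre_apply_zero, map_zero]
  | succ i =>
    simp only [cre_apply_succ, cut_apply]
    by_cases hi : i ≤ n
    · simp only [if_pos hi, if_pos (show i ≤ N by omega), if_pos (show i + 1 ≤ N by omega)]
      exact createN_comm g k i _
    · simp only [if_neg hi, map_zero, ite_self]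

/-- The canonical commutation relation. -/
theorem ann_mul_cre_sub {n N : ℕ} (h : n + 1 ≤ N) (g k : f) :
    (ann N g * cre N k - cre N k * ann N g) * cut _ n = ⟪g, k⟫_ℂ • cut _ n := by
  refine ContinuousLinearMap.ext fun ψ => fock_ext ?_ fun i => ?_
  · rw [mul_apply_eq_comp, sub_apply, smul_apply, lp.coeFn_sub, lp.coeFn_smul, Pi.sub_apply,
      Pi.smul_apply]
    simp only [mul_apply_eq_comp, ann_apply, cre_apply_succ, cut_apply, cre_apply_zero,
      Nat.zero_le, if_true, sub_zero]
    exact ccr_zero g k _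
  · rw [mul_apply_eq_comp, sub_apply, smul_apply, lp.coeFn_sub, lp.coeFn_smul, Pi.sub_apply,
      Pi.smul_apply]
    simp only [mul_apply_eq_comp, ann_apply, cre_apply_succ, cut_apply]
    by_cases h1 : i + 1 ≤ n
    · simp only [if_pos h1, if_pos (show i ≤ N by omega), if_pos (show i + 1 ≤ N by omega)]
      exact ccr_succ g k i _
    · simp only [if_neg h1, map_zero, ite_self, smul_zero, sub_zero]

/-! ### The unbounded creation and annihilation operators -/

theorem mem_graph_creation {g : f} {φ ψ : Fock f} :
    (φ, ψ) ∈ (creation g).graph ↔ (ψ : ∀ n, symPow f n) = createSeq g φ := by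
  rw [LinearPMap.mem_graph_iff']
  constructor
  · rintro ⟨z, hz⟩
    obtain ⟨rfl, rfl⟩ := Prod.mk.inj hz
    rfl
  · intro h
    have hm : Memℓp (createSeq g φ) 2 := h ▸ lp.memℓp ψ
    exact ⟨⟨φ, hm⟩, Prod.ext rfl (lp.ext h.symm)⟩

theorem cut_mem_graph_creation (g : f) (N : ℕ) (φ : Fock f) :
    (cut _ N φ, cre N g φ) ∈ (creation g).graph :=
  mem_graph_creation.2 rfl

/-- The creation operator maps the part of a vector with at most `N` particles to the part of the
image with at most `N + 1` particles. -/
theorem cut_succ_of_mem_graph_creation {g : f} {φ ψ : Fock f} (h : (φ, ψ) ∈ (creation g).graph)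
    (N : ℕ) : cut _ (N + 1) ψ = cre N g φ := by
  have h := mem_graph_creation.1 h
  refine fock_ext ?_ fun i => ?_
  · rw [cut_apply, if_pos (Nat.zero_le _), h, cre_apply_zero, createSeq_zero]
  · rw [cut_apply, cre_apply_succ, h, createSeq_succ]
    split_ifs <;> first | rfl | omega

theorem dense_domain_of_cut {A : Fock f →ₗ.[ℂ] Fock f} (h : ∀ N φ, cut _ N φ ∈ A.domain) :
    Dense (A.domain : Set (Fock f)) := fun φ =>
  mem_closure_of_tendsto (tendsto_cut φ) (Eventually.of_forall fun N => h N φ)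

/-- Without density the adjoint defining `annihilation` would be a default value. -/
theorem dense_domain_creation (g : f) : Dense ((creation g).domain : Set (Fock f)) :=
  dense_domain_of_cut fun N φ => LinearPMap.mem_domain_of_mem_graph (cut_mem_graph_creation g N φ)

variable [CompleteSpace f]

theorem mem_graph_annihilation {g : f} {φ ψ : Fock f} : (φ, ψ) ∈ (annihilation g).graph ↔
    ∀ a b, (a, b) ∈ (creation g).graph → ⟪ψ, a⟫_ℂ = ⟪φ, b⟫_ℂ :=
  mem_graph_adjoint_iff (dense_domain_creation g)

theorem cut_mem_graph_annihilation (g : f) (N : ℕ) (φ : Fock f) :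
    (cut _ N φ, ann N g (cut _ N φ)) ∈ (annihilation g).graph := by
  refine mem_graph_annihilation.2 fun a b hab => ?_
  rw [ann, ContinuousLinearMap.adjoint_inner_left, ← cut_succ_of_mem_graph_creation hab,
    ← inner_cut_left, ← mul_apply_eq_comp, cut_mul_cut (Nat.le_succ N)]

end FockSpace


/-! ### Differential second quantization -/

section SecondQuantization

universe w
variable {f : Type w} [NormedAddCommGroup f] [InnerProductSpace ℂ f]

open Filter Topology MeasureTheory

theorem tpowMap_one (n : ℕ) : tpowMap (1 : f →L[ℂ] f) n = 1 := by
  induction n with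
  | zero => rfl
  | succ n ih => rw [tpowMap, ih]; exact mapT_one

theorem tpowMap_mul (u v : f →L[ℂ] f) (n : ℕ) :
    tpowMap (u * v) n = tpowMap u n * tpowMap v n := by
  induction n with
  | zero => exact (mul_one _).symm
  | succ n ih => simp only [tpowMap]; rw [ih]; exact (mapT_mul _ _ _ _).symm

variable [CompleteSpace f]

theorem tpowMap_mem_unitary {u : f →L[ℂ] f} (hu : u ∈ unitary (f →L[ℂ] f)) (n : ℕ) :
    tpowMap u n ∈ unitary (TensorPow f n →L[ℂ] TensorPow f n) := by
  induction n with
  | zero => exact one_mem _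
  | succ n ih => exact mapT_mem_unitary hu ih

theorem isUnitaryGroupOf_zero {E : Type*} [NormedAddCommGroup E] [InnerProductSpace ℂ E]
    [CompleteSpace E] : IsUnitaryGroupOf (0 : E →ₗ.[ℂ] E) fun _ => 1 := by
  have h := isUnitaryGroup_one (E := E)
  refine ⟨h.unitary, h.zero, h.add, h.continuous, fun ψ φ => ?_⟩
  have h1 : (ψ, φ) ∈ (0 : E →ₗ.[ℂ] E).graph ↔ φ = 0 := by
    rw [LinearPMap.mem_graph_iff']
    constructor
    · rintro ⟨z, hz⟩
      exact (Prod.mk.inj hz).2.symm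
    · rintro rfl
      exact ⟨⟨ψ, Submodule.mem_top⟩, rfl⟩
  rw [h1]
  constructor
  · rintro rfl
    simpa using hasDerivAt_const (0 : ℝ) ψ
  · intro h2
    simpa using h2.unique (hasDerivAt_const (0 : ℝ) ψ)

theorem isUnitaryGroupOf_secondQuantN {h : f →ₗ.[ℂ] f} {u : ℝ → f →L[ℂ] f}
    (hu : IsUnitaryGroupOf h u) (n : ℕ) :
    IsUnitaryGroupOf (secondQuantN h n) fun t => tpowMap (u t) n := by
  induction n with
  | zero => exact isUnitaryGroupOf_zero
  | succ n ih => exact isUnitaryGroupOf_tensorSum hu ih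

theorem norm_spowMap {u : f →L[ℂ] f} (hu : u ∈ unitary (f →L[ℂ] f)) (n : ℕ) (ψ : symPow f n) :
    ‖spowMap u n ψ‖ = ‖ψ‖ :=
  norm_apply_of_mem_unitary (tpowMap_mem_unitary hu n) (ψ : TensorPow f n)

/-- The second quantization of a unitary group. -/
def fockGroup {u : ℝ → f →L[ℂ] f} (hu : IsUnitaryGroup u) (t : ℝ) : Fock f →L[ℂ] Fock f :=
  diag (fun n => spowMap (u t) n) fun n ψ => (norm_spowMap (hu.unitary t) n ψ).le

theorem fockGroup_apply {u : ℝ → f →L[ℂ] f} (hu : IsUnitaryGroup u) (t : ℝ) (ψ : Fock f) (n : ℕ) :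
    fockGroup hu t ψ n = spowMap (u t) n (ψ n) := rfl

theorem norm_fockGroup {u : ℝ → f →L[ℂ] f} (hu : IsUnitaryGroup u) (t : ℝ) (ψ : Fock f) :
    ‖fockGroup hu t ψ‖ = ‖ψ‖ := by
  have h1 : ⟪fockGroup hu t ψ, fockGroup hu t ψ⟫_ℂ = ⟪ψ, ψ⟫_ℂ := by
    rw [lp.inner_eq_tsum, lp.inner_eq_tsum]
    refine tsum_congr fun n => ?_
    rw [fockGroup_apply]
    exact inner_apply_apply_of_mem_unitary (tpowMap_mem_unitary (hu.unitary t) n)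
      (ψ n : TensorPow f n) (ψ n : TensorPow f n)
  rw [@norm_eq_sqrt_re_inner ℂ, h1, ← @norm_eq_sqrt_re_inner ℂ]

theorem isUnitaryGroup_fockGroup {h : f →ₗ.[ℂ] f} {u : ℝ → f →L[ℂ] f}
    (hu : IsUnitaryGroupOf h u) : IsUnitaryGroup (fockGroup hu.isUnitaryGroup) := by
  refine .of_norm (norm_fockGroup _) ?_ (fun s t => ?_) span_single ?_
  · refine ContinuousLinearMap.ext fun ψ => lp.ext (funext fun n => Subtype.ext ?_)
    rw [fockGroup_apply, coe_spowMap, hu.zero, tpowMap_one]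
    rfl
  · refine ContinuousLinearMap.ext fun ψ => lp.ext (funext fun n => Subtype.ext ?_)
    rw [mul_apply_eq_comp, fockGroup_apply, fockGroup_apply, fockGroup_apply, coe_spowMap,
      coe_spowMap, coe_spowMap, hu.add, tpowMap_mul]
    rfl
  · rintro _ ⟨n, a, rfl⟩
    have h1 : ∀ t, fockGroup hu.isUnitaryGroup t (lp.single 2 n a) =
        lp.single 2 n (spowMap (u t) n a) := fun t =>
      diag_single (G := fun n : ℕ => symPow f n) (fun n => spowMap (u t) n) _ n a
    simp only [h1]
    refine (lp.isometry_single n).continuous.comp (Continuous.subtype_mk ?_ _)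
    exact (isUnitaryGroupOf_secondQuantN hu n).continuous a

theorem mem_graph_secondQuant {h : f →ₗ.[ℂ] f} {φ ψ : Fock f} :
    (φ, ψ) ∈ (secondQuant h).graph ↔
      ∀ n, ((φ n : TensorPow f n), (ψ n : TensorPow f n)) ∈ (secondQuantN h n).graph := by
  rw [secondQuant_graph]; rfl

variable (f) in
/-- The component of a Fock space vector in the `n`-fold tensor power. -/
def component (n : ℕ) : Fock f →L[ℂ] TensorPow f n :=
  (symPow f n).subtypeL ∘L lp.evalCLM ℂ (fun n : ℕ => symPow f n) 2 n

theorem component_fockGroup {u : ℝ → f →L[ℂ] f} (hu : IsUnitaryGroup u) (t : ℝ) (ψ : Fock f)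
    (n : ℕ) : component f n (fockGroup hu t ψ) = tpowMap (u t) n (component f n ψ) := rfl

theorem ext_component {φ ψ : Fock f} (h : ∀ n, component f n φ = component f n ψ) : φ = ψ :=
  lp.ext (funext fun n => Subtype.ext (h n))

/-- Differentiability of every component does not give differentiability in Fock space, but the
integral equations can be checked componentwise. The converse projects the derivative to each
component. -/
theorem isUnitaryGroupOf_secondQuant {h : f →ₗ.[ℂ] f} {u : ℝ → f →L[ℂ] f}
    (hu : IsUnitaryGroupOf h u) :
    IsUnitaryGroupOf (secondQuant h) (fockGroup hu.isUnitaryGroup) := by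
  have hΓ := isUnitaryGroup_fockGroup hu
  refine ⟨hΓ.unitary, hΓ.zero, hΓ.add, hΓ.continuous, fun ψ φ => ?_⟩
  rw [mem_graph_secondQuant]
  constructor
  · intro hp
    refine hΓ.mem_generatorGraph_of_integral_eq fun t => ext_component fun n => ?_
    have hi : IntervalIntegrable (fun s => -Complex.I • fockGroup hu.isUnitaryGroup s φ) volume 0 t :=
      ((hΓ.continuous φ).fun_const_smul _).intervalIntegrable _ _
    refine ((component f n).intervalIntegral_comp_comm hi).symm.trans ?_
    have hn := isUnitaryGroupOf_secondQuantN hu n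
    have h1 := hn.isUnitaryGroup.integral_eq (hn.graph_eq ▸ hp n) t
    simp only [map_smul, map_sub, component_fockGroup]
    exact h1
  · intro hd n
    refine ((isUnitaryGroupOf_secondQuantN hu n).generator _ _).2 ?_
    have h1 := ((component f n).restrictScalars ℝ).hasFDerivAt.comp_hasDerivAt 0 hd
    simp only [ContinuousLinearMap.coe_restrictScalars', map_smul] at h1
    exact h1

theorem cut_mem_graph_secondQuant {h : f →ₗ.[ℂ] f} {φ ψ : Fock f}
    (hp : (φ, ψ) ∈ (secondQuant h).graph) (N : ℕ) :
    (cut _ N φ, cut _ N ψ) ∈ (secondQuant h).graph := by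
  rw [mem_graph_secondQuant] at hp ⊢
  intro n
  rw [cut_apply, cut_apply]
  split_ifs
  · exact hp n
  · exact (secondQuantN h n).graph.zero_mem

theorem fockGroup_mul_cut {u : ℝ → f →L[ℂ] f} (hu : IsUnitaryGroup u) (t : ℝ) (N : ℕ) :
    fockGroup hu t * cut _ N = cut _ N * fockGroup hu t := by
  refine ContinuousLinearMap.ext fun ψ => lp.ext (funext fun n => ?_)
  rw [mul_apply_eq_comp, mul_apply_eq_comp, fockGroup_apply, cut_apply, cut_apply, fockGroup_apply]
  split_ifs
  · rfl
  · rw [map_zero]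

theorem fockGroup_mul_cre {u : ℝ → f →L[ℂ] f} (hu : IsUnitaryGroup u) (t : ℝ) (N : ℕ) (g : f) :
    fockGroup hu t * cre N g = cre N (u t g) * fockGroup hu t := by
  refine ContinuousLinearMap.ext fun ψ => fock_ext ?_ fun n => ?_
  · rw [mul_apply_eq_comp, mul_apply_eq_comp, fockGroup_apply, cre_apply_zero, cre_apply_zero,
      map_zero]
  · rw [mul_apply_eq_comp, mul_apply_eq_comp, fockGroup_apply, cre_apply_succ, cre_apply_succ,
      fockGroup_apply]
    split_ifs
    · exact createN_spowMap (hu.inner_apply_apply t) (fun y => ⟨u (-t) y, hu.apply_apply_neg t y⟩)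
        g n (ψ n)
    · rw [map_zero]

end SecondQuantization


/-! ### The Dyson series on vectors of finite particle number -/

section Dyson

variable {E : Type*} [NormedAddCommGroup E] [InnerProductSpace ℂ E] [CompleteSpace E]

open MeasureTheory Filter Topology

/-- An increasing sequence of self-adjoint projections which converges strongly to the identity. -/
structure IsCutoff (Q : ℕ → E →L[ℂ] E) : Prop where
  apply_apply : ∀ m n, m ≤ n → ∀ x, Q n (Q m x) = Q m x
  tendsto : ∀ x, Tendsto (fun n => Q n x) atTop (𝓝 x)
  symm : ∀ n x y, ⟪Q n x, y⟫_ℂ = ⟪x, Q n y⟫_ℂ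

theorem IsCutoff.apply_eq_of_le {Q : ℕ → E →L[ℂ] E} (hQ : IsCutoff Q) {m n : ℕ} (h : m ≤ n) {x : E}
    (hx : Q m x = x) : Q n x = x := by
  rw [← hx, hQ.apply_apply m n h]

/-- A consistent family of bounded operators `T n`, where `T n` describes the action of an unbounded
operator on the range of `Q n`; it raises the particle number by at most one, and its norm is
bounded by a multiple of the square root of the particle number. -/
structure IsLadder (Q T : ℕ → E →L[ℂ] E) (c : ℝ) : Prop where
  norm_le : ∀ n, ‖T n‖ ≤ c * Real.sqrt (n + 1)
  apply_eq : ∀ m n, m ≤ n → ∀ x, Q m x = x → T n x = T m x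
  cut_apply : ∀ m x, Q m x = x → Q (m + 1) (T m x) = T m x

theorem IsLadder.nonneg {Q T : ℕ → E →L[ℂ] E} {c : ℝ} (hT : IsLadder Q T c) : 0 ≤ c := by
  have := (norm_nonneg _).trans (hT.norm_le 0)
  simpa using this

/-- The terms of the Dyson series. -/
def dyson (V : ℝ → ℕ → E →L[ℂ] E) (m : ℕ) (ξ : E) : ℕ → ℝ → E
  | 0 => fun _ => ξ
  | k + 1 => fun t => ∫ s in (0 : ℝ)..t, -Complex.I • V s (m + k) (dyson V m ξ k s)

/-- The coefficients of a majorant of the Dyson series. -/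
def dysonCoeff (c : ℝ) (m : ℕ) : ℕ → ℝ
  | 0 => 1
  | k + 1 => dysonCoeff c m k * (c * Real.sqrt (m + k + 1)) / (k + 1)

/-- A majorant for the terms of the Dyson series and their images under two ladder operators. -/
def dysonMaj (c : ℝ) (m : ℕ) (τ : ℝ) (k : ℕ) : ℝ := (m + k + 2) * dysonCoeff c m k * τ ^ k

theorem dysonCoeff_nonneg {c : ℝ} (hc : 0 ≤ c) (m k : ℕ) : 0 ≤ dysonCoeff c m k := by
  induction k with
  | zero => exact zero_le_one
  | succ k ih => rw [dysonCoeff]; positivity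

theorem dysonMaj_nonneg {c τ : ℝ} (hc : 0 ≤ c) (hτ : 0 ≤ τ) (m k : ℕ) : 0 ≤ dysonMaj c m τ k := by
  have := dysonCoeff_nonneg hc m k
  rw [dysonMaj]; positivity

/-- The ratio of consecutive terms is cτ√(m+k+1)/(k+1) times (m+k+3)/(m+k+2), and the square root
loses to k + 1. -/
theorem summable_dysonMaj {c τ : ℝ} (hc : 0 ≤ c) (hτ : 0 ≤ τ) (m : ℕ) :
    Summable (dysonMaj c m τ) := by
  refine summable_of_ratio_norm_eventually_le (r := 1 / 2) (by norm_num) ?_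
  -- Since m+k+1 ≤ (m+1)(k+1), this threshold makes 4cτ√(m+k+1) ≤ k+1. The first factor of the ratio
  -- is then at most 1/4 and the second at most 2.
  obtain ⟨K, hK⟩ := exists_nat_ge (16 * c ^ 2 * τ ^ 2 * (m + 1))
  filter_upwards [eventually_ge_atTop K] with k hk
  rw [Real.norm_of_nonneg (dysonMaj_nonneg hc hτ _ _),
    Real.norm_of_nonneg (dysonMaj_nonneg hc hτ _ _)]
  have hb := dysonCoeff_nonneg hc m k
  have hkK : (K : ℝ) ≤ k := by exact_mod_cast hk
  have h1 : 4 * c * τ * Real.sqrt (m + k + 1) ≤ k + 1 := by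
    refine le_of_sq_le_sq ?_ (by positivity)
    rw [mul_pow, Real.sq_sqrt (by positivity)]
    have h2 : (m + k + 1 : ℝ) ≤ (m + 1) * (k + 1) := by
      have : (0 : ℝ) ≤ m * k := by positivity
      linarith
    have h3 : (0 : ℝ) ≤ (4 * c * τ) ^ 2 := by positivity
    calc (4 * c * τ) ^ 2 * (m + k + 1) ≤ (4 * c * τ) ^ 2 * ((m + 1) * (k + 1)) :=
          mul_le_mul_of_nonneg_left h2 h3
      _ = (16 * c ^ 2 * τ ^ 2 * (m + 1)) * (k + 1) := by ring
      _ ≤ (k + 1) * (k + 1) := by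
          refine mul_le_mul_of_nonneg_right ?_ (by positivity)
          linarith
      _ = (k + 1) ^ 2 := by ring
  rw [dysonMaj, dysonMaj, dysonCoeff, pow_succ]
  have hk1 : (0 : ℝ) < k + 1 := by positivity
  have h4 : c * Real.sqrt (m + k + 1) / (k + 1) * τ ≤ 1 / 4 := by
    rw [div_mul_eq_mul_div, div_le_iff₀ hk1]; linarith
  have h5 : (0 : ℝ) ≤ dysonCoeff c m k * τ ^ k := by positivity
  push_cast
  calc ((m : ℝ) + (k + 1) + 2) * (dysonCoeff c m k * (c * Real.sqrt (m + k + 1)) / (k + 1)) *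
        (τ ^ k * τ)
      = ((m : ℝ) + k + 3) * (dysonCoeff c m k * τ ^ k) *
        (c * Real.sqrt (m + k + 1) / (k + 1) * τ) := by ring
    _ ≤ ((m : ℝ) + k + 3) * (dysonCoeff c m k * τ ^ k) * (1 / 4) :=
        mul_le_mul_of_nonneg_left h4 (by positivity)
    _ ≤ 1 / 2 * (((m : ℝ) + k + 2) * dysonCoeff c m k * τ ^ k) := by
        have : (0 : ℝ) ≤ ((m : ℝ) + k + 1) * (dysonCoeff c m k * τ ^ k) := by positivity
        linarith

theorem dysonCoeff_mul_pow_le {c τ : ℝ} (hc : 0 ≤ c) (hτ : 0 ≤ τ) (m k : ℕ) :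
    dysonCoeff c m k * τ ^ k ≤ dysonMaj c m τ k := by
  have h5 : (0 : ℝ) ≤ dysonCoeff c m k * τ ^ k :=
    mul_nonneg (dysonCoeff_nonneg hc m k) (pow_nonneg hτ k)
  rw [dysonMaj, mul_assoc]
  have : (0 : ℝ) ≤ ((m : ℝ) + k + 1) * (dysonCoeff c m k * τ ^ k) := by positivity
  linarith

/-- A continuous family of symmetric ladder operators. -/
structure IsInteraction (Q : ℕ → E →L[ℂ] E) (V : ℝ → ℕ → E →L[ℂ] E) (c : ℝ) : Prop where
  ladder : ∀ s, IsLadder Q (V s) c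
  continuous : ∀ n, Continuous fun s => V s n
  symm : ∀ s n x y, ⟪V s n x, y⟫_ℂ = ⟪x, V s n y⟫_ℂ

section

variable {Q : ℕ → E →L[ℂ] E} {V : ℝ → ℕ → E →L[ℂ] E} {c : ℝ} {m : ℕ} {ξ : E}

theorem continuous_dyson (hV : IsInteraction Q V c) (k : ℕ) : Continuous (dyson V m ξ k) := by
  induction k with
  | zero => exact continuous_const
  | succ k ih =>
    exact intervalIntegral.continuous_primitive
      (fun a b => (((hV.continuous (m + k)).clm_apply ih).fun_const_smul _).intervalIntegrable a b) 0

theorem hasDerivAt_dyson (hV : IsInteraction Q V c) (k : ℕ) (t : ℝ) :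
    HasDerivAt (dyson V m ξ (k + 1)) (-Complex.I • V t (m + k) (dyson V m ξ k t)) t := by
  have hc : Continuous fun s => -Complex.I • V s (m + k) (dyson V m ξ k s) :=
    ((hV.continuous (m + k)).clm_apply (continuous_dyson hV k)).fun_const_smul _
  exact (hc.integral_hasStrictDerivAt 0 t).hasDerivAt

/-- Each interaction adds at most one particle, so the k-th term stays at level m + k, which is why
`dyson` uses the truncation V s (m + k). -/
theorem cut_dyson (hV : IsInteraction Q V c) (hξ : Q m ξ = ξ) (k : ℕ) (t : ℝ) :
    Q (m + k) (dyson V m ξ k t) = dyson V m ξ k t := by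
  induction k generalizing t with
  | zero => exact hξ
  | succ k ih =>
    have hi : IntervalIntegrable (fun s => -Complex.I • V s (m + k) (dyson V m ξ k s)) volume 0 t :=
      (((hV.continuous (m + k)).clm_apply (continuous_dyson hV k)).fun_const_smul _).intervalIntegrable
        _ _
    rw [dyson, ← (Q (m + (k + 1))).intervalIntegral_comp_comm hi]
    refine intervalIntegral.integral_congr fun s _ => ?_
    simp only [map_smul]
    rw [← add_assoc, (hV.ladder s).cut_apply _ _ (ih s)]

/-- The starting level may be raised freely, so two finite-particle vectors can be placed at a
common level. -/
theorem dyson_eq_of_le (hV : IsInteraction Q V c) (hξ : Q m ξ = ξ) {n : ℕ} (h : m ≤ n) (k : ℕ)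
    (t : ℝ) : dyson V n ξ k t = dyson V m ξ k t := by
  induction k generalizing t with
  | zero => rfl
  | succ k ih =>
    rw [dyson, dyson]
    refine intervalIntegral.integral_congr fun s _ => ?_
    rw [ih, (hV.ladder s).apply_eq (m + k) (n + k) (by omega) _ (cut_dyson hV hξ k s)]

theorem norm_dyson_le (hV : IsInteraction Q V c) (k : ℕ) (t : ℝ) :
    ‖dyson V m ξ k t‖ ≤ dysonCoeff c m k * |t| ^ k * ‖ξ‖ := by
  have hc := (hV.ladder 0).nonneg
  induction k generalizing t with
  | zero => simp [dyson, dysonCoeff]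
  | succ k ih =>
    rw [dyson, intervalIntegral.norm_integral_eq_norm_integral_uIoc]
    refine (norm_integral_le_of_norm_le (g := fun s => dysonCoeff c m k * (c * Real.sqrt (m + k + 1)) *
      ‖ξ‖ * |s - 0| ^ k) ?_ (Eventually.of_forall fun s => ?_)).trans ?_
    · refine (Continuous.intervalIntegrable ?_ 0 t).def'
      fun_prop
    · rw [norm_smul, norm_neg, Complex.norm_I, one_mul, sub_zero]
      refine ((V s (m + k)).le_of_opNorm_le ((hV.ladder s).norm_le (m + k)) _).trans ?_
      push_cast
      refine (mul_le_mul_of_nonneg_left (ih s) (by positivity)).trans (le_of_eq ?_)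
      ring
    · rw [integral_const_mul, integral_pow_abs_sub_uIoc, sub_zero, dysonCoeff]
      refine le_of_eq ?_
      ring

theorem norm_dyson_le_of_abs_le (hV : IsInteraction Q V c) (k : ℕ) {t τ : ℝ} (ht : |t| ≤ τ) :
    ‖dyson V m ξ k t‖ ≤ dysonCoeff c m k * τ ^ k * ‖ξ‖ := by
  refine (norm_dyson_le hV k t).trans ?_
  have := dysonCoeff_nonneg (hV.ladder 0).nonneg m k
  gcongr

theorem norm_dyson_le_maj (hV : IsInteraction Q V c) (k : ℕ) {t τ : ℝ} (ht : |t| ≤ τ) :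
    ‖dyson V m ξ k t‖ ≤ dysonMaj c m τ k * ‖ξ‖ :=
  (norm_dyson_le_of_abs_le hV k ht).trans (mul_le_mul_of_nonneg_right
    (dysonCoeff_mul_pow_le (hV.ladder 0).nonneg ((abs_nonneg t).trans ht) m k) (norm_nonneg _))

theorem norm_ladder_dyson_le (hV : IsInteraction Q V c) (hξ : Q m ξ = ξ) {T : ℕ → E →L[ℂ] E}
    {c' : ℝ} (hT : IsLadder Q T c') {k M : ℕ} (hM : m + k ≤ M) {t τ : ℝ} (ht : |t| ≤ τ) :
    ‖T M (dyson V m ξ k t)‖ ≤ c' * (dysonMaj c m τ k * ‖ξ‖) := by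
  rw [hT.apply_eq _ _ hM _ (cut_dyson hV hξ k t)]
  refine ((T (m + k)).le_of_opNorm_le (hT.norm_le (m + k)) _).trans ?_
  rw [mul_assoc]
  refine mul_le_mul_of_nonneg_left ?_ hT.nonneg
  refine (mul_le_mul_of_nonneg_left (norm_dyson_le_of_abs_le hV k ht) (Real.sqrt_nonneg _)).trans ?_
  have h1 : (0 : ℝ) ≤ dysonCoeff c m k * τ ^ k := mul_nonneg
    (dysonCoeff_nonneg (hV.ladder 0).nonneg m k) (pow_nonneg ((abs_nonneg t).trans ht) k)
  have h2 : Real.sqrt ((m + k : ℕ) + 1) ≤ m + k + 2 := by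
    rw [Real.sqrt_le_left (by positivity)]
    push_cast
    nlinarith [Nat.cast_nonneg (α := ℝ) m, Nat.cast_nonneg (α := ℝ) k]
  rw [dysonMaj, ← mul_assoc, mul_assoc (_ + _ : ℝ)]
  exact mul_le_mul_of_nonneg_right (mul_le_mul_of_nonneg_right h2 h1) (norm_nonneg _)

theorem norm_ladder_ladder_dyson_le (hV : IsInteraction Q V c) (hξ : Q m ξ = ξ)
    {T S : ℕ → E →L[ℂ] E} {c' c'' : ℝ} (hT : IsLadder Q T c') (hS : IsLadder Q S c'') {k M M' : ℕ}
    (hM : m + k ≤ M) (hM' : m + k + 1 ≤ M') {t τ : ℝ} (ht : |t| ≤ τ) :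
    ‖S M' (T M (dyson V m ξ k t))‖ ≤ c'' * c' * (dysonMaj c m τ k * ‖ξ‖) := by
  have hcut := cut_dyson hV hξ k t
  rw [hT.apply_eq _ _ hM _ hcut, hS.apply_eq _ _ hM' _ (hT.cut_apply _ _ hcut)]
  refine ((S (m + k + 1)).le_of_opNorm_le (hS.norm_le _) _).trans ?_
  have hc' := hT.nonneg
  have hc'' := hS.nonneg
  have h0 := (T (m + k)).le_of_opNorm_le (hT.norm_le (m + k)) (dyson V m ξ k t)
  have h1 := h0.trans (mul_le_mul_of_nonneg_left (norm_dyson_le_of_abs_le hV k ht) (by positivity))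
  refine (mul_le_mul_of_nonneg_left h1 (by positivity)).trans ?_
  -- Two successive ladder operators cost this product; it is the reason for the prefactor m + k + 2
  -- in `dysonMaj`.
  have h2 : Real.sqrt ((m + k + 1 : ℕ) + 1) * Real.sqrt ((m + k : ℕ) + 1) ≤ m + k + 2 := by
    have h3 : Real.sqrt ((m + k : ℕ) + 1) ≤ Real.sqrt ((m + k + 1 : ℕ) + 1) :=
      Real.sqrt_le_sqrt (by push_cast; linarith)
    refine (mul_le_mul_of_nonneg_left h3 (Real.sqrt_nonneg _)).trans ?_
    rw [Real.mul_self_sqrt (by positivity)]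
    push_cast; linarith
  have h1 : (0 : ℝ) ≤ c'' * c' * (dysonCoeff c m k * τ ^ k * ‖ξ‖) := by
    have := dysonCoeff_nonneg (hV.ladder 0).nonneg m k
    have := (abs_nonneg t).trans ht
    positivity
  calc c'' * Real.sqrt ((m + k + 1 : ℕ) + 1) * (c' * Real.sqrt ((m + k : ℕ) + 1) *
        (dysonCoeff c m k * τ ^ k * ‖ξ‖))
      = (Real.sqrt ((m + k + 1 : ℕ) + 1) * Real.sqrt ((m + k : ℕ) + 1)) *
        (c'' * c' * (dysonCoeff c m k * τ ^ k * ‖ξ‖)) := by ring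
    _ ≤ (m + k + 2) * (c'' * c' * (dysonCoeff c m k * τ ^ k * ‖ξ‖)) :=
        mul_le_mul_of_nonneg_right h2 h1
    _ = c'' * c' * (dysonMaj c m τ k * ‖ξ‖) := by rw [dysonMaj]; ring

/-! #### Partial sums -/

/-- The partial sums of the Dyson series. -/
def dysonPartial (V : ℝ → ℕ → E →L[ℂ] E) (m : ℕ) (ξ : E) (N : ℕ) (t : ℝ) : E :=
  ∑ k ∈ Finset.range N, dyson V m ξ k t

/-- The sum of the Dyson series. -/
def dysonSum (V : ℝ → ℕ → E →L[ℂ] E) (m : ℕ) (ξ : E) (t : ℝ) : E := ∑' k, dyson V m ξ k t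

theorem dysonPartial_succ (N : ℕ) (t : ℝ) :
    dysonPartial V m ξ (N + 1) t = dysonPartial V m ξ N t + dyson V m ξ N t :=
  Finset.sum_range_succ _ _

theorem continuous_dysonPartial (hV : IsInteraction Q V c) (N : ℕ) :
    Continuous (dysonPartial V m ξ N) :=
  continuous_finsetSum _ fun k _ => continuous_dyson hV k

/-- A sum of N terms ends with index N - 1, so its level is m + N - 1; the bound is stated as m + N
≤ M + 1 to avoid truncated subtraction. -/
theorem cut_dysonPartial (hQ : IsCutoff Q) (hV : IsInteraction Q V c) (hξ : Q m ξ = ξ) {N M : ℕ}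
    (h : m + N ≤ M + 1) (t : ℝ) : Q M (dysonPartial V m ξ N t) = dysonPartial V m ξ N t := by
  rw [dysonPartial, map_sum]
  refine Finset.sum_congr rfl fun k hk => ?_
  have := Finset.mem_range.1 hk
  exact hQ.apply_eq_of_le (by omega) (cut_dyson hV hξ k t)

/-- Differentiation lowers each Dyson index by one, so N + 1 terms produce V on N terms. The
Schrödinger equation thus fails only by V on the last term. -/
theorem hasDerivAt_dysonPartial (hV : IsInteraction Q V c) (hξ : Q m ξ = ξ) {N M : ℕ}
    (h : m + N ≤ M + 1) (t : ℝ) : HasDerivAt (dysonPartial V m ξ (N + 1))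
      (-Complex.I • V t M (dysonPartial V m ξ N t)) t := by
  have h1 : HasDerivAt (fun s => ∑ k ∈ Finset.range N, dyson V m ξ (k + 1) s + ξ)
      (∑ k ∈ Finset.range N, -Complex.I • V t (m + k) (dyson V m ξ k t)) t :=
    (HasDerivAt.fun_sum fun k _ => hasDerivAt_dyson hV k t).add_const ξ
  have h2 : dysonPartial V m ξ (N + 1) =
      fun s => ∑ k ∈ Finset.range N, dyson V m ξ (k + 1) s + ξ := by
    funext s
    rw [dysonPartial, Finset.sum_range_succ']
    rfl
  rw [h2]
  refine h1.congr_deriv ?_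
  rw [dysonPartial, map_sum, Finset.smul_sum]
  refine Finset.sum_congr rfl fun k hk => ?_
  have := Finset.mem_range.1 hk
  rw [(hV.ladder t).apply_eq (m + k) M (by omega) _ (cut_dyson hV hξ k t)]

theorem dysonPartial_zero_time (N : ℕ) : dysonPartial V m ξ (N + 1) 0 = ξ := by
  rw [dysonPartial, Finset.sum_range_succ']
  have : ∀ k, dyson V m ξ (k + 1) 0 = 0 := fun k => by
    exact intervalIntegral.integral_same
  simp only [this, Finset.sum_const_zero, zero_add]
  rfl

theorem norm_dysonPartial_le (hV : IsInteraction Q V c) (N : ℕ) {t τ : ℝ} (ht : |t| ≤ τ) :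
    ‖dysonPartial V m ξ N t‖ ≤ (∑' k, dysonMaj c m τ k) * ‖ξ‖ := by
  have hc := (hV.ladder 0).nonneg
  have hτ := (abs_nonneg t).trans ht
  refine (norm_sum_le_of_le _ fun k _ => norm_dyson_le_maj hV k ht).trans ?_
  rw [← Finset.sum_mul]
  exact mul_le_mul_of_nonneg_right ((summable_dysonMaj hc hτ m).sum_le_tsum _
    fun k _ => dysonMaj_nonneg hc hτ m k) (norm_nonneg _)

theorem norm_ladder_dysonPartial_le (hV : IsInteraction Q V c) (hξ : Q m ξ = ξ)
    {T : ℕ → E →L[ℂ] E} {c' : ℝ} (hT : IsLadder Q T c') {N M : ℕ} (hM : m + N ≤ M + 1) {t τ : ℝ}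
    (ht : |t| ≤ τ) :
    ‖T M (dysonPartial V m ξ N t)‖ ≤ c' * ((∑' k, dysonMaj c m τ k) * ‖ξ‖) := by
  have hc := (hV.ladder 0).nonneg
  have hτ := (abs_nonneg t).trans ht
  rw [dysonPartial, map_sum]
  refine (norm_sum_le_of_le _ fun k hk => norm_ladder_dyson_le hV hξ hT (by
    have := Finset.mem_range.1 hk; omega) ht).trans ?_
  rw [← Finset.mul_sum, ← Finset.sum_mul]
  exact mul_le_mul_of_nonneg_left (mul_le_mul_of_nonneg_right
    ((summable_dysonMaj hc hτ m).sum_le_tsum _ fun k _ => dysonMaj_nonneg hc hτ m k)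
    (norm_nonneg _)) hT.nonneg

theorem summable_dyson (hV : IsInteraction Q V c) (t : ℝ) : Summable fun k => dyson V m ξ k t :=
  .of_norm_bounded ((summable_dysonMaj (hV.ladder 0).nonneg (abs_nonneg t) m).mul_right ‖ξ‖)
    fun k => norm_dyson_le_maj hV k le_rfl

theorem tendsto_dysonPartial (hV : IsInteraction Q V c) (t : ℝ) :
    Tendsto (fun N => dysonPartial V m ξ N t) atTop (𝓝 (dysonSum V m ξ t)) :=
  (summable_dyson hV t).hasSum.tendsto_sum_nat

/-- This series stands for the unbounded operator T applied to the Dyson sum, a vector of possibly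
unbounded particle number. -/
theorem summable_ladder_dyson (hV : IsInteraction Q V c) (hξ : Q m ξ = ξ)
    {T : ℕ → E →L[ℂ] E} {c' : ℝ} (hT : IsLadder Q T c') (t : ℝ) :
    Summable fun k => T (m + k) (dyson V m ξ k t) :=
  .of_norm_bounded (((summable_dysonMaj (hV.ladder 0).nonneg (abs_nonneg t) m).mul_right
    ‖ξ‖).mul_left c') fun _ => norm_ladder_dyson_le hV hξ hT le_rfl le_rfl

theorem tendsto_ladder_dysonPartial (hV : IsInteraction Q V c) (hξ : Q m ξ = ξ)
    {T : ℕ → E →L[ℂ] E} {c' : ℝ} (hT : IsLadder Q T c') (t : ℝ) {M : ℕ → ℕ}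
    (hM : ∀ N, m + N ≤ M N + 1) : Tendsto (fun N => T (M N) (dysonPartial V m ξ N t)) atTop
      (𝓝 (∑' k, T (m + k) (dyson V m ξ k t))) := by
  refine (summable_ladder_dyson hV hξ hT t).hasSum.tendsto_sum_nat.congr fun N => ?_
  rw [dysonPartial, map_sum]
  refine Finset.sum_congr rfl fun k hk => ?_
  have := Finset.mem_range.1 hk
  have h2 := hM N
  rw [hT.apply_eq (m + k) (M N) (by omega) _ (cut_dyson hV hξ k t)]

theorem tendsto_dysonMaj {τ : ℝ} (hc : 0 ≤ c) (hτ : 0 ≤ τ) (m : ℕ) :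
    Tendsto (dysonMaj c m τ) atTop (𝓝 0) := (summable_dysonMaj hc hτ m).tendsto_atTop_zero

end

/-- The evolution of the matrix elements of a ladder operator `T` whose commutator with the
interaction is the bounded operator `-i R`. -/
theorem inner_dysonSum_ladder {Q : ℕ → E →L[ℂ] E} {V : ℝ → ℕ → E →L[ℂ] E} {c : ℝ} {m : ℕ}
    (hQ : IsCutoff Q) (hV : IsInteraction Q V c) {T : ℕ → E →L[ℂ] E} {c' : ℝ}
    (hT : IsLadder Q T c') {R : ℝ → E →L[ℂ] E} (hR : Continuous R)
    (hcomm : ∀ s n M x, n + 1 ≤ M → Q n x = x →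
      V s M (T M x) - T M (V s M x) = -Complex.I • R s x)
    {ξ η : E} (hξ : Q m ξ = ξ) (hη : Q m η = η) (t : ℝ) :
    ⟪dysonSum V m η t, ∑' k, T (m + k) (dyson V m ξ k t)⟫_ℂ = ⟪η, T m ξ⟫_ℂ +
      ∫ s in (0 : ℝ)..t, ⟪dysonSum V m η s, R s (dysonSum V m ξ s)⟫_ℂ := by
  have hc := (hV.ladder 0).nonneg
  have hc' := hT.nonneg
  let X := fun N s => dysonPartial V m ξ N s
  let Y := fun N s => dysonPartial V m η N s
  -- The first term is the expected derivative; the two others are the defects of the Schrödinger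
  -- equation for the partial sums of ξ and η. The level m + N + 1 leaves the one-particle margin
  -- that `hcomm` needs for vectors of level m + N.
  let D := fun (N : ℕ) (s : ℝ) => ⟪Y (N + 1) s, R s (X (N + 1) s)⟫_ℂ
    + Complex.I * ⟪Y (N + 1) s, T (m + N + 1) (V s (m + N + 1) (dyson V m ξ N s))⟫_ℂ
    - Complex.I * ⟪V s (m + N + 1) (dyson V m η N s), T (m + N + 1) (X (N + 1) s)⟫_ℂ
  have hd : ∀ N s, HasDerivAt (fun s => ⟪Y (N + 1) s, T (m + N + 1) (X (N + 1) s)⟫_ℂ) (D N s) s := by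
    intro N s
    have h1 := hasDerivAt_dysonPartial hV hη (show m + N ≤ m + N + 1 + 1 by omega) s
    have h2 := hasDerivAt_dysonPartial hV hξ (show m + N ≤ m + N + 1 + 1 by omega) s
    have h3 := ((T (m + N + 1)).restrictScalars ℝ).hasFDerivAt.comp_hasDerivAt s h2
    have h4 := HasDerivAt.inner ℂ h1 h3
    refine h4.congr_deriv ?_
    have e1 : dysonPartial V m ξ N s = X (N + 1) s - dyson V m ξ N s :=
      eq_sub_of_add_eq (dysonPartial_succ N s).symm
    have e2 : dysonPartial V m η N s = Y (N + 1) s - dyson V m η N s :=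
      eq_sub_of_add_eq (dysonPartial_succ N s).symm
    have h5 := hcomm s (m + N) (m + N + 1) (X (N + 1) s) le_rfl
      (cut_dysonPartial hQ hV hξ (by omega) s)
    have h6 := congrArg (fun v => ⟪Y (N + 1) s, v⟫_ℂ) h5
    simp only [inner_sub_right, inner_smul_right] at h6
    rw [e1, e2]
    change ⟪Y (N + 1) s, T (m + N + 1) (-Complex.I • V s (m + N + 1) (X (N + 1) s - dyson V m ξ N s))⟫_ℂ
      + ⟪-Complex.I • V s (m + N + 1) (Y (N + 1) s - dyson V m η N s),
        T (m + N + 1) (X (N + 1) s)⟫_ℂ = _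
    simp only [map_smul, map_sub, inner_smul_right, inner_smul_left, inner_sub_left,
      inner_sub_right, map_neg, Complex.conj_I, D]
    have h7 := hV.symm s (m + N + 1) (Y (N + 1) s) (T (m + N + 1) (X (N + 1) s))
    have hI : Complex.I * Complex.I = -1 := Complex.I_mul_I
    linear_combination Complex.I * h7 + Complex.I * h6 - ⟪Y (N + 1) s, R s (X (N + 1) s)⟫_ℂ * hI
  have hDc : ∀ N, Continuous (D N) := fun N => by
    have hX : Continuous (X (N + 1)) := continuous_dysonPartial hV (N + 1)
    have hY : Continuous (Y (N + 1)) := continuous_dysonPartial hV (N + 1)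
    have hv := hV.continuous (m + N + 1)
    have hdx : Continuous (dyson V m ξ N) := continuous_dyson hV N
    have hdy : Continuous (dyson V m η N) := continuous_dyson hV N
    refine Continuous.sub (Continuous.add ?_ (continuous_const.mul ?_)) (continuous_const.mul ?_)
    · exact hY.inner (hR.clm_apply hX)
    · exact hY.inner ((T (m + N + 1)).continuous.comp (hv.clm_apply hdx))
    · exact (hv.clm_apply hdy).inner ((T (m + N + 1)).continuous.comp hX)
  have hint : ∀ N, ⟪Y (N + 1) t, T (m + N + 1) (X (N + 1) t)⟫_ℂ =
      ⟪η, T m ξ⟫_ℂ + ∫ s in (0 : ℝ)..t, D N s := fun N => by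
    rw [intervalIntegral.integral_eq_sub_of_hasDerivAt (fun s _ => hd N s)
      ((hDc N).intervalIntegrable _ _)]
    have h1 : X (N + 1) 0 = ξ := dysonPartial_zero_time N
    have h2 : Y (N + 1) 0 = η := dysonPartial_zero_time N
    rw [h1, h2, hT.apply_eq m (m + N + 1) (by omega) ξ hξ]
    ring
  have hXt : ∀ s, Tendsto (fun N => X (N + 1) s) atTop (𝓝 (dysonSum V m ξ s)) := fun s =>
    (tendsto_dysonPartial hV s).comp (tendsto_add_atTop_nat 1)
  have hYt : ∀ s, Tendsto (fun N => Y (N + 1) s) atTop (𝓝 (dysonSum V m η s)) := fun s =>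
    (tendsto_dysonPartial hV s).comp (tendsto_add_atTop_nat 1)
  have hTX : ∀ s, Tendsto (fun N => T (m + N + 1) (X (N + 1) s)) atTop
      (𝓝 (∑' k, T (m + k) (dyson V m ξ k s))) := fun s =>
    (tendsto_ladder_dysonPartial hV hξ hT s (M := fun N => m + N) (fun N => by omega)).comp
      (tendsto_add_atTop_nat 1)
  -- The defects involve only the N-th Dyson term under at most two ladder operators, hence are
  -- bounded by a term of the convergent majorant.
  have hsmall1 : ∀ N s τ, |s| ≤ τ → ‖T (m + N + 1) (V s (m + N + 1) (dyson V m ξ N s))‖ ≤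
      c' * c * (dysonMaj c m τ N * ‖ξ‖) := fun N s τ hs =>
    norm_ladder_ladder_dyson_le hV hξ (hV.ladder s) hT (by omega) le_rfl hs
  have hsmall2 : ∀ N s τ, |s| ≤ τ → ‖V s (m + N + 1) (dyson V m η N s)‖ ≤
      c * (dysonMaj c m τ N * ‖η‖) := fun N s τ hs =>
    norm_ladder_dyson_le hV hη (hV.ladder s) (by omega) hs
  have hlim : ∀ s, Tendsto (fun N => D N s) atTop
      (𝓝 ⟪dysonSum V m η s, R s (dysonSum V m ξ s)⟫_ℂ) := fun s => by
    have hm := tendsto_dysonMaj hc (abs_nonneg s) m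
    have z1 : Tendsto (fun N => T (m + N + 1) (V s (m + N + 1) (dyson V m ξ N s))) atTop (𝓝 0) :=
      squeeze_zero_norm (fun N => hsmall1 N s _ le_rfl)
        (by simpa using (hm.mul_const ‖ξ‖).const_mul (c' * c))
    have z2 : Tendsto (fun N => V s (m + N + 1) (dyson V m η N s)) atTop (𝓝 0) :=
      squeeze_zero_norm (fun N => hsmall2 N s _ le_rfl)
        (by simpa using (hm.mul_const ‖η‖).const_mul c)
    have a1 := (hYt s).inner (𝕜 := ℂ) (((R s).continuous.tendsto _).comp (hXt s))
    have a2 := ((hYt s).inner (𝕜 := ℂ) z1).const_mul Complex.I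
    have a3 := (z2.inner (𝕜 := ℂ) (hTX s)).const_mul Complex.I
    have := (a1.add a2).sub a3
    simpa using this
  obtain ⟨CR, hCR⟩ : ∃ C, ∀ s ∈ Set.uIcc 0 t, ‖R s‖ ≤ C :=
    (isCompact_uIcc.exists_bound_of_continuousOn hR.continuousOn)
  set S := ∑' k, dysonMaj c m |t| k
  have hmajle : ∀ N, dysonMaj c m |t| N ≤ S := fun N =>
    (summable_dysonMaj hc (abs_nonneg t) m).le_tsum N fun k _ =>
      dysonMaj_nonneg hc (abs_nonneg t) m k
  have hS : 0 ≤ S := tsum_nonneg fun k => dysonMaj_nonneg hc (abs_nonneg t) m k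
  have habs : ∀ s ∈ Set.uIoc 0 t, |s| ≤ |t| := fun s hs => by
    have := Set.abs_sub_left_of_mem_uIcc (Set.uIoc_subset_uIcc hs)
    simpa using this
  have hlimint : Tendsto (fun N => ∫ s in (0 : ℝ)..t, D N s) atTop
      (𝓝 (∫ s in (0 : ℝ)..t, ⟪dysonSum V m η s, R s (dysonSum V m ξ s)⟫_ℂ)) := by
    refine intervalIntegral.tendsto_integral_filter_of_dominated_convergence
      (fun _ => (S * ‖η‖) * (CR * (S * ‖ξ‖)) + (S * ‖η‖) * (c' * c * (S * ‖ξ‖))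
        + (c * (S * ‖η‖)) * (c' * (S * ‖ξ‖)))
      (Eventually.of_forall fun N => (hDc N).aestronglyMeasurable)
      (Eventually.of_forall fun N => Eventually.of_forall fun s hs => ?_)
      intervalIntegrable_const (Eventually.of_forall fun s _ => hlim s)
    have hs' := habs s hs
    have bY : ‖Y (N + 1) s‖ ≤ S * ‖η‖ := norm_dysonPartial_le hV _ hs'
    have bX : ‖X (N + 1) s‖ ≤ S * ‖ξ‖ := norm_dysonPartial_le hV _ hs'
    have bTX : ‖T (m + N + 1) (X (N + 1) s)‖ ≤ c' * (S * ‖ξ‖) :=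
      norm_ladder_dysonPartial_le hV hξ hT (by omega) hs'
    have bR : ‖R s (X (N + 1) s)‖ ≤ CR * (S * ‖ξ‖) :=
      (R s).le_of_opNorm_le_of_le (hCR s (Set.uIoc_subset_uIcc hs)) bX
    have b1 : ‖T (m + N + 1) (V s (m + N + 1) (dyson V m ξ N s))‖ ≤ c' * c * (S * ‖ξ‖) :=
      (hsmall1 N s _ hs').trans (mul_le_mul_of_nonneg_left
        (mul_le_mul_of_nonneg_right (hmajle N) (norm_nonneg _)) (by positivity))
    have b2 : ‖V s (m + N + 1) (dyson V m η N s)‖ ≤ c * (S * ‖η‖) :=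
      (hsmall2 N s _ hs').trans (mul_le_mul_of_nonneg_left
        (mul_le_mul_of_nonneg_right (hmajle N) (norm_nonneg _)) hc)
    have hp : 0 ≤ S * ‖η‖ := by positivity
    refine (norm_sub_le _ _).trans (add_le_add ((norm_add_le _ _).trans (add_le_add ?_ ?_)) ?_)
    · exact (norm_inner_le_norm _ _).trans (mul_le_mul bY bR (norm_nonneg _) hp)
    · rw [norm_mul, Complex.norm_I, one_mul]
      exact (norm_inner_le_norm _ _).trans (mul_le_mul bY b1 (norm_nonneg _) hp)
    · rw [norm_mul, Complex.norm_I, one_mul]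
      exact (norm_inner_le_norm _ _).trans (mul_le_mul b2 bTX (norm_nonneg _) (by positivity))
  refine tendsto_nhds_unique ((hYt t).inner (𝕜 := ℂ) (hTX t)) ?_
  simp only [hint]
  exact hlimint.const_add _

/-- The Dyson series is isometric. -/
theorem inner_dysonSum {Q : ℕ → E →L[ℂ] E} {V : ℝ → ℕ → E →L[ℂ] E} {c : ℝ} {m : ℕ}
    (hQ : IsCutoff Q) (hV : IsInteraction Q V c) {ξ η : E} (hξ : Q m ξ = ξ) (hη : Q m η = η)
    (t : ℝ) : ⟪dysonSum V m η t, dysonSum V m ξ t⟫_ℂ = ⟪η, ξ⟫_ℂ := by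
  -- The identity is a ladder operator commuting with the interaction, so R = 0 and inner products
  -- are conserved.
  have hT : IsLadder Q (fun _ => 1) 1 := by
    refine ⟨fun n => ?_, fun _ _ _ _ _ => rfl, fun m x hx => hQ.apply_eq_of_le (Nat.le_succ m) hx⟩
    rw [one_mul]
    refine ContinuousLinearMap.norm_id_le.trans ?_
    rw [Real.one_le_sqrt]
    have := Nat.cast_nonneg (α := ℝ) n
    linarith
  have := inner_dysonSum_ladder hQ hV hT (R := fun _ => 0) continuous_const
    (fun s n M x _ _ => by simp) hξ hη t
  simpa [dysonSum] using this

end Dyson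


/-! ### Perturbations of the generator of a unitary group by an interaction -/

section Perturbation

variable {E : Type*} [NormedAddCommGroup E] [InnerProductSpace ℂ E] [CompleteSpace E]

open MeasureTheory Filter Topology

theorem inner_intervalIntegral_right {f : ℝ → E} (hf : Continuous f) (a b : ℝ) (x : E) :
    ⟪x, ∫ s in a..b, f s⟫_ℂ = ∫ s in a..b, ⟪x, f s⟫_ℂ :=
  ((innerSL ℂ x).intervalIntegral_comp_comm (hf.intervalIntegrable a b)).symm

theorem inner_intervalIntegral_left {f : ℝ → E} (hf : Continuous f) (a b : ℝ) (x : E) :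
    ⟪∫ s in a..b, f s, x⟫_ℂ = ∫ s in a..b, ⟪f s, x⟫_ℂ := by
  have h : Continuous fun s => ⟪x, f s⟫_ℂ := continuous_const.inner hf
  have h1 := Complex.conjCLE.toContinuousLinearMap.intervalIntegral_comp_comm
    (h.intervalIntegrable (μ := volume) a b)
  rw [← inner_intervalIntegral_right hf] at h1
  simpa using h1.symm

theorem IsCutoff.eq_of_inner {Q : ℕ → E →L[ℂ] E} (hQ : IsCutoff Q) {x y : E} (m : ℕ)
    (h : ∀ n, m ≤ n → ∀ z, Q n z = z → ⟪z, x⟫_ℂ = ⟪z, y⟫_ℂ) : x = y := by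
  have h1 : ∀ᶠ n in atTop, ⟪Q n (x - y), x - y⟫_ℂ = 0 := by
    filter_upwards [eventually_ge_atTop m] with n hn
    rw [inner_sub_right, h n hn _ (hQ.apply_apply n n le_rfl _), sub_self]
  have h2 := (hQ.tendsto (x - y)).inner (𝕜 := ℂ) (tendsto_const_nhds (x := x - y))
  exact sub_eq_zero.1 (inner_self_eq_zero.1
    (tendsto_nhds_unique h2 (tendsto_const_nhds.congr' (EventuallyEq.symm h1))))

section

variable {Q : ℕ → E →L[ℂ] E} {V : ℝ → ℕ → E →L[ℂ] E} {c : ℝ} {m : ℕ} {ξ : E}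

theorem continuous_dysonSum (hV : IsInteraction Q V c) : Continuous (dysonSum V m ξ) := by
  refine continuous_iff_continuousAt.2 fun t => ?_
  have hτ : 0 ≤ |t| + 1 := by positivity
  have h1 : ContinuousOn (dysonSum V m ξ) (Metric.ball t 1) :=
    continuousOn_tsum (fun k => (continuous_dyson hV k).continuousOn)
      ((summable_dysonMaj (hV.ladder 0).nonneg hτ m).mul_right ‖ξ‖)
      fun k s hs => norm_dyson_le_maj hV k <| by
        rw [Metric.mem_ball, Real.dist_eq] at hs
        have := abs_sub_abs_le_abs_sub s t
        linarith
  exact h1.continuousAt (Metric.ball_mem_nhds t one_pos)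

theorem dysonSum_zero_time (hV : IsInteraction Q V c) : dysonSum V m ξ 0 = ξ :=
  tendsto_nhds_unique ((tendsto_dysonPartial hV 0).comp (tendsto_add_atTop_nat 1))
    (tendsto_const_nhds.congr fun N => (dysonPartial_zero_time N).symm)

theorem norm_dysonSum (hQ : IsCutoff Q) (hV : IsInteraction Q V c) (hξ : Q m ξ = ξ) (t : ℝ) :
    ‖dysonSum V m ξ t‖ = ‖ξ‖ := by
  rw [@norm_eq_sqrt_re_inner ℂ, @norm_eq_sqrt_re_inner ℂ, inner_dysonSum hQ hV hξ hξ]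

end

/-- The free evolution `Γ`, generated by `H₀`, together with bounded truncations `W n` of an
interaction, whose interaction picture satisfies `IsInteraction`. -/
structure IsPerturbation (Q : ℕ → E →L[ℂ] E) (H₀ : E →ₗ.[ℂ] E) (Γ : ℝ → E →L[ℂ] E)
    (W : ℕ → E →L[ℂ] E) (V : ℝ → ℕ → E →L[ℂ] E) (c : ℝ) : Prop where
  cutoff : IsCutoff Q
  group : IsUnitaryGroupOf H₀ Γ
  comm : ∀ t n x, Γ t (Q n x) = Q n (Γ t x)
  interaction : IsInteraction Q V c
  covariant : ∀ s n x, Γ s (V s n x) = W n (Γ s x)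

namespace IsPerturbation

variable {Q : ℕ → E →L[ℂ] E} {H₀ : E →ₗ.[ℂ] E} {Γ : ℝ → E →L[ℂ] E} {W : ℕ → E →L[ℂ] E}
  {V : ℝ → ℕ → E →L[ℂ] E} {c : ℝ} {m : ℕ} {ξ : E}

theorem continuous_partial (hP : IsPerturbation Q H₀ Γ W V c) (N : ℕ) :
    Continuous fun s => Γ s (dysonPartial V m ξ N s) :=
  hP.group.isUnitaryGroup.continuous_comp continuous_id (continuous_dysonPartial hP.interaction N)

theorem continuous_sum (hP : IsPerturbation Q H₀ Γ W V c) :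
    Continuous fun s => Γ s (dysonSum V m ξ s) :=
  hP.group.isUnitaryGroup.continuous_comp continuous_id (continuous_dysonSum hP.interaction)

/-- The integrated equation holds weakly against the domain of H₀, and maximality of H₀ upgrades it
to graph membership. Integrating over time avoids asking that the partial sums themselves lie in the
domain. -/
theorem integral_partial_mem_graph (hP : IsPerturbation Q H₀ Γ W V c) (hξ : Q m ξ = ξ) (N : ℕ)
    (t : ℝ) : (∫ s in (0 : ℝ)..t, Γ s (dysonPartial V m ξ (N + 1) s),
      Complex.I • (Γ t (dysonPartial V m ξ (N + 1) t) - ξ) -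
        ∫ s in (0 : ℝ)..t, W (m + N) (Γ s (dysonPartial V m ξ N s))) ∈ H₀.graph := by
  have hΓ := hP.group.isUnitaryGroup
  have hV := hP.interaction
  have hc1 := hP.continuous_partial (m := m) (ξ := ξ) (N + 1)
  have hc2 : Continuous fun s => W (m + N) (Γ s (dysonPartial V m ξ N s)) :=
    (W (m + N)).continuous.comp (hP.continuous_partial N)
  refine hP.group.isSymmSurj.mem_graph fun χ χ' hχ => ?_
  have hg : (χ, χ') ∈ IsUnitaryGroup.generatorGraph Γ := hP.group.graph_eq ▸ hχ
  have hd : ∀ s, HasDerivAt (fun s => ⟪Γ s (dysonPartial V m ξ (N + 1) s), χ⟫_ℂ)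
      (Complex.I * (⟪Γ s (dysonPartial V m ξ (N + 1) s), χ'⟫_ℂ +
        ⟪W (m + N) (Γ s (dysonPartial V m ξ N s)), χ⟫_ℂ)) s := fun s => by
    have h1 := hasDerivAt_dysonPartial hV hξ (show m + N ≤ m + N + 1 by omega) s
    have h2 : HasDerivAt (fun s => Γ (-s) χ) (-(-Complex.I • Γ (-s) χ')) s :=
      (HasDerivAt.scomp s (hΓ.hasDerivAt hg (-s)) (hasDerivAt_neg s)).congr_deriv (by simp)
    have h3 := HasDerivAt.inner ℂ h1 h2
    simp only [hΓ.inner_apply_left]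
    refine h3.congr_deriv ?_
    rw [← hP.covariant, hΓ.inner_apply_left]
    simp only [inner_smul_left, inner_smul_right, inner_neg_right, map_neg, Complex.conj_I]
    ring
  have hi := intervalIntegral.integral_eq_sub_of_hasDerivAt (a := 0) (b := t) (fun s _ => hd s)
    (Continuous.intervalIntegrable (continuous_const.mul
      ((hc1.inner continuous_const).add (hc2.inner continuous_const))) _ _)
  rw [intervalIntegral.integral_const_mul, intervalIntegral.integral_add
    ((hc1.inner continuous_const).intervalIntegrable _ _)
    ((hc2.inner continuous_const).intervalIntegrable _ _),
    ← inner_intervalIntegral_left hc1, ← inner_intervalIntegral_left hc2,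
    dysonPartial_zero_time, hΓ.apply_zero] at hi
  rw [inner_sub_left, inner_smul_left, inner_sub_left, ← hi, Complex.conj_I]
  have hI : Complex.I * Complex.I = -1 := Complex.I_mul_I
  linear_combination -(⟪∫ s in (0 : ℝ)..t, Γ s (dysonPartial V m ξ (N + 1) s), χ'⟫_ℂ +
        ⟪∫ s in (0 : ℝ)..t, W (m + N) (Γ s (dysonPartial V m ξ N s)), χ⟫_ℂ) * hI

/-- The integrated partial sum has finite particle number, so W may be added to pass from H₀ to A.
The interaction terms on N + 1 and N summands cancel up to the last Dyson term. -/
theorem integral_partial_mem_graph_add (hP : IsPerturbation Q H₀ Γ W V c) {A : E →ₗ.[ℂ] E}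
    (hA : ∀ n x y, Q n x = x → (x, y) ∈ H₀.graph → (x, y + W n x) ∈ A.graph) (hξ : Q m ξ = ξ)
    (N : ℕ) (t : ℝ) : (∫ s in (0 : ℝ)..t, Γ s (dysonPartial V m ξ (N + 1) s),
      Complex.I • (Γ t (dysonPartial V m ξ (N + 1) t) - ξ) +
        ∫ s in (0 : ℝ)..t, Γ s (V s (m + N) (dyson V m ξ N s))) ∈ A.graph := by
  have hc1 := hP.continuous_partial (m := m) (ξ := ξ) (N + 1)
  have hc2 : Continuous fun s => W (m + N) (Γ s (dysonPartial V m ξ N s)) :=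
    (W (m + N)).continuous.comp (hP.continuous_partial N)
  have hc3 : Continuous fun s => W (m + N) (Γ s (dysonPartial V m ξ (N + 1) s)) :=
    (W (m + N)).continuous.comp hc1
  have hcut : Q (m + N) (∫ s in (0 : ℝ)..t, Γ s (dysonPartial V m ξ (N + 1) s)) =
      ∫ s in (0 : ℝ)..t, Γ s (dysonPartial V m ξ (N + 1) s) := by
    rw [← (Q (m + N)).intervalIntegral_comp_comm (hc1.intervalIntegrable _ _)]
    refine intervalIntegral.integral_congr fun s _ => ?_
    simp only [← hP.comm]
    rw [cut_dysonPartial hP.cutoff hP.interaction hξ (show m + (N + 1) ≤ m + N + 1 by omega)]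
  have h := hA _ _ _ hcut (hP.integral_partial_mem_graph hξ N t)
  rw [← (W (m + N)).intervalIntegral_comp_comm (hc1.intervalIntegrable _ _), sub_add_eq_add_sub,
    add_sub_assoc, ← intervalIntegral.integral_sub (hc3.intervalIntegrable _ _)
      (hc2.intervalIntegrable _ _)] at h
  have he : ∀ s, W (m + N) (Γ s (dysonPartial V m ξ (N + 1) s)) -
      W (m + N) (Γ s (dysonPartial V m ξ N s)) = Γ s (V s (m + N) (dyson V m ξ N s)) := fun s => by
    rw [hP.covariant, ← map_sub, ← map_sub, dysonPartial_succ, add_sub_cancel_left]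
  simpa only [he] using h

/-- The mild form of the Schrödinger equation for the sum of the Dyson series. -/
theorem integral_sum_mem_graph (hP : IsPerturbation Q H₀ Γ W V c) {A : E →ₗ.[ℂ] E}
    (hcl : A.IsClosed) (hA : ∀ n x y, Q n x = x → (x, y) ∈ H₀.graph → (x, y + W n x) ∈ A.graph)
    (hξ : Q m ξ = ξ) (t : ℝ) : (∫ s in (0 : ℝ)..t, Γ s (dysonSum V m ξ s),
      Complex.I • (Γ t (dysonSum V m ξ t) - ξ)) ∈ A.graph := by
  have hΓ := hP.group.isUnitaryGroup
  have hV := hP.interaction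
  have hc := (hV.ladder 0).nonneg
  have habs : ∀ s ∈ Set.uIoc 0 t, |s| ≤ |t| := fun s hs => by
    have := Set.abs_sub_left_of_mem_uIcc (Set.uIoc_subset_uIcc hs)
    simpa using this
  have hX : ∀ s, Tendsto (fun N => Γ s (dysonPartial V m ξ (N + 1) s)) atTop
      (𝓝 (Γ s (dysonSum V m ξ s))) := fun s => ((Γ s).continuous.tendsto _).comp
    ((tendsto_dysonPartial hV s).comp (tendsto_add_atTop_nat 1))
  have h1 : Tendsto (fun N => ∫ s in (0 : ℝ)..t, Γ s (dysonPartial V m ξ (N + 1) s)) atTop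
      (𝓝 (∫ s in (0 : ℝ)..t, Γ s (dysonSum V m ξ s))) := by
    refine intervalIntegral.tendsto_integral_filter_of_dominated_convergence
      (fun _ => (∑' k, dysonMaj c m |t| k) * ‖ξ‖)
      (Eventually.of_forall fun N => (hP.continuous_partial (N + 1)).aestronglyMeasurable)
      (Eventually.of_forall fun N => Eventually.of_forall fun s hs => ?_)
      intervalIntegrable_const (Eventually.of_forall fun s _ => hX s)
    rw [hΓ.norm_apply]
    exact norm_dysonPartial_le hV _ (habs s hs)
  -- The leftover last-term integral vanishes in the limit, and closedness of A yields the equation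
  -- for the full sum.
  have h2 : Tendsto (fun N => ∫ s in (0 : ℝ)..t, Γ s (V s (m + N) (dyson V m ξ N s))) atTop
      (𝓝 0) := by
    have hm := (((tendsto_dysonMaj hc (abs_nonneg t) m).mul_const ‖ξ‖).const_mul c).mul_const |t|
    simp only [zero_mul, mul_zero] at hm
    refine squeeze_zero_norm (fun N => ?_) hm
    have := intervalIntegral.norm_integral_le_of_norm_le_const (a := 0) (b := t)
      (C := c * (dysonMaj c m |t| N * ‖ξ‖)) (f := fun s => Γ s (V s (m + N) (dyson V m ξ N s)))
      fun s hs => by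
        rw [hΓ.norm_apply]
        exact norm_ladder_dyson_le hV hξ (hV.ladder s) le_rfl (habs s hs)
    simpa using this
  have h3 := h1.prodMk_nhds ((((hX t).sub_const ξ).const_smul Complex.I).add h2)
  rw [add_zero] at h3
  exact hcl.mem_of_tendsto h3
    (Eventually.of_forall fun N => hP.integral_partial_mem_graph_add hA hξ N t)

/-- The deficiency argument run along the Dyson sums, since no group for A is available yet: for φ
orthogonal to the range of A + ir, the function ⟪φ, Γ_t ξ(t)⟫ has derivative -r times itself and is
bounded because the Dyson series is isometric. -/
theorem isSymmSurj (hP : IsPerturbation Q H₀ Γ W V c) {A : E →ₗ.[ℂ] E} (hcl : A.IsClosed)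
    (hsymm : ∀ x y x' y', (x, y) ∈ A.graph → (x', y') ∈ A.graph → ⟪y, x'⟫_ℂ = ⟪x, y'⟫_ℂ)
    (hA : ∀ n x y, Q n x = x → (x, y) ∈ H₀.graph → (x, y + W n x) ∈ A.graph) : IsSymmSurj A := by
  have hΓ := hP.group.isUnitaryGroup
  refine isSymmSurj_of_isClosed hcl hsymm fun r hr φ hφ => ?_
  refine hP.cutoff.eq_of_inner 0 fun n _ ξ hξ => ?_
  have hc := hP.continuous_sum (m := n) (ξ := ξ)
  have hc' : Continuous fun s => ⟪φ, Γ s (dysonSum V n ξ s)⟫_ℂ := continuous_const.inner hc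
  have h1 : ∀ t, ⟪φ, Γ t (dysonSum V n ξ t)⟫_ℂ =
      ⟪φ, ξ⟫_ℂ + ((-r : ℝ) : ℂ) * ∫ s in (0 : ℝ)..t, ⟪φ, Γ s (dysonSum V n ξ s)⟫_ℂ := fun t => by
    have h2 := hφ _ _ (hP.integral_sum_mem_graph hcl hA hξ t)
    rw [inner_add_right, inner_smul_right, inner_smul_right, inner_sub_right,
      inner_intervalIntegral_right hc] at h2
    have hI : Complex.I * Complex.I = -1 := Complex.I_mul_I
    push_cast
    linear_combination -Complex.I * h2 + (⟪φ, Γ t (dysonSum V n ξ t)⟫_ℂ - ⟪φ, ξ⟫_ℂ +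
      r * ∫ s in (0 : ℝ)..t, ⟪φ, Γ s (dysonSum V n ξ s)⟫_ℂ) * hI
  have h2 : ∀ t, HasDerivAt (fun t => ⟪φ, Γ t (dysonSum V n ξ t)⟫_ℂ)
      (((-r : ℝ) : ℂ) * ⟪φ, Γ t (dysonSum V n ξ t)⟫_ℂ) t := fun t => by
    have h3 := ((hc'.integral_hasStrictDerivAt 0 t).hasDerivAt.const_mul ((-r : ℝ) : ℂ)).const_add
      ⟪φ, ξ⟫_ℂ
    exact h3.congr_of_eventuallyEq (Eventually.of_forall h1)
  have h3 := eq_zero_of_hasDerivAt_mul_of_bounded (neg_ne_zero.2 hr) h2 (C := ‖φ‖ * ‖ξ‖)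
    fun t => (norm_inner_le_norm _ _).trans (by
      rw [hΓ.norm_apply, norm_dysonSum hP.cutoff hP.interaction hξ])
  simp only [hΓ.apply_zero, dysonSum_zero_time hP.interaction] at h3
  rw [inner_zero_right, ← inner_conj_symm, h3, map_zero]

theorem apply_eq_dysonSum (hP : IsPerturbation Q H₀ Γ W V c) {A : E →ₗ.[ℂ] E} (hcl : A.IsClosed)
    (hA : ∀ n x y, Q n x = x → (x, y) ∈ H₀.graph → (x, y + W n x) ∈ A.graph)
    {U : ℝ → E →L[ℂ] E} (hU : IsUnitaryGroupOf A U) (hξ : Q m ξ = ξ) (t : ℝ) :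
    Γ (-t) (U t ξ) = dysonSum V m ξ t := by
  have hΓ := hP.group.isUnitaryGroup
  have hc := hP.continuous_sum (m := m) (ξ := ξ)
  have hcU := hU.continuous ξ
  have hcz : Continuous fun s => Γ s (dysonSum V m ξ s) - U s ξ := hc.sub hcU
  -- The difference of the two candidate solutions need not lie in the domain, but its time integral
  -- does and solves i z' = A z with z(0) = 0. So the integral vanishes, and with it its derivative.
  have hz : ∀ t, HasDerivAt (fun t => ∫ s in (0 : ℝ)..t, (Γ s (dysonSum V m ξ s) - U s ξ))
      (-Complex.I • Complex.I • (Γ t (dysonSum V m ξ t) - U t ξ)) t := fun t => by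
    rw [smul_smul, neg_mul, Complex.I_mul_I, neg_neg, one_smul]
    exact (hcz.integral_hasStrictDerivAt 0 t).hasDerivAt
  have hg : ∀ t, (∫ s in (0 : ℝ)..t, (Γ s (dysonSum V m ξ s) - U s ξ),
      Complex.I • (Γ t (dysonSum V m ξ t) - U t ξ)) ∈ A.graph := fun t => by
    have h1 := hP.integral_sum_mem_graph hcl hA hξ t
    have h2 := hU.isUnitaryGroup.integral_mem_generatorGraph ξ t
    rw [← hU.graph_eq] at h2
    have h3 := A.graph.sub_mem h1 h2
    rw [Prod.mk_sub_mk, ← intervalIntegral.integral_sub (hc.intervalIntegrable _ _)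
      (hcU.intervalIntegrable _ _), ← smul_sub, sub_sub_sub_cancel_right] at h3
    exact h3
  have h0 := eq_zero_of_hasDerivAt_of_symmetric hU.isSymmSurj.symm hz hg
    intervalIntegral.integral_same
  have h1 := hz t
  simp only [h0] at h1
  have h2 := h1.unique (hasDerivAt_const t 0)
  rw [smul_smul, neg_mul, Complex.I_mul_I, neg_neg, one_smul, sub_eq_zero] at h2
  rw [← h2, hΓ.apply_neg_apply]

end IsPerturbation

/-! ### Heisenberg evolution of adjoints -/

/-- The pair `(ψ, w)` belongs to the graph of the adjoint of the unbounded operator described by the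
ladder operators `T n`. -/
def IsAdjointPair (Q T : ℕ → E →L[ℂ] E) (ψ w : E) : Prop :=
  ∀ n, ContinuousLinearMap.adjoint (T n) ψ = Q n w

/-- For ξ of finite particle number, ⟪w, U_t ξ⟫ = ⟪U_t ψ, T U_t ξ⟫ follows by inserting partial
Dyson sums, where the adjoint pair applies. The Heisenberg equation U_t*TU_t ξ = Tξ + ∫ U_s*R_sU_s ξ
then moves the evolution onto ψ. -/
theorem isAdjointPair_heisenberg {Q T : ℕ → E →L[ℂ] E} {V : ℝ → ℕ → E →L[ℂ] E} {c c' : ℝ}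
    (hQ : IsCutoff Q) (hV : IsInteraction Q V c) (hT : IsLadder Q T c')
    (hTQ : ∀ n x, T n (Q n x) = T n x) {R : ℝ → E →L[ℂ] E} (hR : Continuous R)
    (hcomm : ∀ s n M x, n + 1 ≤ M → Q n x = x →
      V s M (T M x) - T M (V s M x) = -Complex.I • R s x)
    {U : ℝ → E →L[ℂ] E} (hU : ∀ t m ξ, Q m ξ = ξ → U t ξ = dysonSum V m ξ t)
    (hUc : ∀ {x : ℝ → E}, Continuous x → Continuous fun s => U s (x s))
    (hUc' : ∀ {x : ℝ → E}, Continuous x → Continuous fun s => ContinuousLinearMap.adjoint (U s) (x s))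
    {t : ℝ} {ψ w : E} (h : IsAdjointPair Q T (U t ψ) w) :
    IsAdjointPair Q T ψ (ContinuousLinearMap.adjoint (U t) w - ∫ s in (0 : ℝ)..t,
      ContinuousLinearMap.adjoint (U s) (ContinuousLinearMap.adjoint (R s) (U s ψ))) := by
  have hR' : Continuous fun s => ContinuousLinearMap.adjoint (R s) :=
    (ContinuousLinearMap.adjoint (𝕜 := ℂ) (E := E) (F := E)).continuous.comp hR
  have hc1 : ∀ x, Continuous fun s => ContinuousLinearMap.adjoint (U s) (R s (U s x)) := fun x =>
    hUc' (hR.clm_apply (hUc continuous_const))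
  have hc2 : ∀ x, Continuous fun s => ContinuousLinearMap.adjoint (U s)
      (ContinuousLinearMap.adjoint (R s) (U s x)) := fun x =>
    hUc' (hR'.clm_apply (hUc continuous_const))
  have key : ∀ m ξ, Q m ξ = ξ → ⟪w, U t ξ⟫_ℂ = ⟪ψ, T m ξ⟫_ℂ +
      ⟪∫ s in (0 : ℝ)..t, ContinuousLinearMap.adjoint (U s)
        (ContinuousLinearMap.adjoint (R s) (U s ψ)), ξ⟫_ℂ := by
    intro m ξ hξ
    -- The weak Heisenberg equation becomes one between vectors by testing against finite-particle
    -- η, with ξ and η raised to a common level n.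
    have hy : ContinuousLinearMap.adjoint (U t) (∑' k, T (m + k) (dyson V m ξ k t)) =
        T m ξ + ∫ s in (0 : ℝ)..t, ContinuousLinearMap.adjoint (U s) (R s (U s ξ)) := by
      refine hQ.eq_of_inner m fun n hn η hη => ?_
      have hξn := hQ.apply_eq_of_le hn hξ
      have h1 := inner_dysonSum_ladder hQ hV hT hR hcomm hξn hη t
      simp only [← hU _ n _ hη, ← hU _ n _ hξn] at h1
      rw [inner_add_right, inner_intervalIntegral_right (hc1 ξ),
        ContinuousLinearMap.adjoint_inner_right]
      simp only [ContinuousLinearMap.adjoint_inner_right]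
      rw [← hT.apply_eq m n hn ξ hξ, ← h1]
      congr 2
      funext k
      rw [dyson_eq_of_le hV hξ hn, hT.apply_eq (m + k) (n + k) (by omega) _ (cut_dyson hV hξ k t)]
    have hX := tendsto_dysonPartial (m := m) (ξ := ξ) hV t
    have hTX := tendsto_ladder_dysonPartial hV hξ hT t (M := fun N => m + N) fun N => by omega
    -- Each partial sum is fixed by Q (m + N), so the pair relation at that level applies without
    -- error.
    have e1 : ∀ N, ⟪w, dysonPartial V m ξ N t⟫_ℂ = ⟪U t ψ, T (m + N) (dysonPartial V m ξ N t)⟫_ℂ :=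
      fun N => by
        rw [← ContinuousLinearMap.adjoint_inner_left, h (m + N), hQ.symm,
          cut_dysonPartial hQ hV hξ (by omega)]
    have h1 := (tendsto_const_nhds (x := w)).inner (𝕜 := ℂ) hX
    have h2 := (tendsto_const_nhds (x := U t ψ)).inner (𝕜 := ℂ) hTX
    simp only [e1] at h1
    have h3 := tendsto_nhds_unique h1 h2
    rw [hU t m ξ hξ, h3, ← ContinuousLinearMap.adjoint_inner_right, hy, inner_add_right,
      inner_intervalIntegral_right (hc1 ξ), inner_intervalIntegral_left (hc2 ψ)]
    simp only [ContinuousLinearMap.adjoint_inner_left, ContinuousLinearMap.adjoint_inner_right]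
  intro n
  refine ext_inner_right ℂ fun x => ?_
  have h1 := key n (Q n x) (hQ.apply_apply n n le_rfl x)
  rw [ContinuousLinearMap.adjoint_inner_left, hQ.symm, inner_sub_left,
    ContinuousLinearMap.adjoint_inner_left, h1, hTQ]
  ring

end Perturbation


/-! ### The interaction of the system with the bath -/

section Generic

variable {E : Type*} [NormedAddCommGroup E] [InnerProductSpace ℂ E] [CompleteSpace E]
variable {F : Type*} [NormedAddCommGroup F] [InnerProductSpace ℂ F] [CompleteSpace F]

open Filter Topology

theorem ht_sub_right (x : E) (y y' : F) : ht x (y - y') = ht x y - ht x y' := by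
  simp only [← htL_apply, map_sub]

theorem norm_mapT_one_le (Y : F →L[ℂ] F) : ‖mapT (1 : E →L[ℂ] E) Y‖ ≤ ‖Y‖ :=
  (norm_mapT_le _ _).trans (mul_le_of_le_one_left (norm_nonneg _) ContinuousLinearMap.norm_id_le)

theorem continuous_mapT_right (X : E →L[ℂ] E) : Continuous fun Y : F →L[ℂ] F => mapT X Y :=
  (LinearMap.mkContinuous (σ := RingHom.id ℂ) ⟨⟨fun Y : F →L[ℂ] F => mapT X Y, mapT_add_right X⟩,
    mapT_smul_right X⟩ ‖X‖ fun Y => norm_mapT_le X Y).continuous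

theorem adjoint_mul (S T : E →L[ℂ] E) : ContinuousLinearMap.adjoint (S * T) =
    ContinuousLinearMap.adjoint T * ContinuousLinearMap.adjoint S :=
  ContinuousLinearMap.adjoint_comp S T

theorem adjoint_one : ContinuousLinearMap.adjoint (1 : E →L[ℂ] E) = 1 := star_one _

theorem continuous_adjoint :
    Continuous fun S : E →L[ℂ] E => ContinuousLinearMap.adjoint S :=
  (ContinuousLinearMap.adjoint (𝕜 := ℂ) (E := E) (F := E)).continuous

/-- Taking the adjoint of an intertwining relation at time -t gives one at time t; covariance of
annihilation thus follows from that of creation. -/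
theorem IsUnitaryGroup.mul_adjoint {U : ℝ → E →L[ℂ] E} (hU : IsUnitaryGroup U) {S T : E →L[ℂ] E}
    {t : ℝ} (h : U (-t) * T = S * U (-t)) :
    U t * ContinuousLinearMap.adjoint S = ContinuousLinearMap.adjoint T * U t := by
  have h1 := congrArg ContinuousLinearMap.adjoint h
  rw [adjoint_mul, adjoint_mul, hU.adjoint_eq, neg_neg] at h1
  exact h1.symm

/-- The operator `H ⊗ 1 + i L ⊗ C - i L* ⊗ C*`. -/
def coupling (H L : E →L[ℂ] E) (C : F →L[ℂ] F) : HTensor E F →L[ℂ] HTensor E F :=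
  mapT H 1 + Complex.I • mapT L C -
    Complex.I • mapT (ContinuousLinearMap.adjoint L) (ContinuousLinearMap.adjoint C)

theorem coupling_ht (H L : E →L[ℂ] E) (C : F →L[ℂ] F) (x : E) (y : F) :
    coupling H L C (ht x y) = ht (H x) y + Complex.I • ht (L x) (C y) -
      Complex.I • ht (ContinuousLinearMap.adjoint L x) (ContinuousLinearMap.adjoint C y) := by
  rw [coupling, sub_apply, add_apply, smul_apply, smul_apply, mapT_ht, mapT_ht, mapT_ht,
    one_apply_eq_self]

theorem adjoint_coupling {H : E →L[ℂ] E} (hH : IsSelfAdjoint H) (L : E →L[ℂ] E) (C : F →L[ℂ] F) :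
    ContinuousLinearMap.adjoint (coupling H L C) = coupling H L C := by
  have h1 : ContinuousLinearMap.adjoint H = H := hH
  rw [coupling, map_sub, map_add, map_smulₛₗ, map_smulₛₗ, adjoint_mapT, adjoint_mapT, adjoint_mapT,
    ContinuousLinearMap.adjoint_adjoint, ContinuousLinearMap.adjoint_adjoint, h1, adjoint_one,
    Complex.conj_I]
  simp only [neg_smul]
  abel

theorem continuous_coupling (H L : E →L[ℂ] E) :
    Continuous fun C : F →L[ℂ] F => coupling H L C := by
  have h1 : Continuous fun C : F →L[ℂ] F => Complex.I • mapT L C :=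
    (continuous_mapT_right L).fun_const_smul _
  have h2 : Continuous fun C : F →L[ℂ] F => Complex.I • mapT (ContinuousLinearMap.adjoint L)
      (ContinuousLinearMap.adjoint C) :=
    ((continuous_mapT_right _).comp continuous_adjoint).fun_const_smul _
  exact (h1.const_add (mapT H 1)).sub h2

theorem norm_add_I_smul_sub_le {V : Type*} [NormedAddCommGroup V] [NormedSpace ℂ V] (x y z : V) :
    ‖x + Complex.I • y - Complex.I • z‖ ≤ ‖x‖ + ‖y‖ + ‖z‖ := by
  have h5 := norm_sub_le (x + Complex.I • y) (Complex.I • z)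
  have h6 := norm_add_le x (Complex.I • y)
  rw [norm_smul, Complex.norm_I, one_mul] at h5 h6
  linarith

theorem norm_coupling_le (H L : E →L[ℂ] E) (C : F →L[ℂ] F) :
    ‖coupling H L C‖ ≤ ‖H‖ + 2 * ‖L‖ * ‖C‖ := by
  have h2 : ‖mapT H (1 : F →L[ℂ] F)‖ ≤ ‖H‖ * 1 :=
    (norm_mapT_le H 1).trans (mul_le_mul_of_nonneg_left
      ContinuousLinearMap.norm_id_le (norm_nonneg H))
  have h3 := norm_mapT_le L C
  have h4 := norm_mapT_le (ContinuousLinearMap.adjoint L) (ContinuousLinearMap.adjoint C)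
  rw [LinearIsometryEquiv.norm_map, LinearIsometryEquiv.norm_map] at h4
  have h5 := norm_add_I_smul_sub_le (mapT H (1 : F →L[ℂ] F)) (mapT L C)
    (mapT (ContinuousLinearMap.adjoint L) (ContinuousLinearMap.adjoint C))
  rw [coupling]
  linarith

theorem coupling_mul_congr (H L : E →L[ℂ] E) {C C' D : F →L[ℂ] F} (h : C * D = C' * D)
    (h' : ContinuousLinearMap.adjoint C * D = ContinuousLinearMap.adjoint C' * D) :
    coupling H L C * mapT 1 D = coupling H L C' * mapT 1 D := by
  simp only [coupling, add_mul, sub_mul, smul_mul_assoc, mapT_mul, h, h']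

theorem mul_coupling_congr (H L : E →L[ℂ] E) {C C' D D' : F →L[ℂ] F} (h : D * C = C' * D')
    (h' : D * ContinuousLinearMap.adjoint C = ContinuousLinearMap.adjoint C' * D') (h1 : D = D') :
    mapT 1 D * coupling H L C = coupling H L C' * mapT 1 D' := by
  subst h1
  simp only [coupling, mul_add, mul_sub, add_mul, sub_mul, mul_smul_comm, smul_mul_assoc, mapT_mul,
    h, h', one_mul, mul_one]

theorem mul_coupling_mul (H L : E →L[ℂ] E) {C D D' : F →L[ℂ] F} (h : D * C = C)
    (h' : D * ContinuousLinearMap.adjoint C = ContinuousLinearMap.adjoint C) (h1 : D * D' = D') :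
    mapT 1 D * (coupling H L C * mapT 1 D') = coupling H L C * mapT 1 D' := by
  simp only [coupling, mul_add, mul_sub, add_mul, sub_mul, mul_smul_comm, smul_mul_assoc, mapT_mul,
    one_mul, ← mul_assoc, h, h', mul_one, h1]

/-- H⊗1 commutes with 1⊗K, and so does L⊗C on the range of D by `h`; only -iL*⊗[C*, K] survives, and
it equals -iz L*⊗1 there. -/
theorem coupling_commutator (H L : E →L[ℂ] E) {C K D : F →L[ℂ] F} {z : ℂ}
    (h : C * K * D = K * C * D) (h' : (ContinuousLinearMap.adjoint C * K -
      K * ContinuousLinearMap.adjoint C) * D = z • D) :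
    (coupling H L C * mapT 1 K - mapT 1 K * coupling H L C) * mapT 1 D =
      -Complex.I • ((z • mapT (ContinuousLinearMap.adjoint L) 1) * mapT 1 D) := by
  refine ext_ht fun a φ => ?_
  have e1 := congrArg (fun S => ht (L a) (S φ)) h
  have e2 := congrArg (fun S => ht (ContinuousLinearMap.adjoint L a) (S φ)) h'
  simp only [mul_apply_eq_comp, sub_apply, smul_apply, ht_sub_right, ht_smul_right] at e1 e2
  simp only [mul_apply_eq_comp, sub_apply, smul_apply, mapT_ht, one_apply_eq_self, map_add, map_sub,
    map_smul, coupling_ht]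
  rw [e1, ← e2]
  simp only [smul_sub, neg_smul]
  abel

theorem tendsto_mapT_one {l : ℕ → F →L[ℂ] F} (hl : ∀ n, ‖l n‖ ≤ 1)
    (h : ∀ y, Tendsto (fun n => l n y) atTop (𝓝 y)) (x : HTensor E F) :
    Tendsto (fun n => mapT (1 : E →L[ℂ] E) (l n) x) atTop (𝓝 x) := by
  have h1 : ∀ n z, ‖(mapT (1 : E →L[ℂ] E) (l n) - 1) z‖ ≤ 2 * ‖z‖ := fun n z => by
    refine ContinuousLinearMap.le_of_opNorm_le _ ?_ z
    have h2 := (norm_mapT_one_le (E := E) (l n)).trans (hl n)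
    have h3 : ‖(1 : HTensor E F →L[ℂ] HTensor E F)‖ ≤ 1 := ContinuousLinearMap.norm_id_le
    linarith [norm_sub_le (mapT (1 : E →L[ℂ] E) (l n)) 1]
  have hD : Dense (Submodule.span ℂ (Set.image2 (ht (E := E) (F := F)) Set.univ Set.univ) :
      Set (HTensor E F)) := by
    rw [Submodule.dense_iff_topologicalClosure_eq_top]
    exact span_ht_eq_top span_univ_closure span_univ_closure
  have h4 := tendsto_zero_of_dense (l := atTop) (T := fun n => mapT (1 : E →L[ℂ] E) (l n) - 1) h1 hD
    (fun z hz => by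
      induction hz using Submodule.span_induction with
      | mem z hz =>
        obtain ⟨a, -, b, -, rfl⟩ := hz
        simp only [sub_apply, one_apply_eq_self, mapT_ht, ← ht_sub_right]
        have h5 : Tendsto (fun n => htL E F a (l n b - b)) atTop (𝓝 (htL E F a (b - b))) :=
          ((htL E F a).continuous.tendsto _).comp ((h b).sub_const b)
        rw [sub_self, map_zero] at h5
        exact h5
      | zero => simp only [map_zero]; exact tendsto_const_nhds
      | add a b _ _ ha hb => simp only [map_add]; simpa using ha.add hb
      | smul c a _ ha => simp only [map_smul]; simpa using ha.const_smul c) x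
  simpa using h4.add_const x

theorem isLadder_of_mul {Q T : ℕ → E →L[ℂ] E} {c : ℝ} (hT : ∀ n, ‖T n‖ ≤ c * Real.sqrt (n + 1))
    (h : ∀ m n, m ≤ n → T n * Q m = T m * Q m) (h' : ∀ m, Q (m + 1) * (T m * Q m) = T m * Q m) :
    IsLadder Q T c := by
  refine ⟨hT, fun m n hmn x hx => ?_, fun m x hx => ?_⟩
  · have := congrArg (fun S => S x) (h m n hmn)
    simpa only [mul_apply_eq_comp, hx] using this
  · have := congrArg (fun S => S x) (h' m)
    simpa only [mul_apply_eq_comp, hx] using this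

end Generic

/-! ### The truncated system-bath interaction and its covariance under the free evolution -/

section Coupling

universe w w'
variable {𝓗 : Type w} [NormedAddCommGroup 𝓗] [InnerProductSpace ℂ 𝓗] [CompleteSpace 𝓗]
variable {f : Type w'} [NormedAddCommGroup f] [InnerProductSpace ℂ f] [CompleteSpace f]

open MeasureTheory Filter Topology

variable (𝓗 f) in
/-- The projection to the vectors with at most `n` bath particles. -/
def totalCut (n : ℕ) : Total 𝓗 f →L[ℂ] Total 𝓗 f := mapT 1 (cut (fun n => symPow f n) n)

variable (𝓗) in
/-- The operator `1 ⊗ a(k)*` on vectors with at most `n` bath particles. -/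
def totalCre (k : f) (n : ℕ) : Total 𝓗 f →L[ℂ] Total 𝓗 f := mapT 1 (cre n k)

/-- The operator `H ⊗ 1 + i L ⊗ a(k)* - i L* ⊗ a(k)` on vectors with at most `n` bath particles. -/
def totalInt (H L : 𝓗 →L[ℂ] 𝓗) (k : f) (n : ℕ) : Total 𝓗 f →L[ℂ] Total 𝓗 f :=
  coupling H L (cre n k)

theorem isCutoff_totalCut : IsCutoff (totalCut 𝓗 f) := by
  refine ⟨fun m n h x => ?_, tendsto_mapT_one norm_cut_le tendsto_cut, fun n x y => ?_⟩
  · rw [← mul_apply_eq_comp, totalCut, totalCut, mapT_mul, cut_mul_cut h, one_mul]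
  · rw [← ContinuousLinearMap.adjoint_inner_right, totalCut, adjoint_mapT, adjoint_cut, adjoint_one]

theorem isLadder_totalCre (k : f) : IsLadder (totalCut 𝓗 f) (totalCre 𝓗 k) ‖k‖ := by
  refine isLadder_of_mul (fun n => ?_) (fun m n h => ?_) fun m => ?_
  · rw [mul_comm]
    exact (norm_mapT_one_le _).trans (norm_cre_le n k)
  · simp only [totalCre, totalCut, mapT_mul, cre_mul_cut h]
  · simp only [totalCre, totalCut, mapT_mul, cre_mul_cut_self, one_mul, cut_succ_mul_cre]

theorem totalCre_mul_totalCut (k : f) (n : ℕ) : totalCre 𝓗 k n * totalCut 𝓗 f n = totalCre 𝓗 k n := by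
  rw [totalCre, totalCut, mapT_mul, cre_mul_cut_self, one_mul]

theorem isLadder_totalInt (H L : 𝓗 →L[ℂ] 𝓗) (k : f) :
    IsLadder (totalCut 𝓗 f) (totalInt H L k) (‖H‖ + 2 * ‖L‖ * ‖k‖) := by
  refine isLadder_of_mul (fun n => ?_) (fun m n h => coupling_mul_congr H L (cre_mul_cut h k)
    (ann_mul_cut h k)) fun m => mul_coupling_mul H L (cut_succ_mul_cre m k) (cut_succ_mul_ann m k)
    (cut_mul_cut (Nat.le_succ m))
  -- The term H⊗1 does not grow with n and is absorbed by the factor √(n + 1) ≥ 1.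
  have h1 : 1 ≤ Real.sqrt ((n : ℝ) + 1) := by
    rw [Real.one_le_sqrt]; linarith [Nat.cast_nonneg (α := ℝ) n]
  refine (norm_coupling_le H L (cre n k)).trans ?_
  have h2 := mul_le_mul_of_nonneg_left (norm_cre_le n k) (show 0 ≤ 2 * ‖L‖ by positivity)
  have h3 := mul_le_mul_of_nonneg_left h1 (norm_nonneg H)
  linarith

theorem continuous_cre (n : ℕ) : Continuous fun k : f => cre n k :=
  (LinearMap.mkContinuous (σ := RingHom.id ℂ) ⟨⟨fun k : f => cre n k, cre_add n⟩, cre_smul n⟩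
    (Real.sqrt (n + 1)) fun k => norm_cre_le n k).continuous

theorem isInteraction_totalInt {H : 𝓗 →L[ℂ] 𝓗} (hH : IsSelfAdjoint H) (L : 𝓗 →L[ℂ] 𝓗) {k : ℝ → f}
    (hk : Continuous k) {C : ℝ} (hC : ∀ s, ‖k s‖ = C) :
    IsInteraction (totalCut 𝓗 f) (fun s => totalInt H L (k s)) (‖H‖ + 2 * ‖L‖ * C) := by
  refine ⟨fun s => hC s ▸ isLadder_totalInt H L (k s),
    fun n => (continuous_coupling H L).comp ((continuous_cre n).comp hk), fun s n x y => ?_⟩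
  rw [← ContinuousLinearMap.adjoint_inner_right, totalInt, adjoint_coupling hH]

/-- The key commutator: unbounded interaction and unbounded creation differ, on finite-particle
vectors, by the bounded operator -i⟪g, k⟫L*⊗1. The margin n + 1 ≤ M keeps the cutoff invisible. -/
theorem totalInt_totalCre_sub (H L : 𝓗 →L[ℂ] 𝓗) (g k : f) {n M : ℕ} (h : n + 1 ≤ M)
    {x : Total 𝓗 f} (hx : totalCut 𝓗 f n x = x) :
    totalInt H L g M (totalCre 𝓗 k M x) - totalCre 𝓗 k M (totalInt H L g M x) =
      -Complex.I • (⟪g, k⟫_ℂ • mapT (ContinuousLinearMap.adjoint L) (1 : Fock f →L[ℂ] Fock f)) x := by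
  have h2 := congrArg (fun S => S x) (coupling_commutator H L (cre_mul_cre_mul_cut h g k)
    (ann_mul_cre_sub h g k))
  change totalInt H L g M (totalCre 𝓗 k M (totalCut 𝓗 f n x)) -
    totalCre 𝓗 k M (totalInt H L g M (totalCut 𝓗 f n x)) = -Complex.I • (⟪g, k⟫_ℂ •
      mapT (ContinuousLinearMap.adjoint L) (1 : Fock f →L[ℂ] Fock f)) (totalCut 𝓗 f n x) at h2
  rwa [hx] at h2

theorem fockGroup_mul_ann {h : f →ₗ.[ℂ] f} {u : ℝ → f →L[ℂ] f} (hu : IsUnitaryGroupOf h u) (t : ℝ)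
    (N : ℕ) (g : f) : fockGroup hu.isUnitaryGroup t * ann N g =
      ann N (u t g) * fockGroup hu.isUnitaryGroup t := by
  refine (isUnitaryGroup_fockGroup hu).mul_adjoint ?_
  rw [fockGroup_mul_cre, hu.isUnitaryGroup.apply_neg_apply]

variable (𝓗) in
/-- The free evolution of system and bath. -/
def freeGroup {u : ℝ → f →L[ℂ] f} (hu : IsUnitaryGroup u) (t : ℝ) : Total 𝓗 f →L[ℂ] Total 𝓗 f :=
  mapT 1 (fockGroup hu t)

theorem isUnitaryGroupOf_freeGroup {h : f →ₗ.[ℂ] f} {u : ℝ → f →L[ℂ] f}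
    (hu : IsUnitaryGroupOf h u) : IsUnitaryGroupOf (freeHam 𝓗 h) (freeGroup 𝓗 hu.isUnitaryGroup) :=
  isUnitaryGroupOf_tensorOp_closure (isUnitaryGroupOf_secondQuant hu)

theorem freeGroup_mul_totalCut {u : ℝ → f →L[ℂ] f} (hu : IsUnitaryGroup u) (t : ℝ) (n : ℕ) :
    freeGroup 𝓗 hu t * totalCut 𝓗 f n = totalCut 𝓗 f n * freeGroup 𝓗 hu t := by
  rw [freeGroup, totalCut, mapT_mul, mapT_mul, fockGroup_mul_cut]

theorem freeGroup_mul_totalInt {h : f →ₗ.[ℂ] f} {u : ℝ → f →L[ℂ] f} (hu : IsUnitaryGroupOf h u)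
    (H L : 𝓗 →L[ℂ] 𝓗) (t : ℝ) (k : f) (n : ℕ) :
    freeGroup 𝓗 hu.isUnitaryGroup t * totalInt H L k n =
      totalInt H L (u t k) n * freeGroup 𝓗 hu.isUnitaryGroup t :=
  mul_coupling_congr H L (fockGroup_mul_cre hu.isUnitaryGroup t n k) (fockGroup_mul_ann hu t n k) rfl

theorem freeGroup_mul_totalCre {u : ℝ → f →L[ℂ] f} (hu : IsUnitaryGroup u) (t : ℝ) (k : f) (n : ℕ) :
    freeGroup 𝓗 hu t * totalCre 𝓗 k n = totalCre 𝓗 (u t k) n * freeGroup 𝓗 hu t := by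
  rw [freeGroup, totalCre, totalCre, mapT_mul, mapT_mul, fockGroup_mul_cre]

/-- In the interaction picture only g moves, to g_s = u(-s)g, because H and L commute with the free
evolution. Its norm is constant, so one ladder constant serves all times. -/
theorem isPerturbation_totalInt {H : 𝓗 →L[ℂ] 𝓗} (hH : IsSelfAdjoint H) (L : 𝓗 →L[ℂ] 𝓗)
    {h : f →ₗ.[ℂ] f} {u : ℝ → f →L[ℂ] f} (hu : IsUnitaryGroupOf h u) (g : f) :
    IsPerturbation (totalCut 𝓗 f) (freeHam 𝓗 h) (freeGroup 𝓗 hu.isUnitaryGroup) (totalInt H L g)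
      (fun s => totalInt H L (u (-s) g)) (‖H‖ + 2 * ‖L‖ * ‖g‖) where
  cutoff := isCutoff_totalCut
  group := isUnitaryGroupOf_freeGroup hu
  comm t n x := by
    rw [← mul_apply_eq_comp, freeGroup_mul_totalCut, mul_apply_eq_comp]
  interaction := isInteraction_totalInt hH L
    (hu.isUnitaryGroup.continuous_comp continuous_neg continuous_const)
    fun s => hu.isUnitaryGroup.norm_apply _ _
  covariant s n x := by
    rw [← mul_apply_eq_comp, freeGroup_mul_totalInt hu, hu.isUnitaryGroup.apply_apply_neg,
      mul_apply_eq_comp]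

/-- The adjoint of a creation operator is covariant under the free evolution. -/
theorem IsAdjointPair.freeGroup {u : ℝ → f →L[ℂ] f} {h : f →ₗ.[ℂ] f} (hu : IsUnitaryGroupOf h u)
    {k : f} {ψ w : Total 𝓗 f} (hp : IsAdjointPair (totalCut 𝓗 f) (totalCre 𝓗 k) ψ w) (t : ℝ) :
    IsAdjointPair (totalCut 𝓗 f) (totalCre 𝓗 (u t k))
      (OpenSystem.freeGroup 𝓗 hu.isUnitaryGroup t ψ)
      (OpenSystem.freeGroup 𝓗 hu.isUnitaryGroup t w) := by
  intro n
  have hΓ := (isUnitaryGroupOf_freeGroup (𝓗 := 𝓗) hu).isUnitaryGroup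
  have h1 := hΓ.mul_adjoint (t := t) (S := totalCre 𝓗 k n) (T := totalCre 𝓗 (u t k) n) (by
    rw [freeGroup_mul_totalCre, hu.isUnitaryGroup.apply_neg_apply])
  have h2 := congrArg (fun S => S ψ) h1
  have h3 := congrArg (fun S => S w) (freeGroup_mul_totalCut (𝓗 := 𝓗) hu.isUnitaryGroup t n)
  simp only [mul_apply_eq_comp, hp n] at h2 h3
  exact h2.symm.trans h3

end Coupling


/-! ### Formally adjoint operators -/

section FormalAdjoint

variable {E : Type*} [NormedAddCommGroup E] [InnerProductSpace ℂ E]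
variable {F : Type*} [NormedAddCommGroup F] [InnerProductSpace ℂ F]

open Filter Topology

theorem mem_adjoint_graph {K : Submodule ℂ (E × E)} {x y : E} :
    (x, y) ∈ K.adjoint ↔ ∀ a b, (a, b) ∈ K → ⟪b, x⟫_ℂ = ⟪a, y⟫_ℂ := by
  simp only [Submodule.mem_adjoint_iff, sub_eq_zero]

theorem isClosed_adjoint (K : Submodule ℂ (E × E)) : IsClosed (K.adjoint : Set (E × E)) := by
  rw [Submodule.adjoint, Submodule.map_coe, LinearEquiv.coe_coe, LinearEquiv.image_eq_preimage_symm]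
  exact (Submodule.isClosed_orthogonal _).preimage (WithLp.prod_continuous_toLp _ _ _)

theorem le_adjoint_comm {K K' : Submodule ℂ (E × E)} (h : K ≤ K'.adjoint) : K' ≤ K.adjoint := by
  rintro ⟨x, y⟩ hxy
  refine mem_adjoint_graph.2 fun a b hab => ?_
  have := mem_adjoint_graph.1 (h hab) x y hxy
  rw [← inner_conj_symm b x, ← inner_conj_symm a y, this]

/-- The closure of the graph stays in the closed adjoint relation, where a pair (0, y) forces y to
be orthogonal to the dense domain of S'. -/
theorem isClosable_of_le_adjoint {S S' : E →ₗ.[ℂ] E} (h : S.graph ≤ S'.graph.adjoint)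
    (hD : Dense (S'.domain : Set E)) : S.IsClosable := by
  have h1 : S.graph.topologicalClosure ≤ S'.graph.adjoint :=
    Submodule.topologicalClosure_minimal _ h (isClosed_adjoint _)
  refine ⟨S.graph.topologicalClosure.toLinearPMap, (Submodule.toLinearPMap_graph_eq _ ?_).symm⟩
  rintro ⟨x, y⟩ hp rfl
  refine hD.eq_zero_of_inner_right ℂ fun a ha => ?_
  obtain ⟨b, hb⟩ := LinearPMap.mem_domain_iff.1 ha
  have := mem_adjoint_graph.1 (h1 hp) a b hb
  rw [← this]
  exact inner_zero_right _

theorem closure_graph_le_adjoint {S : E →ₗ.[ℂ] E} (h : S.graph ≤ S.graph.adjoint)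
    (hS : S.IsClosable) : S.closure.graph ≤ S.closure.graph.adjoint := by
  rw [← hS.graph_closure_eq_closure_graph]
  refine Submodule.topologicalClosure_minimal _ (le_adjoint_comm ?_) (isClosed_adjoint _)
  exact Submodule.topologicalClosure_minimal _ h (isClosed_adjoint _)

/-- Formal adjointness is checked on pure tensors in one argument at a time; `le_adjoint_comm`
exchanges the arguments between the two reductions. -/
theorem tensorOp_graph_le_adjoint {A A' : E →ₗ.[ℂ] E} {B B' : F →ₗ.[ℂ] F}
    (hA : A.graph ≤ A'.graph.adjoint) (hB : B.graph ≤ B'.graph.adjoint) :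
    (tensorOp A B).graph ≤ (tensorOp A' B').graph.adjoint := by
  refine tensorOp_graph_le fun x x' y y' hx hy => ?_
  have h1 : (tensorOp A' B').graph ≤ (ℂ ∙ (ht x y, ht x' y')).adjoint :=
    tensorOp_graph_le fun a a' b b' ha hb => by
      refine mem_adjoint_graph.2 fun p q hpq => ?_
      obtain ⟨c, hc⟩ := Submodule.mem_span_singleton.1 hpq
      obtain ⟨rfl, rfl⟩ := Prod.mk.inj hc
      have h2 := mem_adjoint_graph.1 (le_adjoint_comm hA ha) _ _ hx
      have h3 := mem_adjoint_graph.1 (le_adjoint_comm hB hb) _ _ hy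
      rw [inner_smul_left, inner_smul_left, inner_ht, inner_ht, h2, h3]
  exact le_adjoint_comm h1 (Submodule.mem_span_singleton_self _)

theorem bdd_graph_le_adjoint [CompleteSpace E] (X : E →L[ℂ] E) :
    (bdd X).graph ≤ (bdd (ContinuousLinearMap.adjoint X)).graph.adjoint := by
  rintro ⟨x, y⟩ hxy
  obtain rfl := mem_graph_bdd.1 hxy
  refine mem_adjoint_graph.2 fun a b hab => ?_
  obtain rfl := mem_graph_bdd.1 hab
  exact ContinuousLinearMap.adjoint_inner_left _ _ _

theorem dense_domain_of_ht {D : Set F} (hD : (Submodule.span ℂ D).topologicalClosure = ⊤)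
    {S : HTensor E F →ₗ.[ℂ] HTensor E F} (h : ∀ x, ∀ y ∈ D, ht x y ∈ S.domain) :
    Dense (S.domain : Set (HTensor E F)) := by
  refine Submodule.dense_iff_topologicalClosure_eq_top.2 (top_le_iff.1 ?_)
  rw [← span_ht_eq_top (E := E) span_univ_closure hD]
  refine Submodule.topologicalClosure_mono (Submodule.span_le.2 ?_)
  rintro _ ⟨x, -, y, hy, rfl⟩
  exact h x y hy

theorem tensorOp_bdd_one_isClosable [CompleteSpace E] {B B' : F →ₗ.[ℂ] F}
    (hB : B.graph ≤ B'.graph.adjoint) (hD : Dense (B'.domain : Set F)) :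
    (tensorOp (bdd (1 : E →L[ℂ] E)) B).IsClosable := by
  have h1 := bdd_graph_le_adjoint (1 : E →L[ℂ] E)
  rw [adjoint_one] at h1
  refine isClosable_of_le_adjoint (tensorOp_graph_le_adjoint h1 hB)
    (dense_domain_of_ht (D := (B'.domain : Set F)) ?_ fun x y hy => mem_domain_of_ht Submodule.mem_top hy)
  rw [Submodule.span_eq]
  exact Submodule.dense_iff_topologicalClosure_eq_top.1 hD

theorem mem_graph_conjOp [CompleteSpace E] {U : E →L[ℂ] E} (hU : U ∈ unitary (E →L[ℂ] E))
    {Z : E →ₗ.[ℂ] E} {x y : E} : (x, y) ∈ (conjOp U Z).graph ↔ (U x, U y) ∈ Z.graph := by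
  have h1 : ∀ z, ContinuousLinearMap.adjoint U (U z) = z := fun z => by
    have := congrArg (fun S => S z) (Unitary.mem_iff.1 hU).1
    exact this
  have h2 : ∀ z, U (ContinuousLinearMap.adjoint U z) = z := fun z => by
    have := congrArg (fun S => S z) (Unitary.mem_iff.1 hU).2
    exact this
  rw [LinearPMap.mem_graph_iff', LinearPMap.mem_graph_iff']
  constructor
  · rintro ⟨z, hz⟩
    obtain ⟨rfl, rfl⟩ := Prod.mk.inj hz
    exact ⟨⟨U z, z.2⟩, Prod.ext rfl (h2 _).symm⟩
  · rintro ⟨z, hz⟩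
    obtain ⟨hz1, hz2⟩ := Prod.mk.inj hz
    have hm : U x ∈ Z.domain := hz1 ▸ z.2
    refine ⟨⟨x, hm⟩, Prod.ext rfl ?_⟩
    change ContinuousLinearMap.adjoint U (Z ⟨U x, hm⟩) = y
    have : z = ⟨U x, hm⟩ := Subtype.ext hz1
    rw [← this, hz2, h1]

/-- For unitary U, (U*ZU)* = U*Z*U; the domain of U*ZU is the image under U* of a dense set, so both
adjoints are genuine. -/
theorem mem_graph_adjoint_conjOp [CompleteSpace E] {U : E →L[ℂ] E} (hU : U ∈ unitary (E →L[ℂ] E))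
    {Z : E →ₗ.[ℂ] E} (hZ : Dense (Z.domain : Set E)) {x y : E} :
    (x, y) ∈ (conjOp U Z)†.graph ↔ (U x, U y) ∈ Z†.graph := by
  have h2 : ∀ z, U (ContinuousLinearMap.adjoint U z) = z := fun z => by
    have := congrArg (fun S => S z) (Unitary.mem_iff.1 hU).2
    exact this
  have hD : Dense ((conjOp U Z).domain : Set E) := by
    have h3 : Function.Surjective (ContinuousLinearMap.adjoint U) := fun z => ⟨U z, by
      have := congrArg (fun S => S z) (Unitary.mem_iff.1 hU).1
      exact this⟩
    refine (h3.denseRange.dense_image (ContinuousLinearMap.adjoint U).continuous hZ).mono ?_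
    rintro _ ⟨z, hz, rfl⟩
    change U (ContinuousLinearMap.adjoint U z) ∈ Z.domain
    rwa [h2]
  rw [mem_graph_adjoint_iff hD, mem_graph_adjoint_iff hZ]
  constructor
  · intro h a b hab
    have h3 := h (ContinuousLinearMap.adjoint U a) (ContinuousLinearMap.adjoint U b)
      ((mem_graph_conjOp hU).2 (by rwa [h2, h2]))
    rwa [ContinuousLinearMap.adjoint_inner_right, ContinuousLinearMap.adjoint_inner_right] at h3
  · intro h a b hab
    have h3 := h _ _ ((mem_graph_conjOp hU).1 hab)
    rwa [inner_apply_apply_of_mem_unitary hU, inner_apply_apply_of_mem_unitary hU] at h3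

/-- The projections `Q n` preserve the graph of the generator of a unitary group commuting with
them. -/
theorem apply_eq_of_mem_graph [CompleteSpace E] {A : E →ₗ.[ℂ] E} {U : ℝ → E →L[ℂ] E}
    (hU : IsUnitaryGroupOf A U) {P : E →L[ℂ] E} (hP : ∀ t, U t * P = P * U t) {x y : E}
    (h : (x, y) ∈ A.graph) (hx : P x = x) : P y = y := by
  have h1 := (hU.generator x y).1 h
  have h2 := (P.restrictScalars ℝ).hasFDerivAt.comp_hasDerivAt 0 h1
  have h3 : HasDerivAt (fun t => U t x) (-Complex.I • P y) 0 := by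
    refine (h2.congr_deriv (map_smul P _ _)).congr_of_eventuallyEq (Eventually.of_forall fun t => ?_)
    have := congrArg (fun S => S x) (hP t)
    simp only [mul_apply_eq_comp, hx] at this
    exact this
  have h4 := (hU.generator x (P y)).2 h3
  exact A.mem_graph_snd_inj h4 h rfl

/-- Graph membership on pure tensors extends to all vectors. -/
theorem mem_graph_of_ht {G : Type*} [NormedAddCommGroup G] [NormedSpace ℂ G]
    {K : Submodule ℂ (G × G)} (hK : IsClosed (K : Set (G × G))) {S T : HTensor E F →L[ℂ] G}
    (h : ∀ x y, (S (ht x y), T (ht x y)) ∈ K) (z : HTensor E F) : (S z, T z) ∈ K := by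
  have h1 : (Submodule.span ℂ (Set.image2 (ht (E := E) (F := F)) Set.univ Set.univ)).topologicalClosure
      ≤ K.comap (S.prod T).toLinearMap := by
    refine Submodule.topologicalClosure_minimal _ (Submodule.span_le.2 ?_)
      (hK.preimage (S.prod T).continuous)
    rintro _ ⟨x, -, y, -, rfl⟩
    exact h x y
  rw [span_ht_eq_top span_univ_closure span_univ_closure] at h1
  exact h1 Submodule.mem_top

end FormalAdjoint


/-! ### The total Hamiltonian and the input process -/

section Generic

variable {E : Type*} [NormedAddCommGroup E] [InnerProductSpace ℂ E]

/-- The map `(x, y) ↦ (Q x, Q y + W Q x)`. -/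
def cutShear (Q W : E →L[ℂ] E) : E × E →L[ℂ] E × E :=
  (Q ∘L ContinuousLinearMap.fst ℂ E E).prod
    (Q ∘L ContinuousLinearMap.snd ℂ E E + W ∘L Q ∘L ContinuousLinearMap.fst ℂ E E)

theorem closure_graph_le_comap {S A : E →ₗ.[ℂ] E} (hS : S.IsClosable) (hA : A.IsClosed)
    {M : E × E →L[ℂ] E × E} (h : S.graph ≤ A.graph.comap M.toLinearMap) :
    S.closure.graph ≤ A.graph.comap M.toLinearMap := by
  rw [← hS.graph_closure_eq_closure_graph]
  have hA' : IsClosed (A.graph : Set (E × E)) := hA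
  exact Submodule.topologicalClosure_minimal _ h (hA'.preimage M.continuous)

theorem closure_graph_le_singleton_adjoint {S : E →ₗ.[ℂ] E} (hS : S.IsClosable) {ψ w : E}
    (h : S.graph ≤ (ℂ ∙ (ψ, w)).adjoint) {a b : E} (hab : (a, b) ∈ S.closure.graph) :
    ⟪w, a⟫_ℂ = ⟪ψ, b⟫_ℂ := by
  rw [← hS.graph_closure_eq_closure_graph] at hab
  exact mem_adjoint_graph.1 (Submodule.topologicalClosure_minimal _ h (isClosed_adjoint _) hab) ψ w
    (Submodule.mem_span_singleton_self _)

theorem mem_singleton_adjoint {ψ w a b : E} (h : ⟪w, a⟫_ℂ = ⟪ψ, b⟫_ℂ) :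
    (a, b) ∈ (ℂ ∙ (ψ, w)).adjoint := by
  refine mem_adjoint_graph.2 fun p q hpq => ?_
  obtain ⟨c, hc⟩ := Submodule.mem_span_singleton.1 hpq
  obtain ⟨rfl, rfl⟩ := Prod.mk.inj hc
  rw [inner_smul_left, inner_smul_left, h]

/-- If C and D are formally adjoint, then iC - iD is symmetric, the cross terms pairing C with D. -/
theorem sum_graph_le_adjoint {A B C D : E →ₗ.[ℂ] E} (hA : A.graph ≤ A.graph.adjoint)
    (hB : B.graph ≤ B.graph.adjoint) (hC : C.graph ≤ D.graph.adjoint) :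
    (A + B + Complex.I • C - Complex.I • D).graph ≤
      (A + B + Complex.I • C - Complex.I • D).graph.adjoint := by
  have key : ∀ x y, (x, y) ∈ (A + B + Complex.I • C - Complex.I • D).graph → ∃ a b c d,
      (x, a) ∈ A.graph ∧ (x, b) ∈ B.graph ∧ (x, c) ∈ C.graph ∧ (x, d) ∈ D.graph ∧
      y = a + b + Complex.I • c - Complex.I • d := fun x y h => by
    obtain ⟨y₁, y₂, h1, h2, rfl⟩ := mem_graph_sub.1 h
    obtain ⟨y₃, y₄, h3, h4, rfl⟩ := mem_graph_add.1 h1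
    obtain ⟨a, b, ha, hb, rfl⟩ := mem_graph_add.1 h3
    obtain ⟨c, hc, rfl⟩ := mem_graph_smul.1 h4
    obtain ⟨d, hd, rfl⟩ := mem_graph_smul.1 h2
    exact ⟨a, b, c, d, ha, hb, hc, hd, rfl⟩
  rintro ⟨x, y⟩ hxy
  refine mem_adjoint_graph.2 fun x' y' hxy' => ?_
  obtain ⟨a, b, c, d, ha, hb, hc, hd, rfl⟩ := key _ _ hxy
  obtain ⟨a', b', c', d', ha', hb', hc', hd', rfl⟩ := key _ _ hxy'
  have h1 := mem_adjoint_graph.1 (hA ha) _ _ ha'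
  have h2 := mem_adjoint_graph.1 (hB hb) _ _ hb'
  have h3 := mem_adjoint_graph.1 (hC hc) _ _ hd'
  have h4 := mem_adjoint_graph.1 (le_adjoint_comm hC hd) _ _ hc'
  simp only [inner_sub_left, inner_sub_right, inner_add_left, inner_add_right, inner_smul_left,
    inner_smul_right, Complex.conj_I]
  linear_combination h1 + h2 + Complex.I * h3 - Complex.I * h4

theorem mem_graph_sum {A B C D : E →ₗ.[ℂ] E} {x a b c d y : E} (ha : (x, a) ∈ A.graph)
    (hb : (x, b) ∈ B.graph) (hc : (x, c) ∈ C.graph) (hd : (x, d) ∈ D.graph)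
    (hy : y = a + b + Complex.I • c - Complex.I • d) :
    (x, y) ∈ (A + B + Complex.I • C - Complex.I • D).graph :=
  mem_graph_sub.2 ⟨_, _, mem_graph_add.2 ⟨_, _, mem_graph_add.2 ⟨_, _, ha, hb, rfl⟩,
    mem_graph_smul.2 ⟨_, hc, rfl⟩, rfl⟩, mem_graph_smul.2 ⟨_, hd, rfl⟩, hy⟩

end Generic

/-! ### Closedness and symmetry of the total Hamiltonian; adjoint of the input process -/

section Hamiltonian

universe w w'
variable {𝓗 : Type w} [NormedAddCommGroup 𝓗] [InnerProductSpace ℂ 𝓗] [CompleteSpace 𝓗]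
variable {f : Type w'} [NormedAddCommGroup f] [InnerProductSpace ℂ f] [CompleteSpace f]

open MeasureTheory Filter Topology

theorem creation_graph_le_adjoint (g : f) :
    (creation g).graph ≤ (annihilation g).graph.adjoint := by
  rintro ⟨φ, ψ⟩ h
  exact mem_adjoint_graph.2 fun a b hab => mem_graph_annihilation.1 hab _ _ h

theorem secondQuant_graph_le_adjoint {h : f →ₗ.[ℂ] f} {u : ℝ → f →L[ℂ] f}
    (hu : IsUnitaryGroupOf h u) : (secondQuant h).graph ≤ (secondQuant h).graph.adjoint := by
  rintro ⟨φ, ψ⟩ hp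
  exact mem_adjoint_graph.2 fun a b hab =>
    (isUnitaryGroupOf_secondQuant hu).isSymmSurj.symm _ _ _ _ hab hp

theorem dense_domain_annihilation (g : f) : Dense ((annihilation g).domain : Set (Fock f)) :=
  dense_domain_of_cut fun N φ =>
    LinearPMap.mem_domain_of_mem_graph (cut_mem_graph_annihilation g N φ)

/-- The total Hamiltonian before taking the closure. -/
def preHam (H L : 𝓗 →L[ℂ] 𝓗) (h : f →ₗ.[ℂ] f) (g : f) : Total 𝓗 f →ₗ.[ℂ] Total 𝓗 f :=
  tensorOp (bdd H) (bdd 1) + tensorOp (bdd 1) (secondQuant h)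
    + Complex.I • tensorOp (bdd L) (creation g)
    - Complex.I • tensorOp (bdd (ContinuousLinearMap.adjoint L)) (annihilation g)

/-- Cutting a vector of the domain of dΓ(h) at n particles keeps it there and puts it in the domains
of a(g)* and a(g). Such vectors supply the dense common domain. -/
theorem ht_cut_mem_graph_preHam (H L : 𝓗 →L[ℂ] 𝓗) {h : f →ₗ.[ℂ] f} (g : f) (x : 𝓗) {φ φ' : Fock f}
    (hφ : (φ, φ') ∈ (secondQuant h).graph) (n : ℕ) :
    (ht x (cut _ n φ), ht x (cut _ n φ') + totalInt H L g n (ht x (cut _ n φ))) ∈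
      (preHam H L h g).graph := by
  refine mem_graph_sum (ht_mem_tensorOp_graph (mem_graph_bdd.2 rfl) (mem_graph_bdd.2 rfl))
    (ht_mem_tensorOp_graph (mem_graph_bdd.2 rfl) (cut_mem_graph_secondQuant hφ n))
    (ht_mem_tensorOp_graph (mem_graph_bdd.2 rfl) (cut_mem_graph_creation g n φ))
    (ht_mem_tensorOp_graph (mem_graph_bdd.2 rfl) (cut_mem_graph_annihilation g n φ)) ?_
  have h1 : cre n g (cut _ n φ) = cre n g φ := congrArg (fun S => S φ) (cre_mul_cut_self n g)
  rw [totalInt, coupling_ht, h1, one_apply_eq_self, one_apply_eq_self, ann]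
  abel

theorem preHam_isClosable {H : 𝓗 →L[ℂ] 𝓗} (hH : IsSelfAdjoint H) (L : 𝓗 →L[ℂ] 𝓗)
    {h : f →ₗ.[ℂ] f} {u : ℝ → f →L[ℂ] f} (hu : IsUnitaryGroupOf h u) (g : f) :
    (preHam H L h g).graph ≤ (preHam H L h g).graph.adjoint ∧ (preHam H L h g).IsClosable := by
  have hH1 := bdd_graph_le_adjoint H
  rw [show ContinuousLinearMap.adjoint H = H from hH] at hH1
  have hle : (preHam H L h g).graph ≤ (preHam H L h g).graph.adjoint := by
    refine sum_graph_le_adjoint (tensorOp_graph_le_adjoint hH1 ?_)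
      (tensorOp_graph_le_adjoint ?_ (secondQuant_graph_le_adjoint hu))
      (tensorOp_graph_le_adjoint (bdd_graph_le_adjoint L) (creation_graph_le_adjoint g))
    · have := bdd_graph_le_adjoint (1 : Fock f →L[ℂ] Fock f)
      rwa [adjoint_one] at this
    · have := bdd_graph_le_adjoint (1 : 𝓗 →L[ℂ] 𝓗)
      rwa [adjoint_one] at this
  refine ⟨hle, isClosable_of_le_adjoint hle (dense_domain_of_ht
    (D := {ψ | ∃ N, ∃ φ ∈ (secondQuant h).domain, cut _ N φ = ψ}) ?_ ?_)⟩
  · refine Submodule.dense_iff_topologicalClosure_eq_top.1 (Dense.mono Submodule.subset_span ?_)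
    have hd := (isUnitaryGroupOf_secondQuant hu).isSymmSurj.dense_domain
    refine dense_closure.1 (hd.mono fun φ hφ => ?_)
    exact mem_closure_of_tendsto (tendsto_cut φ) (Eventually.of_forall fun N => ⟨N, φ, hφ, rfl⟩)
  · rintro x _ ⟨N, φ, hφ, rfl⟩
    obtain ⟨φ', hφ'⟩ := LinearPMap.mem_domain_iff.1 hφ
    exact LinearPMap.mem_domain_of_mem_graph (ht_cut_mem_graph_preHam H L g x hφ' N)

theorem totalHam_isClosed {H : 𝓗 →L[ℂ] 𝓗} (hH : IsSelfAdjoint H) (L : 𝓗 →L[ℂ] 𝓗)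
    {h : f →ₗ.[ℂ] f} {u : ℝ → f →L[ℂ] f} (hu : IsUnitaryGroupOf h u) (g : f) :
    (totalHam H L h g).IsClosed :=
  (preHam_isClosable hH L hu g).2.closure_isClosed

theorem totalHam_symm {H : 𝓗 →L[ℂ] 𝓗} (hH : IsSelfAdjoint H) (L : 𝓗 →L[ℂ] 𝓗)
    {h : f →ₗ.[ℂ] f} {u : ℝ → f →L[ℂ] f} (hu : IsUnitaryGroupOf h u) (g : f) (x y x' y' : Total 𝓗 f)
    (hxy : (x, y) ∈ (totalHam H L h g).graph) (hxy' : (x', y') ∈ (totalHam H L h g).graph) :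
    ⟪y, x'⟫_ℂ = ⟪x, y'⟫_ℂ :=
  mem_adjoint_graph.1 (closure_graph_le_adjoint (preHam_isClosable hH L hu g).1
    (preHam_isClosable hH L hu g).2 hxy') _ _ hxy

/-- On vectors of finite particle number, the total Hamiltonian is the sum of the free Hamiltonian
and the bounded interaction. -/
theorem mem_graph_totalHam {H : 𝓗 →L[ℂ] 𝓗} (hH : IsSelfAdjoint H) (L : 𝓗 →L[ℂ] 𝓗)
    {h : f →ₗ.[ℂ] f} {u : ℝ → f →L[ℂ] f} (hu : IsUnitaryGroupOf h u) (g : f) (n : ℕ)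
    (x y : Total 𝓗 f) (hx : totalCut 𝓗 f n x = x) (hxy : (x, y) ∈ (freeHam 𝓗 h).graph) :
    (x, y + totalInt H L g n x) ∈ (totalHam H L h g).graph := by
  have hU := isUnitaryGroupOf_freeGroup (𝓗 := 𝓗) hu
  have hy := apply_eq_of_mem_graph hU
    (fun t => freeGroup_mul_totalCut (𝓗 := 𝓗) hu.isUnitaryGroup t n) hxy hx
  -- The shear (x, y) ↦ (Qx, Qy + WQx) is continuous and sends pure tensors in the graph of 1⊗dΓ(h)
  -- into the closed graph of H_Tot, so it sends the closure there too. It acts as addition of W x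
  -- when Q fixes x and y.
  have h1 := closure_graph_le_comap (M := cutShear (totalCut 𝓗 f n) (totalInt H L g n))
    (tensorOp_bdd_one_isClosable (E := 𝓗) (secondQuant_graph_le_adjoint hu)
      (isUnitaryGroupOf_secondQuant hu).isSymmSurj.dense_domain) (totalHam_isClosed hH L hu g)
    (tensorOp_graph_le fun a a' φ φ' ha hφ => by
      obtain rfl : a' = a := mem_graph_bdd.1 ha
      rw [Submodule.mem_comap]
      change (totalCut 𝓗 f n (ht a' φ), totalCut 𝓗 f n (ht a' φ') +
        totalInt H L g n (totalCut 𝓗 f n (ht a' φ))) ∈ _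
      rw [totalCut, mapT_ht, mapT_ht]
      exact LinearPMap.le_graph_of_le (preHam H L h g).le_closure
        (ht_cut_mem_graph_preHam H L g a' hφ n)) hxy
  rw [Submodule.mem_comap] at h1
  change (totalCut 𝓗 f n x, totalCut 𝓗 f n y + totalInt H L g n (totalCut 𝓗 f n x)) ∈ _ at h1
  rwa [hx, hy] at h1

theorem tensorOp_creation_isClosable (k : f) :
    (tensorOp (bdd (1 : 𝓗 →L[ℂ] 𝓗)) (creation k)).IsClosable :=
  tensorOp_bdd_one_isClosable (creation_graph_le_adjoint k) (dense_domain_annihilation k)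

theorem cut_mem_graph_tensorOp_creation (k : f) (n : ℕ) (z : Total 𝓗 f) :
    (totalCut 𝓗 f n z, totalCre 𝓗 k n z) ∈
      (tensorOp (bdd (1 : 𝓗 →L[ℂ] 𝓗)) (creation k)).closure.graph := by
  refine mem_graph_of_ht (tensorOp_creation_isClosable k).closure_isClosed (fun x φ => ?_) z
  rw [totalCut, totalCre, mapT_ht, mapT_ht]
  exact LinearPMap.le_graph_of_le (LinearPMap.le_closure _)
    (ht_mem_tensorOp_graph (mem_graph_bdd.2 rfl) (cut_mem_graph_creation k n φ))

theorem dense_domain_tensorOp_creation (k : f) :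
    Dense ((tensorOp (bdd (1 : 𝓗 →L[ℂ] 𝓗)) (creation k)).closure.domain : Set (Total 𝓗 f)) :=
  fun z => mem_closure_of_tendsto (isCutoff_totalCut.tendsto z) (Eventually.of_forall fun n =>
    LinearPMap.mem_domain_of_mem_graph (cut_mem_graph_tensorOp_creation k n z))

/-- Finite-particle vectors form a core: cutting φ at n and a(k)*φ at n + 1 stays in the graph and
converges. The adjoint is therefore determined by the bounded truncations. -/
theorem mem_graph_adjoint_tensorOp_creation {k : f} {ψ w : Total 𝓗 f} :
    (ψ, w) ∈ (tensorOp (bdd (1 : 𝓗 →L[ℂ] 𝓗)) (creation k)).closure†.graph ↔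
      IsAdjointPair (totalCut 𝓗 f) (totalCre 𝓗 k) ψ w := by
  rw [mem_graph_adjoint_iff (dense_domain_tensorOp_creation k)]
  constructor
  · intro h n
    refine ext_inner_right ℂ fun z => ?_
    rw [ContinuousLinearMap.adjoint_inner_left, isCutoff_totalCut.symm]
    exact (h _ _ (cut_mem_graph_tensorOp_creation k n z)).symm
  · intro h a b hab
    refine closure_graph_le_singleton_adjoint (tensorOp_creation_isClosable k)
      (tensorOp_graph_le fun x x' φ φ' hx hφ => mem_singleton_adjoint ?_) hab
    obtain rfl : x' = x := mem_graph_bdd.1 hx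
    have h1 := (tendsto_const_nhds (x := w)).inner (𝕜 := ℂ) (isCutoff_totalCut.tendsto (ht x' φ))
    have h2 := ((tendsto_const_nhds (x := ψ)).inner (𝕜 := ℂ)
      -- The shift by one matches the level n + 1 of the image with the level n of the argument.
      (isCutoff_totalCut.tendsto (ht x' φ'))).comp (tendsto_add_atTop_nat 1)
    refine tendsto_nhds_unique h1 (h2.congr fun n => ?_)
    have h3 := cut_succ_of_mem_graph_creation hφ n
    simp only [Function.comp]
    rw [← isCutoff_totalCut.symm n w, ← h n, ContinuousLinearMap.adjoint_inner_left, totalCut, totalCre,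
      mapT_ht, mapT_ht, h3]

end Hamiltonian


/-! ### The input-output relation -/

section InputOutput

universe w w'
variable {𝓗 : Type w} [NormedAddCommGroup 𝓗] [InnerProductSpace ℂ 𝓗] [CompleteSpace 𝓗]
variable {f : Type w'} [NormedAddCommGroup f] [InnerProductSpace ℂ f] [CompleteSpace f]

open MeasureTheory Filter Topology

theorem gAt_eq {h : f →ₗ.[ℂ] f} {u : ℝ → f →L[ℂ] f} (hu : IsUnitaryGroupOf h u) (g : f) (t : ℝ) :
    gAt h g t = u (-t) g := by
  rw [gAt, expNegI_eq hu]

/-- The unitary group of the total Hamiltonian, whose interaction picture is given by the Dyson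
series on vectors of finite particle number. -/
theorem exists_totalGroup {H : 𝓗 →L[ℂ] 𝓗} (hH : IsSelfAdjoint H) (L : 𝓗 →L[ℂ] 𝓗)
    {h : f →ₗ.[ℂ] f} {u : ℝ → f →L[ℂ] f} (hu : IsUnitaryGroupOf h u) (g : f) :
    ∃ W : ℝ → Total 𝓗 f →L[ℂ] Total 𝓗 f, IsUnitaryGroup W ∧
      (∀ t, evol H L h g t = freeGroup 𝓗 hu.isUnitaryGroup (-t) * W t) ∧
      ∀ t m ξ, totalCut 𝓗 f m ξ = ξ →
        evol H L h g t ξ = dysonSum (fun s => totalInt H L (u (-s) g)) m ξ t := by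
  have hP := isPerturbation_totalInt hH L hu g
  have hcl := totalHam_isClosed hH L hu g
  have hA := mem_graph_totalHam hH L hu g
  -- The range property of the closed total Hamiltonian provides its group, so `evol` does not
  -- involve the default value of `expNegI`.
  obtain ⟨W, hW⟩ := (hP.isSymmSurj hcl (totalHam_symm hH L hu g) hA).exists_isUnitaryGroupOf
  have he : ∀ t, evol H L h g t = freeGroup 𝓗 hu.isUnitaryGroup (-t) * W t := fun t => by
    rw [evol, expNegI_eq hW, expNegI_eq (isUnitaryGroupOf_freeGroup hu)]
  refine ⟨W, hW.isUnitaryGroup, he, fun t m ξ hξ => ?_⟩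
  rw [he, mul_apply_eq_comp]
  exact hP.apply_eq_dysonSum hcl hA hW hξ t

variable {H : 𝓗 →L[ℂ] 𝓗} {h : f →ₗ.[ℂ] f} {u : ℝ → f →L[ℂ] f}

theorem evol_mem_unitary (hH : IsSelfAdjoint H) (L : 𝓗 →L[ℂ] 𝓗) (hu : IsUnitaryGroupOf h u) (g : f)
    (t : ℝ) : evol H L h g t ∈ unitary (Total 𝓗 f →L[ℂ] Total 𝓗 f) := by
  obtain ⟨W, hW, he, -⟩ := exists_totalGroup hH L hu g
  rw [he]
  exact mul_mem ((isUnitaryGroupOf_freeGroup hu).isUnitaryGroup.unitary _) (hW.unitary _)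

theorem continuous_evol (hH : IsSelfAdjoint H) (L : 𝓗 →L[ℂ] 𝓗) (hu : IsUnitaryGroupOf h u) (g : f)
    {x : ℝ → Total 𝓗 f} (hx : Continuous x) : Continuous fun s => evol H L h g s (x s) := by
  obtain ⟨W, hW, he, -⟩ := exists_totalGroup hH L hu g
  simp only [he, mul_apply_eq_comp]
  exact (isUnitaryGroupOf_freeGroup hu).isUnitaryGroup.continuous_comp continuous_neg
    (hW.continuous_comp continuous_id hx)

theorem continuous_adjoint_evol (hH : IsSelfAdjoint H) (L : 𝓗 →L[ℂ] 𝓗) (hu : IsUnitaryGroupOf h u)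
    (g : f) {x : ℝ → Total 𝓗 f} (hx : Continuous x) :
    Continuous fun s => ContinuousLinearMap.adjoint (evol H L h g s) (x s) := by
  obtain ⟨W, hW, he, -⟩ := exists_totalGroup hH L hu g
  have hΓ := (isUnitaryGroupOf_freeGroup (𝓗 := 𝓗) hu).isUnitaryGroup
  simp only [he, adjoint_mul, hW.adjoint_eq, hΓ.adjoint_eq, neg_neg, mul_apply_eq_comp]
  exact hW.continuous_comp continuous_neg (hΓ.continuous_comp continuous_id hx)

theorem continuous_heis (hH : IsSelfAdjoint H) (L : 𝓗 →L[ℂ] 𝓗) (hu : IsUnitaryGroupOf h u) (g : f)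
    (X : 𝓗 →L[ℂ] 𝓗) (ψ : Total 𝓗 f) : Continuous fun s => heis H L h g s X ψ :=
  continuous_adjoint_evol hH L hu g
    ((ampliation (Fock f) X).continuous.comp (continuous_evol hH L hu g continuous_const))

theorem continuous_gAt (hu : IsUnitaryGroupOf h u) (g : f) : Continuous fun s => gAt h g s := by
  simp only [gAt_eq hu]
  exact hu.isUnitaryGroup.continuous_comp continuous_neg continuous_const

/-- The Heisenberg lemma with R_s = ⟪g_s, k⟫L*⊗1, whose adjoint ⟪k, g_s⟫L⊗1 produces j_s(L). The
vector k is kept arbitrary because the reverse inclusion of domains uses it at k other than g_t. -/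
theorem isAdjointPair_evol (hH : IsSelfAdjoint H) (L : 𝓗 →L[ℂ] 𝓗) (hu : IsUnitaryGroupOf h u) (g k : f)
    {t : ℝ} {ψ w : Total 𝓗 f}
    (hp : IsAdjointPair (totalCut 𝓗 f) (totalCre 𝓗 k) (evol H L h g t ψ) w) :
    IsAdjointPair (totalCut 𝓗 f) (totalCre 𝓗 k) ψ
      (ContinuousLinearMap.adjoint (evol H L h g t) w -
        ∫ s in (0 : ℝ)..t, ⟪k, gAt h g s⟫_ℂ • heis H L h g s L ψ) := by
  obtain ⟨W, hW, he, hd⟩ := exists_totalGroup hH L hu g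
  have hP := isPerturbation_totalInt hH L hu g
  have hk : Continuous fun s => ⟪u (-s) g, k⟫_ℂ := by
    have := continuous_gAt hu g
    simp only [gAt_eq hu] at this
    exact this.inner continuous_const
  have h1 := isAdjointPair_heisenberg hP.cutoff hP.interaction (isLadder_totalCre k)
    (fun n x => congrArg (fun S => S x) (totalCre_mul_totalCut k n))
    (R := fun s => ⟪u (-s) g, k⟫_ℂ • mapT (ContinuousLinearMap.adjoint L) (1 : Fock f →L[ℂ] Fock f))
    (hk.smul continuous_const)
    (fun s n M x hn hx => totalInt_totalCre_sub H L (u (-s) g) k hn hx) hd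
    (continuous_evol hH L hu g) (continuous_adjoint_evol hH L hu g) hp
  have h2 : ∀ s, ContinuousLinearMap.adjoint (evol H L h g s) (ContinuousLinearMap.adjoint
      (⟪u (-s) g, k⟫_ℂ • mapT (ContinuousLinearMap.adjoint L) (1 : Fock f →L[ℂ] Fock f))
        (evol H L h g s ψ)) = ⟪k, gAt h g s⟫_ℂ • heis H L h g s L ψ := fun s => by
    rw [map_smulₛₗ, adjoint_mapT, ContinuousLinearMap.adjoint_adjoint, adjoint_one, smul_apply,
      map_smul, inner_conj_symm, gAt_eq hu, heis, ampliation_eq]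
    rfl
  simp only [h2] at h1
  exact h1

/-- Γ_t U_t = e^{-itH_Tot}, and U_{-t} = Γ_t e^{itH_Tot} undoes it up to Γ_t. The
interaction-picture evolution is not a group, so this takes the place of U_{-t}U_t = 1. -/
theorem evol_neg (hH : IsSelfAdjoint H) (L : 𝓗 →L[ℂ] 𝓗) (hu : IsUnitaryGroupOf h u) (g : f) (t : ℝ)
    (ψ : Total 𝓗 f) : evol H L h g (-t) (freeGroup 𝓗 hu.isUnitaryGroup t (evol H L h g t ψ)) =
      freeGroup 𝓗 hu.isUnitaryGroup t ψ := by
  obtain ⟨W, hW, he, -⟩ := exists_totalGroup hH L hu g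
  have hΓ := (isUnitaryGroupOf_freeGroup (𝓗 := 𝓗) hu).isUnitaryGroup
  rw [he, he, mul_apply_eq_comp, mul_apply_eq_comp, hΓ.apply_apply_neg, hW.apply_neg_apply, neg_neg]

/-- Rotating the pair by Γ_t gives one for u_t k at Γ_t ψ = U_{-t}χ with χ = Γ_t U_t ψ. The forward
lemma at time -t moves it to χ, and rotating back by Γ_{-t} reaches U_t ψ with the original k. -/
theorem exists_isAdjointPair_evol (hH : IsSelfAdjoint H) (L : 𝓗 →L[ℂ] 𝓗) (hu : IsUnitaryGroupOf h u)
    (g k : f) (t : ℝ) {ψ v : Total 𝓗 f} (hp : IsAdjointPair (totalCut 𝓗 f) (totalCre 𝓗 k) ψ v) :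
    ∃ w, IsAdjointPair (totalCut 𝓗 f) (totalCre 𝓗 k) (evol H L h g t ψ) w := by
  have hΓ := (isUnitaryGroupOf_freeGroup (𝓗 := 𝓗) hu).isUnitaryGroup
  have h1 := hp.freeGroup hu t
  rw [← evol_neg hH L hu g t ψ] at h1
  have h2 := (isAdjointPair_evol hH L hu g _ h1).freeGroup hu (-t)
  rw [hu.isUnitaryGroup.apply_neg_apply, hΓ.apply_neg_apply] at h2
  exact ⟨_, h2⟩

theorem mem_graph_adjoint_Zin {g : f} {t : ℝ} {ψ w : Total 𝓗 f} : (ψ, w) ∈ (Zin 𝓗 h g t)†.graph ↔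
    IsAdjointPair (totalCut 𝓗 f) (totalCre 𝓗 (gAt h g t)) ψ w :=
  mem_graph_adjoint_tensorOp_creation

theorem mem_graph_adjoint_Zout (hH : IsSelfAdjoint H) (L : 𝓗 →L[ℂ] 𝓗) (hu : IsUnitaryGroupOf h u)
    {g : f} {t : ℝ} {ψ w : Total 𝓗 f} : (ψ, w) ∈ (Zout H L h g t)†.graph ↔
      IsAdjointPair (totalCut 𝓗 f) (totalCre 𝓗 (gAt h g t)) (evol H L h g t ψ)
        (evol H L h g t w) := by
  rw [← mem_graph_adjoint_Zin (h := h)]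
  exact mem_graph_adjoint_conjOp (evol_mem_unitary hH L hu g t)
    (dense_domain_tensorOp_creation (gAt h g t))

theorem mem_graph_adjoint_Zin_of_Zout (hH : IsSelfAdjoint H) (L : 𝓗 →L[ℂ] 𝓗)
    (hu : IsUnitaryGroupOf h u) {g : f} {t : ℝ} {ψ w : Total 𝓗 f}
    (hp : (ψ, w) ∈ (Zout H L h g t)†.graph) : (ψ, w - ∫ τ in (0 : ℝ)..t,
      bathKernel h g t τ • heis H L h g τ L ψ) ∈ (Zin 𝓗 h g t)†.graph := by
  have h1 := isAdjointPair_evol hH L hu g _ ((mem_graph_adjoint_Zout hH L hu).1 hp)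
  have h2 : ContinuousLinearMap.adjoint (evol H L h g t) (evol H L h g t w) = w :=
    congrArg (fun S => S w) (Unitary.mem_iff.1 (evol_mem_unitary hH L hu g t)).1
  rw [h2] at h1
  exact mem_graph_adjoint_Zin.2 h1

theorem domain_adjoint_Zout (hH : IsSelfAdjoint H) (L : 𝓗 →L[ℂ] 𝓗) (hu : IsUnitaryGroupOf h u)
    (g : f) (t : ℝ) : (Zout H L h g t)†.domain = (Zin 𝓗 h g t)†.domain := by
  ext ψ
  constructor
  · intro hψ
    obtain ⟨w, hw⟩ := LinearPMap.mem_domain_iff.1 hψ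
    exact LinearPMap.mem_domain_of_mem_graph (mem_graph_adjoint_Zin_of_Zout hH L hu hw)
  · intro hψ
    obtain ⟨v, hv⟩ := LinearPMap.mem_domain_iff.1 hψ
    obtain ⟨w, hw⟩ := exists_isAdjointPair_evol hH L hu g _ t (mem_graph_adjoint_Zin.1 hv)
    have h2 : evol H L h g t (ContinuousLinearMap.adjoint (evol H L h g t) w) = w :=
      congrArg (fun S => S w) (Unitary.mem_iff.1 (evol_mem_unitary hH L hu g t)).2
    -- The pair at U_t ψ has second entry w = U_t(U_t* w), the form that the graph of the adjoint of
    -- `Zout` requires.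
    rw [← h2] at hw
    exact LinearPMap.mem_domain_of_mem_graph ((mem_graph_adjoint_Zout hH L hu).2 hw)

theorem adjoint_Zout_apply (hH : IsSelfAdjoint H) (L : 𝓗 →L[ℂ] 𝓗) (hu : IsUnitaryGroupOf h u)
    (g : f) (t : ℝ) (ψ : Total 𝓗 f) (hout : ψ ∈ (Zout H L h g t)†.domain)
    (hin : ψ ∈ (Zin 𝓗 h g t)†.domain) :
    (Zout H L h g t)† ⟨ψ, hout⟩ = (Zin 𝓗 h g t)† ⟨ψ, hin⟩
      + ∫ τ in (0 : ℝ)..t, bathKernel h g t τ • heis H L h g τ L ψ := by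
  have h1 := mem_graph_adjoint_Zin_of_Zout hH L hu ((Zout H L h g t)†.mem_graph ⟨ψ, hout⟩)
  have h2 := (Zin 𝓗 h g t)†.mem_graph_snd_inj h1 ((Zin 𝓗 h g t)†.mem_graph ⟨ψ, hin⟩) rfl
  exact eq_add_of_sub_eq h2

end InputOutput

end OpenSystem

end

/-! ### The input-output relation for a self-adjoint one-particle operator -/

theorem mainTheorem5
    {𝓗 : Type*} [NormedAddCommGroup 𝓗] [InnerProductSpace ℂ 𝓗] [CompleteSpace 𝓗]
    {f : Type*} [NormedAddCommGroup f] [InnerProductSpace ℂ f] [CompleteSpace f]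
    (H : 𝓗 →L[ℂ] 𝓗) (hH : IsSelfAdjoint H) (L : 𝓗 →L[ℂ] 𝓗)
    (h : f →ₗ.[ℂ] f) (hh : IsSelfAdjoint h) (g : f) (t : ℝ) :
    (∀ ψ : OpenSystem.Total 𝓗 f, IntervalIntegrable
      (fun τ => OpenSystem.bathKernel h g t τ • OpenSystem.heis H L h g τ L ψ)
      MeasureTheory.volume 0 t) ∧
    (OpenSystem.Zout H L h g t)†.domain = (OpenSystem.Zin 𝓗 h g t)†.domain ∧
    ∀ (ψ : OpenSystem.Total 𝓗 f) (hout : ψ ∈ (OpenSystem.Zout H L h g t)†.domain)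
      (hin : ψ ∈ (OpenSystem.Zin 𝓗 h g t)†.domain),
      (OpenSystem.Zout H L h g t)† ⟨ψ, hout⟩ = (OpenSystem.Zin 𝓗 h g t)† ⟨ψ, hin⟩
        + ∫ τ in (0 : ℝ)..t, OpenSystem.bathKernel h g t τ • OpenSystem.heis H L h g τ L ψ := by
  -- Stone's theorem for h is the only use of its self-adjointness; everything else is built from
  -- the group u.
  obtain ⟨u, hu⟩ := (OpenSystem.isSymmSurj_of_isSelfAdjoint hh).exists_isUnitaryGroupOf
  refine ⟨fun ψ => Continuous.intervalIntegrable ?_ _ _, OpenSystem.domain_adjoint_Zout hH L hu g t,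
    OpenSystem.adjoint_Zout_apply hH L hu g t⟩
  have hK : Continuous fun τ => OpenSystem.bathKernel h g t τ :=
    Continuous.inner continuous_const (OpenSystem.continuous_gAt hu g)
  exact hK.smul (OpenSystem.continuous_heis hH L hu g L ψ)
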